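/- Let $p\ge 0$ be a fixed integer and, for each $N\ge 1$, let $T=T_N$ be a positive integer, with $T_N/\sqrt N\to\infty$ as $N\to\infty$. For each $N$ consider the panel regression $$y_{it}=x_{it}'\beta_i+\epsilon_{it},\qquad 1\le i\le N,\ 1\le t\le T,$$ with non-random regressors $x_{it}\in\mathbb R^p$ and coefficients $\beta_i\in\mathbb R^p$ (all of these may depend on $N$). Let $\mathbf x_i=(x_{i1},\dots,x_{iT})'$ be the $T\times p$ design matrix, and assume that $\mathbf x_i'\mathbf x_i$ is invertible for every $i$. Put $\mathbf y_i=(y_{i1},\dots,y_{iT})'$ and $\epsilon_i=(\epsilon_{i1},\dots,\epsilon_{iT})'$. Assume that $\epsilon_1,\dots,\epsilon_N$ are independent random vectors with $\epsilon_i\sim N_T(\mathbf 0,\sigma_i^2\mathbf I_T)$, $\sigma_i>0$. Let $\hat\beta_i=(\mathbf x_i'\mathbf x_i)^{-1}\mathbf x_i'\mathbf y_i$ be the least squares estimator, $\hat\epsilon_{it}=y_{it}-x_{it}'\hat\beta_i$ the residuals, $\mathbf P_i=\mathbf I_T-\mathbf x_i(\mathbf x_i'\mathbf x_i)^{-1}\mathbf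 x_i'$ (so that $\hat\beta_i$ is void, $\hat\epsilon_{it}=y_{it}=\epsilon_{it}$ and $\mathbf P_i=\mathbf I_T$ if $p=0$), and $$\hat\rho_{ij}=\frac{\sum_{t=1}^T\hat\epsilon_{it}\hat\epsilon_{jt}}{\sqrt{\sum_{t=1}^T\hat\epsilon_{it}^2}\,\sqrt{\sum_{t=1}^T\hat\epsilon_{jt}^2}},\qquad S_N=\sum_{1\le i<j\le N}T\hat\rho_{ij}^2,\qquad \mu_N=\frac{T}{(T-p)^2}\sum_{1\le i<j\le N}\operatorname{tr}(\mathbf P_i\mathbf P_j).$$ Then $(S_N-\mu_N)/N$ converges to $N(0,1)$ in distribution as $N\to\infty$. -/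

import Mathlib

open MeasureTheory ProbabilityTheory Filter
open scoped Topology Matrix

namespace PanelData

noncomputable section

/-- The ordinary least squares estimator `(x'x)⁻¹ x'y` from the `T × p` design matrix `x`
(whose `t`-th row is the regressor at time `t`) and the responses `y`. -/
def olsEstimator {T p : ℕ} (x : Matrix (Fin T) (Fin p) ℝ) (y : Fin T → ℝ) : Fin p → ℝ :=
  (xᵀ * x)⁻¹ *ᵥ (xᵀ *ᵥ y)

/-- The OLS residuals `y_t - x_t' β̂`, `t = 1, …, T`. -/
def residual {T p : ℕ} (x : Matrix (Fin T) (Fin p) ℝ) (y : Fin T → ℝ) (t : Fin T) : ℝ :=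
  y t - x t ⬝ᵥ olsEstimator x y

/-- The residual projection matrix `P = I_T - x (x'x)⁻¹ x'`; for `p = 0` it is `I_T`. -/
def projMatrix {T p : ℕ} (x : Matrix (Fin T) (Fin p) ℝ) : Matrix (Fin T) (Fin T) ℝ :=
  1 - x * (xᵀ * x)⁻¹ * xᵀ

/-- The sample correlation coefficient of two vectors of residuals `e` and `f`. -/
def sampleCorr {T : ℕ} (e f : Fin T → ℝ) : ℝ :=
  (∑ t, e t * f t) / (√(∑ t, e t ^ 2) * √(∑ t, f t ^ 2))

/-- The statistic `S_N = ∑_{i<j} T ρ̂_{ij}²`, computed from the designs `x_i` and the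
responses `y_i` of the `N` sections. -/
def sumStat {N T p : ℕ} (x : Fin N → Matrix (Fin T) (Fin p) ℝ) (y : Fin N → Fin T → ℝ) : ℝ :=
  ∑ i, ∑ j ∈ Finset.Ioi i,
    (T : ℝ) * sampleCorr (residual (x i) (y i)) (residual (x j) (y j)) ^ 2

/-- The centering `μ_N = T / (T - p)² ∑_{i<j} tr(P_i P_j)`. -/
def centering {N T p : ℕ} (x : Fin N → Matrix (Fin T) (Fin p) ℝ) : ℝ :=
  (T : ℝ) / ((T : ℝ) - (p : ℝ)) ^ 2 *
    ∑ i, ∑ j ∈ Finset.Ioi i, (projMatrix (x i) * projMatrix (x j)).trace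

end

end PanelData

/-!
The residuals of section `i` are `P i *ᵥ ε i`, and the sample correlations depend on them only
through the unit vectors `u i = P i ε i / ‖P i ε i‖`, which are uniform on the unit sphere of the
range of `P i`, a space of dimension `m = T - p`. Since `ρ̂ i j ^ 2` is the Frobenius inner product
of `u i (u i)ᵀ` and `u j (u j)ᵀ`, and `u i (u i)ᵀ` has mean `P i / m`, writing
`A i = u i (u i)ᵀ - P i / m` (`centeredOuter`) splits the statistic into
`(S - μ) / N = (T / N) ∑_{i<j} ⟪A i, A j⟫ - (T / (N m)) ∑ i, ⟪L i, A i⟫`,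
where `L i` is the sum of the projections `1 - P j` over `j ≠ i` (`ae_statistic_eq`): the identity
part of `P j = 1 - (1 - P j)` drops out because `A i` has trace zero almost surely. The second sum
has independent centered terms and standard deviation of order `N ^ (3/2) / T`, so its contribution
is of order `√N / T`, which is where the hypothesis `T / √N → ∞` enters
(`integral_sum_inner_regressorSum_sq_le`).

The first sum is a degenerate cross sum of independent vectors. The direction of a Gaussian vector
is independent of its norm, so the moments of quadratic forms on the sphere are quotients of
Gaussian moments; this gives `𝔼 ⟪z, A i⟫ ^ 2 ≤ κ ‖z‖ ^ 2` with `κ = 2 / (m (m + 2))`, a bound of the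
same strength for the fourth moment (`integral_inner_centeredOuter`), and near equality for `z`
equal to another `A j` on average (`le_integral_integral_inner_centeredOuter_sq`), because any two of
the ranges have a common subspace of codimension at most `2 p`. Moreover `‖A i‖ ^ 2 = 1 - 1 / m`
almost surely. These properties are collected in `IsDegenerateArray`.

For such arrays, put `W k = ∑_{i<k} A i`. The increments `⟪W k, A k⟫` of the cross sum are
martingale differences with conditional variance at most `κ ‖W k‖ ^ 2`, and `‖W k‖ ^ 2` equals
`k (1 - 1 / m)` plus twice the `k`-th cross sum, whose standard deviation is at most `√κ k`. Hence
the conditional variance is close in mean to the number `κ k (1 - 1 / m)`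
(`IsDegenerateArray.integral_abs_condVar_sub_le`), and the characteristic functions of the
successive cross sums satisfy the Gaussian recursion up to errors with a small sum
(`IsDegenerateArray.norm_charFun_step_le`). This yields an explicit bound
(`IsDegenerateArray.norm_charFun_crossSum_sub_le`), whose right-hand side tends to zero after
scaling by `T / N`, while the variance tends to one. Lévy's continuity theorem concludes.
-/

/-! ### Polar coordinates for the standard Gaussian -/

/-- The Lebesgue density of the standard Gaussian on an `n`-dimensional space, as a function of the
norm. -/
noncomputable def stdGaussianRadialDensity (n : ℕ) (r : ℝ) : ℝ :=
  ((Real.pi / (1 / 2)) ^ (n / 2 : ℝ))⁻¹ * Real.exp (-(1 / 2) * r ^ 2)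

section

variable {E : Type*} [NormedAddCommGroup E] [InnerProductSpace ℝ E] [FiniteDimensional ℝ E]
  [MeasurableSpace E] [BorelSpace E]

lemma stdGaussian_eq_withDensity :
    stdGaussian E = (volume : Measure E).withDensity
      (fun x => ENNReal.ofReal (stdGaussianRadialDensity (Module.finrank ℝ E) ‖x‖)) := by
  have hint : Integrable (fun x : E => stdGaussianRadialDensity (Module.finrank ℝ E) ‖x‖) := by
    have h := GaussianFourier.integrable_cexp_neg_mul_sq_norm_add (V := E) (b := 1 / 2)
      (by norm_num) 0 0
    refine (h.norm.congr ?_).const_mul _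
    filter_upwards with x
    rw [Complex.norm_exp]
    congr 1
    simp
    norm_cast
  have hnn : ∀ x : E, 0 ≤ stdGaussianRadialDensity (Module.finrank ℝ E) ‖x‖ := fun x => by
    unfold stdGaussianRadialDensity; positivity
  have hfin : IsFiniteMeasure ((volume : Measure E).withDensity
      (fun x => ENNReal.ofReal (stdGaussianRadialDensity (Module.finrank ℝ E) ‖x‖))) :=
    isFiniteMeasure_withDensity_ofReal hint.2
  refine Measure.ext_of_charFun ?_
  ext t
  rw [charFun_stdGaussian, charFun_apply, integral_withDensity_eq_integral_toReal_smul
    (by unfold stdGaussianRadialDensity; fun_prop) (by simp)]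
  have h := GaussianFourier.integral_cexp_neg_mul_sq_norm_add (V := E) (b := 1 / 2)
      (by norm_num) Complex.I t
  have h2 : ∀ x : E, (ENNReal.ofReal (stdGaussianRadialDensity (Module.finrank ℝ E) ‖x‖)).toReal •
      Complex.exp (inner ℝ x t * Complex.I) =
      ((((Real.pi / (1 / 2)) ^ ((Module.finrank ℝ E) / 2 : ℝ))⁻¹ : ℝ) : ℂ) *
      Complex.exp (-(1 / 2) * (‖x‖ : ℂ) ^ 2 + Complex.I * inner ℝ t x) := by
    intro x
    rw [ENNReal.toReal_ofReal (hnn x), stdGaussianRadialDensity, Complex.real_smul, Complex.exp_add,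
      real_inner_comm, mul_comm Complex.I]
    push_cast
    ring
  simp_rw [h2]
  rw [integral_const_mul, h, ← mul_assoc]
  have h3 : ((((Real.pi / (1 / 2)) ^ ((Module.finrank ℝ E) / 2 : ℝ))⁻¹ : ℝ) : ℂ) *
      ((Real.pi / (1 / 2) : ℂ) ^ ((Module.finrank ℝ E) / 2 : ℂ)) = 1 := by
    have hpos : (0 : ℝ) < (Real.pi / (1 / 2)) ^ ((Module.finrank ℝ E) / 2 : ℝ) := by positivity
    have : ((Real.pi / (1 / 2) : ℂ) ^ ((Module.finrank ℝ E) / 2 : ℂ)) =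
        (((Real.pi / (1 / 2)) ^ ((Module.finrank ℝ E) / 2 : ℝ) : ℝ) : ℂ) := by
      rw [Complex.ofReal_cpow (by positivity)]
      push_cast
      rfl
    rw [this, ← Complex.ofReal_mul, inv_mul_cancel₀ hpos.ne', Complex.ofReal_one]
  rw [h3, one_mul]
  congr 1
  rw [Complex.I_sq]
  ring

lemma integral_stdGaussian_eq_integral_mul (f : E → ℝ) :
    ∫ x, f x ∂(stdGaussian E) =
      ∫ x, stdGaussianRadialDensity (Module.finrank ℝ E) ‖x‖ * f x := by
  have hnn : ∀ x : E, 0 ≤ stdGaussianRadialDensity (Module.finrank ℝ E) ‖x‖ := fun x => by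
    unfold stdGaussianRadialDensity; positivity
  rw [stdGaussian_eq_withDensity, integral_withDensity_eq_integral_toReal_smul
    (by unfold stdGaussianRadialDensity; fun_prop) (by simp)]
  simp_rw [ENNReal.toReal_ofReal (hnn _), smul_eq_mul]

/-- Integration in polar coordinates of a product of a function of the direction and a
function of the norm. -/
lemma integral_direction_mul_norm [Nontrivial E] (f : E → ℝ) (h : ℝ → ℝ) :
    ∫ x : E, f (‖x‖⁻¹ • x) * h ‖x‖ =
      (∫ y, f y.1 ∂(volume : Measure E).toSphere) *
        ∫ r : Set.Ioi (0 : ℝ), h r ∂(Measure.volumeIoiPow (Module.finrank ℝ E - 1)) := by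
  calc ∫ x : E, f (‖x‖⁻¹ • x) * h ‖x‖
      = ∫ x : ({(0 : E)}ᶜ : Set E), f (‖x.1‖⁻¹ • x.1) * h ‖x.1‖
          ∂((volume : Measure E).comap (↑)) := by
        rw [integral_subtype_comap (measurableSet_singleton _).compl
          fun x => f (‖x‖⁻¹ • x) * h ‖x‖, restrict_compl_singleton]
    _ = ∫ z : Metric.sphere (0 : E) 1 × Set.Ioi (0 : ℝ), f z.1.1 * h z.2.1
          ∂((volume : Measure E).toSphere.prod
            (Measure.volumeIoiPow (Module.finrank ℝ E - 1))) := by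
        simpa using (volume : Measure E).measurePreserving_homeomorphUnitSphereProd.integral_comp
          (Homeomorph.measurableEmbedding _)
          (fun z : Metric.sphere (0 : E) 1 × Set.Ioi (0 : ℝ) => f z.1.1 * h z.2.1)
    _ = _ := integral_prod_mul (fun y : Metric.sphere (0 : E) 1 => f y.1)
          (fun r : Set.Ioi (0 : ℝ) => h r.1)

/-- The direction and the norm of a standard Gaussian vector are independent. No integrability is
needed: both sides factor as Bochner integrals over a product space. -/
lemma integral_stdGaussian_direction_mul_norm [Nontrivial E] (f : E → ℝ) (h : ℝ → ℝ) :
    ∫ x, f (‖x‖⁻¹ • x) * h ‖x‖ ∂(stdGaussian E) =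
      (∫ x, f (‖x‖⁻¹ • x) ∂(stdGaussian E)) * ∫ x, h ‖x‖ ∂(stdGaussian E) := by
  have key : ∀ (f : E → ℝ) (h : ℝ → ℝ), ∫ x, f (‖x‖⁻¹ • x) * h ‖x‖ ∂(stdGaussian E) =
      (∫ y, f y.1 ∂(volume : Measure E).toSphere) *
        ∫ r : Set.Ioi (0 : ℝ), stdGaussianRadialDensity (Module.finrank ℝ E) r * h r
          ∂(Measure.volumeIoiPow (Module.finrank ℝ E - 1)) := by
    intro f h
    rw [integral_stdGaussian_eq_integral_mul, ← integral_direction_mul_norm f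
      (fun r => stdGaussianRadialDensity (Module.finrank ℝ E) r * h r)]
    congr 1
    ext x
    ring
  have h1 := key f (fun _ => 1)
  have h2 := key (fun _ => 1) h
  have h3 := key (fun _ => 1) (fun _ => 1)
  simp only [mul_one, one_mul] at h1 h2
  simp only [mul_one, integral_const, probReal_univ, smul_eq_mul] at h3
  rw [key, h1, h2]
  simp only [integral_const, smul_eq_mul, mul_one] at h2 ⊢
  linear_combination (∫ y, f y.1 ∂(volume : Measure E).toSphere) *
        (∫ r : Set.Ioi (0 : ℝ), stdGaussianRadialDensity (Module.finrank ℝ E) r * h r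
          ∂(Measure.volumeIoiPow (Module.finrank ℝ E - 1))) * h3

end

/-! ### Gaussian moments -/

lemma integrable_pow_gaussianReal (n : ℕ) : Integrable (fun x : ℝ => x ^ n) (gaussianReal 0 1) := by
  have h := memLp_id_gaussianReal' (μ := 0) (v := 1) (n : ENNReal) (by simp)
  rcases Nat.eq_zero_or_pos n with rfl | hn
  · simp
  · have := h.integrable_norm_pow (by omega)
    refine this.mono' (by fun_prop) ?_
    filter_upwards with x
    simp

/-- Integration by parts against the Gaussian density. -/
lemma integral_pow_add_two_gaussianReal (n : ℕ) :
    ∫ x : ℝ, x ^ (n + 2) ∂(gaussianReal 0 1) = (n + 1) * ∫ x : ℝ, x ^ n ∂(gaussianReal 0 1) := by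
  have hint : ∀ k : ℕ, Integrable (fun x : ℝ => x ^ k * gaussianPDFReal 0 1 x) := by
    intro k
    have h := integrable_pow_gaussianReal k
    rw [gaussianReal_of_var_ne_zero _ one_ne_zero, gaussianPDF_def,
      integrable_withDensity_iff_integrable_smul' (by fun_prop) (by simp)] at h
    refine h.congr ?_
    filter_upwards with x
    rw [ENNReal.toReal_ofReal (gaussianPDFReal_nonneg 0 1 x), smul_eq_mul, mul_comm]
  rw [integral_gaussianReal_eq_integral_smul one_ne_zero,
    integral_gaussianReal_eq_integral_smul one_ne_zero]
  have hderiv : ∀ x : ℝ, HasDerivAt (gaussianPDFReal 0 1) (-(x * gaussianPDFReal 0 1 x)) x := by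
    intro x
    unfold gaussianPDFReal
    have h : HasDerivAt (fun x : ℝ => -(x - 0) ^ 2 / (2 * ((1 : NNReal) : ℝ))) (-x) x := by
      have := ((hasDerivAt_id x).sub_const 0).pow 2 |>.neg.div_const (2 * ((1 : NNReal) : ℝ))
      refine this.congr_deriv ?_
      simp
      ring
    refine (h.exp.const_mul _).congr_deriv ?_
    ring
  have h := integral_mul_deriv_eq_deriv_mul_of_integrable (u := fun x : ℝ => x ^ (n + 1))
    (v := gaussianPDFReal 0 1) (u' := fun x => ((n + 1 : ℕ) : ℝ) * x ^ n)
    (v' := fun x => -(x * gaussianPDFReal 0 1 x))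
    (fun x _ => by simpa using hasDerivAt_pow (n + 1) x) (fun x _ => hderiv x)
    (((hint (n + 2)).neg).congr (by filter_upwards with x; simp; ring))
    (((hint n).const_mul ((n + 1 : ℕ) : ℝ)).congr (by filter_upwards with x; simp; ring))
    ((hint (n + 1)).congr (by filter_upwards with x; simp))
  have h1 : ∫ x : ℝ, gaussianPDFReal 0 1 x • x ^ (n + 2) =
      -∫ x : ℝ, x ^ (n + 1) * -(x * gaussianPDFReal 0 1 x) := by
    rw [← integral_neg]
    congr 1
    ext x
    simp only [smul_eq_mul]
    ring
  rw [h1, h, neg_neg, ← integral_const_mul]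
  congr 1
  ext x
  simp only [smul_eq_mul]
  push_cast
  ring

lemma integral_sq_sub_one_gaussianReal :
    ∫ x : ℝ, (x ^ 2 - 1) ∂(gaussianReal 0 1) = 0 ∧
    ∫ x : ℝ, (x ^ 2 - 1) ^ 2 ∂(gaussianReal 0 1) = 2 ∧
    ∫ x : ℝ, (x ^ 2 - 1) ^ 4 ∂(gaussianReal 0 1) = 60 := by
  have i := integrable_pow_gaussianReal
  have m0 : ∫ x : ℝ, x ^ 0 ∂(gaussianReal 0 1) = 1 := by simp
  have m2 := integral_pow_add_two_gaussianReal 0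
  have m4 := integral_pow_add_two_gaussianReal 2
  have m6 := integral_pow_add_two_gaussianReal 4
  have m8 := integral_pow_add_two_gaussianReal 6
  norm_num at m2 m4 m6 m8
  rw [m2] at m4
  rw [m4] at m6
  rw [m6] at m8
  have hpow : ∀ n : ℕ, ∫ x : ℝ, (x ^ 2 - 1) ^ n ∂(gaussianReal 0 1) =
      ∑ m ∈ Finset.range (n + 1),
        (∫ x : ℝ, x ^ (2 * m) ∂(gaussianReal 0 1)) * (-1) ^ (n - m) * (n.choose m : ℝ) := by
    intro n
    simp_rw [sub_eq_add_neg, add_pow, ← pow_mul]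
    rw [integral_finsetSum _ fun m _ => ((i _).mul_const _).mul_const _]
    simp_rw [integral_mul_const]
  refine ⟨?_, ?_, ?_⟩
  · simpa [Finset.sum_range_succ, m2] using hpow 1
  · rw [hpow 2]
    norm_num [Finset.sum_range_succ, m2, m4]
  · rw [hpow 4]
    norm_num [Finset.sum_range_succ, m2, m4, m6, m8, Nat.choose]

/-- Moments of linear combinations of independent centered variables with second moment `2` and
fourth moment `60`, as for the variables `g ^ 2 - 1` with `g` standard Gaussian. In the fourth
moment the mixed terms contribute `6 * 2 * 2 = 24` each, less than the `120` of the bound. -/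
lemma integral_sum_pow_of_iIndepFun {Ω ι : Type*} [MeasurableSpace Ω] [DecidableEq ι]
    {P : Measure Ω} [IsProbabilityMeasure P] {X : ι → Ω → ℝ} (hX : ∀ i, Measurable (X i))
    (hind : iIndepFun X P) (hint : ∀ i (n : ℕ), Integrable (fun ω => X i ω ^ n) P)
    (h1 : ∀ i, ∫ ω, X i ω ∂P = 0) (h2 : ∀ i, ∫ ω, X i ω ^ 2 ∂P = 2)
    (h4 : ∀ i, ∫ ω, X i ω ^ 4 ∂P = 60) (l : ι → ℝ) (s : Finset ι) :
    (∀ n ≤ 4, Integrable (fun ω => (∑ i ∈ s, l i * X i ω) ^ n) P) ∧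
    ∫ ω, ∑ i ∈ s, l i * X i ω ∂P = 0 ∧
    ∫ ω, (∑ i ∈ s, l i * X i ω) ^ 2 ∂P = 2 * ∑ i ∈ s, l i ^ 2 ∧
    ∫ ω, (∑ i ∈ s, l i * X i ω) ^ 4 ∂P ≤ 60 * (∑ i ∈ s, l i ^ 2) ^ 2 := by
  induction s using Finset.induction_on with
  | empty => simp
  | insert a s ha ih =>
    obtain ⟨ihi, ih1, ih2, ih4⟩ := ih
    have hind' : IndepFun (fun ω => ∑ i ∈ s, l i * X i ω) (fun ω => l a * X a ω) P := by
      have h := (hind.comp (fun i x => l i * x) (fun i => by fun_prop)).indepFun_finsetSum_of_notMem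
        (fun i => by simp only [Function.comp_def]; fun_prop) ha
      convert h using 1
      · ext ω
        simp
      · rfl
    set S : Ω → ℝ := fun ω => ∑ i ∈ s, l i * X i ω with hS
    set Y : Ω → ℝ := fun ω => l a * X a ω with hY
    replace ih1 : ∫ ω, S ω ∂P = 0 := ih1
    replace ih2 : ∫ ω, S ω ^ 2 ∂P = 2 * ∑ i ∈ s, l i ^ 2 := ih2
    replace ih4 : ∫ ω, S ω ^ 4 ∂P ≤ 60 * (∑ i ∈ s, l i ^ 2) ^ 2 := ih4
    have hSY : ∀ ω, ∑ i ∈ insert a s, l i * X i ω = S ω + Y ω := by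
      intro ω
      rw [Finset.sum_insert ha, add_comm]
    have hYi : ∀ n : ℕ, Integrable (fun ω => Y ω ^ n) P := by
      intro n
      simp only [hY, mul_pow]
      exact (hint a n).const_mul _
    have hind2 : ∀ b c : ℕ, IndepFun (fun ω => S ω ^ b) (fun ω => Y ω ^ c) P := fun b c =>
      hind'.comp (φ := fun x => x ^ b) (ψ := fun x => x ^ c) (by fun_prop) (by fun_prop)
    have hprod : ∀ b c : ℕ, b ≤ 4 → Integrable (fun ω => S ω ^ b * Y ω ^ c) P := fun b c hb =>
      (hind2 b c).integrable_mul (ihi b hb) (hYi c)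
    have hval : ∀ b c : ℕ, b ≤ 4 → ∫ ω, S ω ^ b * Y ω ^ c ∂P =
        (∫ ω, S ω ^ b ∂P) * ∫ ω, Y ω ^ c ∂P := fun b c hb =>
      (hind2 b c).integral_fun_mul_eq_mul_integral (ihi b hb).1 (hYi c).1
    have hexp : ∀ n : ℕ, ∀ ω, (S ω + Y ω) ^ n =
        ∑ m ∈ Finset.range (n + 1), S ω ^ m * Y ω ^ (n - m) * (n.choose m : ℝ) := fun n ω =>
      add_pow _ _ _
    have hintterm : ∀ n ≤ 4, ∀ m ∈ Finset.range (n + 1),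
        Integrable (fun ω => S ω ^ m * Y ω ^ (n - m) * (n.choose m : ℝ)) P := by
      intro n hn m hm
      exact (hprod m (n - m) (by simp at hm; omega)).mul_const _
    have hpow : ∀ n ≤ 4, ∫ ω, (S ω + Y ω) ^ n ∂P = ∑ m ∈ Finset.range (n + 1),
        (∫ ω, S ω ^ m ∂P) * (∫ ω, Y ω ^ (n - m) ∂P) * (n.choose m : ℝ) := by
      intro n hn
      simp_rw [hexp]
      rw [integral_finsetSum _ (hintterm n hn)]
      refine Finset.sum_congr rfl fun m hm => ?_
      rw [integral_mul_const, hval _ _ (by simp at hm; omega)]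
    have y1 : ∫ ω, Y ω ∂P = 0 := by simp only [hY, integral_const_mul, h1, mul_zero]
    have y2 : ∫ ω, Y ω ^ 2 ∂P = 2 * l a ^ 2 := by
      simp only [hY, mul_pow, integral_const_mul, h2]; ring
    have y4 : ∫ ω, Y ω ^ 4 ∂P = 60 * l a ^ 4 := by
      simp only [hY, mul_pow, integral_const_mul, h4]; ring
    simp_rw [hSY, Finset.sum_insert ha]
    refine ⟨fun n hn => ?_, ?_, ?_, ?_⟩
    · simp_rw [hexp]
      exact integrable_finsetSum _ (hintterm n hn)
    · have := hpow 1 (by norm_num)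
      simpa [Finset.sum_range_succ, y1, ih1] using this
    · have := hpow 2 (by norm_num)
      simp [Finset.sum_range_succ, y1, ih1, y2, ih2] at this
      rw [this]; ring
    · have := hpow 4 (by norm_num)
      simp [Finset.sum_range_succ, y1, ih1, y2, y4, ih2, Nat.choose] at this
      rw [this]
      have hnn : 0 ≤ ∑ i ∈ s, l i ^ 2 := Finset.sum_nonneg fun i _ => sq_nonneg _
      nlinarith [mul_nonneg (sq_nonneg (l a)) hnn]

lemma integral_sum_mul_sq_sub_one_stdGaussian {ι : Type*} [Fintype ι] (l : ι → ℝ) :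
    (∀ n ≤ 4, Integrable (fun x : EuclideanSpace ℝ ι => (∑ i, l i * (x i ^ 2 - 1)) ^ n)
      (stdGaussian (EuclideanSpace ℝ ι))) ∧
    ∫ x, ∑ i, l i * (x i ^ 2 - 1) ∂(stdGaussian (EuclideanSpace ℝ ι)) = 0 ∧
    ∫ x, (∑ i, l i * (x i ^ 2 - 1)) ^ 2 ∂(stdGaussian (EuclideanSpace ℝ ι)) =
      2 * ∑ i, l i ^ 2 ∧
    ∫ x, (∑ i, l i * (x i ^ 2 - 1)) ^ 4 ∂(stdGaussian (EuclideanSpace ℝ ι)) ≤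
      60 * (∑ i, l i ^ 2) ^ 2 := by
  classical
  let γ : Measure (ι → ℝ) := Measure.pi (fun _ => gaussianReal 0 1)
  obtain ⟨g1, g2, g4⟩ := integral_sq_sub_one_gaussianReal
  have hcoord : ∀ (i : ι) (f : ℝ → ℝ), AEStronglyMeasurable f (gaussianReal 0 1) →
      ∫ x : ι → ℝ, f (x i) ∂γ = ∫ x, f x ∂(gaussianReal 0 1) := fun i f hf =>
    integral_comp_eval hf
  have h := integral_sum_pow_of_iIndepFun (P := γ) (X := fun (i : ι) (x : ι → ℝ) => x i ^ 2 - 1)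
    (fun i => by fun_prop)
    (iIndepFun_pi (X := fun _ (x : ℝ) => x ^ 2 - 1) (fun i => by fun_prop))
    (fun i n => by
      have h0 : Integrable (fun x : ℝ => (x ^ 2 - 1) ^ n) (gaussianReal 0 1) := by
        simp_rw [sub_eq_add_neg, add_pow, ← pow_mul]
        exact integrable_finsetSum _ fun m _ =>
          ((integrable_pow_gaussianReal _).mul_const _).mul_const _
      exact integrable_comp_eval (i := i) (μ := fun _ : ι => gaussianReal 0 1)
        (f := fun x : ℝ => (x ^ 2 - 1) ^ n) h0)
    (fun i => by rw [hcoord i (fun x => x ^ 2 - 1) (by fun_prop), g1])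
    (fun i => by rw [hcoord i (fun x => (x ^ 2 - 1) ^ 2) (by fun_prop), g2])
    (fun i => by rw [hcoord i (fun x => (x ^ 2 - 1) ^ 4) (by fun_prop), g4]) l Finset.univ
  have hmap := map_pi_eq_stdGaussian (ι := ι)
  have hmeas : Measurable (WithLp.toLp 2 : (ι → ℝ) → EuclideanSpace ℝ ι) := by fun_prop
  rw [← hmap]
  refine ⟨fun n hn => ?_, ?_, ?_, ?_⟩
  · rw [integrable_map_measure (by fun_prop) hmeas.aemeasurable]
    exact h.1 n hn
  · rw [integral_map hmeas.aemeasurable (by fun_prop)]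
    exact h.2.1
  · rw [integral_map hmeas.aemeasurable (by fun_prop)]
    exact h.2.2.1
  · rw [integral_map hmeas.aemeasurable (by fun_prop)]
    exact h.2.2.2

/-! ### Quadratic forms in a uniform direction -/

lemma stdGaussian_ae_ne_zero {E : Type*} [NormedAddCommGroup E] [InnerProductSpace ℝ E]
    [FiniteDimensional ℝ E] [MeasurableSpace E] [BorelSpace E] [Nontrivial E] :
    ∀ᵐ x ∂(stdGaussian E), x ≠ 0 := by
  have hac : stdGaussian E ≪ (volume : Measure E) := by
    rw [stdGaussian_eq_withDensity]
    exact withDensity_absolutelyContinuous _ _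
  have h : ∀ᵐ x ∂(volume : Measure E), x ≠ 0 := by simp [ae_iff]
  exact hac.ae_le h

section

variable {ι : Type*} [Fintype ι]

/-- Moments of the norm of a standard Gaussian vector; for the eighth moment the lower bound given
by the square of the fourth suffices. -/
lemma integral_norm_sq_stdGaussian :
    ∫ x, ‖x‖ ^ 2 ∂(stdGaussian (EuclideanSpace ℝ ι)) = Fintype.card ι ∧
    ∫ x, ‖x‖ ^ 4 ∂(stdGaussian (EuclideanSpace ℝ ι)) =
      (Fintype.card ι : ℝ) * (Fintype.card ι + 2) ∧
    ((Fintype.card ι : ℝ) * (Fintype.card ι + 2)) ^ 2 ≤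
      ∫ x, ‖x‖ ^ 8 ∂(stdGaussian (EuclideanSpace ℝ ι)) := by
  obtain ⟨hi, h1, h2, -⟩ := integral_sum_mul_sq_sub_one_stdGaussian (fun _ : ι => (1 : ℝ))
  set n : ℝ := ((Fintype.card ι : ℕ) : ℝ) with hn
  have hX : ∀ x : EuclideanSpace ℝ ι, ∑ i, (1 : ℝ) * (x i ^ 2 - 1) = ‖x‖ ^ 2 - n := by
    intro x
    simp [EuclideanSpace.real_norm_sq_eq, hn]
  simp_rw [hX] at hi h1 h2
  set X : EuclideanSpace ℝ ι → ℝ := fun x => ‖x‖ ^ 2 - n with hXdef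
  have i1 : Integrable X (stdGaussian (EuclideanSpace ℝ ι)) := by simpa using hi 1 (by norm_num)
  have i2 : Integrable (fun x => X x ^ 2) (stdGaussian (EuclideanSpace ℝ ι)) := hi 2 (by norm_num)
  have i3 : Integrable (fun x => X x ^ 3) (stdGaussian (EuclideanSpace ℝ ι)) := hi 3 (by norm_num)
  have i4 : Integrable (fun x => X x ^ 4) (stdGaussian (EuclideanSpace ℝ ι)) := hi 4 (by norm_num)
  have e2 : ∀ x : EuclideanSpace ℝ ι, ‖x‖ ^ 2 = X x + n := fun x => by simp [hXdef]
  have e4 : ∀ x : EuclideanSpace ℝ ι, ‖x‖ ^ 4 = X x ^ 2 + (2 * n * X x + n ^ 2) := fun x => by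
    have : ‖x‖ ^ 4 = (‖x‖ ^ 2) ^ 2 := by ring
    rw [this, e2]; ring
  have e8 : ∀ x : EuclideanSpace ℝ ι, ‖x‖ ^ 8 = X x ^ 4 + (4 * n * X x ^ 3 +
      (6 * n ^ 2 * X x ^ 2 + (4 * n ^ 3 * X x + n ^ 4))) := fun x => by
    have : ‖x‖ ^ 8 = (‖x‖ ^ 2) ^ 4 := by ring
    rw [this, e2]; ring
  have i8 : Integrable (fun x : EuclideanSpace ℝ ι => ‖x‖ ^ 8)
      (stdGaussian (EuclideanSpace ℝ ι)) := by
    simp_rw [e8]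
    exact i4.add ((i3.const_mul _).add ((i2.const_mul _).add ((i1.const_mul _).add
      (integrable_const _))))
  have i4' : Integrable (fun x : EuclideanSpace ℝ ι => ‖x‖ ^ 4)
      (stdGaussian (EuclideanSpace ℝ ι)) := by
    simp_rw [e4]
    exact i2.add ((i1.const_mul _).add (integrable_const _))
  have h1' : ∫ x, X x ∂(stdGaussian (EuclideanSpace ℝ ι)) = 0 := h1
  have h2' : ∫ x, X x ^ 2 ∂(stdGaussian (EuclideanSpace ℝ ι)) = 2 * n := by
    rw [h2]; simp [hn]
  have r2 : ∫ x, ‖x‖ ^ 2 ∂(stdGaussian (EuclideanSpace ℝ ι)) = n := by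
    simp_rw [e2]
    rw [integral_add i1 (integrable_const _), h1']
    simp
  have r4 : ∫ x, ‖x‖ ^ 4 ∂(stdGaussian (EuclideanSpace ℝ ι)) = n * (n + 2) := by
    have i5 : Integrable (fun x => 2 * n * X x + n ^ 2) (stdGaussian (EuclideanSpace ℝ ι)) :=
      (i1.const_mul _).add (integrable_const _)
    simp_rw [e4]
    rw [integral_add i2 i5,
      integral_add (i1.const_mul _) (integrable_const _), integral_const_mul, h1', h2']
    simp
    ring
  refine ⟨r2, r4, ?_⟩
  -- the variance of `‖x‖⁴` is nonnegative
  have hvar : 0 ≤ ∫ x, (‖x‖ ^ 4 - n * (n + 2)) ^ 2 ∂(stdGaussian (EuclideanSpace ℝ ι)) :=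
    integral_nonneg fun x => sq_nonneg _
  have hexp : ∀ x : EuclideanSpace ℝ ι, (‖x‖ ^ 4 - n * (n + 2)) ^ 2 =
      ‖x‖ ^ 8 - (2 * (n * (n + 2)) * ‖x‖ ^ 4 - (n * (n + 2)) ^ 2) := fun x => by ring
  have i5 : Integrable (fun x : EuclideanSpace ℝ ι =>
      2 * (n * (n + 2)) * ‖x‖ ^ 4 - (n * (n + 2)) ^ 2) (stdGaussian (EuclideanSpace ℝ ι)) :=
    (i4'.const_mul _).sub (integrable_const _)
  simp_rw [hexp] at hvar
  rw [integral_sub i8 i5,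
    integral_sub (i4'.const_mul _) (integrable_const _), integral_const_mul, r4] at hvar
  simp at hvar
  nlinarith

lemma sum_mul_direction_sq_mul_norm_sq (l : ι → ℝ) (x : EuclideanSpace ℝ ι) :
    (∑ i, l i * ((‖x‖⁻¹ • x) i) ^ 2) * ‖x‖ ^ 2 = ∑ i, l i * x i ^ 2 := by
  rcases eq_or_ne x 0 with rfl | hx
  · simp
  · have : ‖x‖ ≠ 0 := norm_ne_zero_iff.2 hx
    rw [Finset.sum_mul]
    refine Finset.sum_congr rfl fun i _ => ?_
    simp only [PiLp.smul_apply, smul_eq_mul]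
    field_simp

/-- For coefficients `l` of sum zero, `∑ l i (x i ^ 2 - 1) = ‖x‖ ^ 2 ∑ l i v i ^ 2` where `v` is the
direction of `x`. As `v` and `‖x‖` are independent, the moments of the quadratic form in `v` are
quotients of Gaussian moments. -/
lemma integral_sum_mul_direction_sq_of_sum_eq_zero [Nonempty ι] (l : ι → ℝ)
    (hl : ∑ i, l i = 0) :
    ∫ x, ∑ i, l i * ((‖x‖⁻¹ • x) i) ^ 2 ∂(stdGaussian (EuclideanSpace ℝ ι)) = 0 ∧
    ∫ x, (∑ i, l i * ((‖x‖⁻¹ • x) i) ^ 2) ^ 2 ∂(stdGaussian (EuclideanSpace ℝ ι)) =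
      2 / ((Fintype.card ι : ℝ) * (Fintype.card ι + 2)) * ∑ i, l i ^ 2 ∧
    ∫ x, (∑ i, l i * ((‖x‖⁻¹ • x) i) ^ 2) ^ 4 ∂(stdGaussian (EuclideanSpace ℝ ι)) ≤
      15 * (2 / ((Fintype.card ι : ℝ) * (Fintype.card ι + 2)) * ∑ i, l i ^ 2) ^ 2 := by
  obtain ⟨-, h1, h2, h4⟩ := integral_sum_mul_sq_sub_one_stdGaussian l
  obtain ⟨r2, r4, r8⟩ := integral_norm_sq_stdGaussian (ι := ι)
  have hn : (0 : ℝ) < Fintype.card ι := by exact_mod_cast Fintype.card_pos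
  set n : ℝ := ((Fintype.card ι : ℕ) : ℝ)
  have key : ∀ q : ℕ, ∫ x, (∑ i, l i * (x i ^ 2 - 1)) ^ q ∂(stdGaussian (EuclideanSpace ℝ ι)) =
      (∫ x, (∑ i, l i * ((‖x‖⁻¹ • x) i) ^ 2) ^ q ∂(stdGaussian (EuclideanSpace ℝ ι))) *
        ∫ x, ‖x‖ ^ (2 * q) ∂(stdGaussian (EuclideanSpace ℝ ι)) := by
    intro q
    rw [← integral_stdGaussian_direction_mul_norm
      (fun v : EuclideanSpace ℝ ι => (∑ i, l i * (v i) ^ 2) ^ q) (fun r => r ^ (2 * q))]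
    congr 1
    ext x
    rw [pow_mul, ← mul_pow, sum_mul_direction_sq_mul_norm_sq]
    simp [mul_sub, hl]
  have k1 := key 1
  have k2 := key 2
  have k4 := key 4
  simp only [pow_one, mul_one] at k1
  norm_num at k2 k4
  rw [h1, r2] at k1
  rw [h2, r4] at k2
  have hnn : 0 < n * (n + 2) := by positivity
  refine ⟨?_, ?_, ?_⟩
  · rcases mul_eq_zero.1 k1.symm with h | h
    · exact h
    · exact absurd h hn.ne'
  · simp only [PiLp.smul_apply, smul_eq_mul]
    rw [div_mul_eq_mul_div, eq_div_iff hnn.ne', k2]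
  · have hf : 0 ≤ ∫ x, (∑ i, l i * ((‖x‖⁻¹ • x) i) ^ 2) ^ 4
        ∂(stdGaussian (EuclideanSpace ℝ ι)) := integral_nonneg fun x => by positivity
    simp only [PiLp.smul_apply, smul_eq_mul] at hf ⊢
    rw [k4] at h4
    have h5 := (mul_le_mul_of_nonneg_left r8 hf).trans h4
    rw [← le_div_iff₀ (by positivity)] at h5
    refine h5.trans (le_of_eq ?_)
    field_simp
    ring

/-- Moments of a quadratic form, diagonal in the standard basis, of the direction of a
standard Gaussian vector, that is, of a uniform point on the sphere. -/
lemma integral_sum_mul_direction_sq_sub [Nonempty ι] (l : ι → ℝ) :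
    ∫ x, (∑ i, l i * ((‖x‖⁻¹ • x) i) ^ 2 - (∑ i, l i) / Fintype.card ι)
      ∂(stdGaussian (EuclideanSpace ℝ ι)) = 0 ∧
    ∫ x, (∑ i, l i * ((‖x‖⁻¹ • x) i) ^ 2 - (∑ i, l i) / Fintype.card ι) ^ 2
      ∂(stdGaussian (EuclideanSpace ℝ ι)) =
      2 / ((Fintype.card ι : ℝ) * (Fintype.card ι + 2)) *
        (∑ i, l i ^ 2 - (∑ i, l i) ^ 2 / Fintype.card ι) ∧
    ∫ x, (∑ i, l i * ((‖x‖⁻¹ • x) i) ^ 2 - (∑ i, l i) / Fintype.card ι) ^ 4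
      ∂(stdGaussian (EuclideanSpace ℝ ι)) ≤
      15 * (2 / ((Fintype.card ι : ℝ) * (Fintype.card ι + 2)) * ∑ i, l i ^ 2) ^ 2 := by
  have hn : (0 : ℝ) < Fintype.card ι := by exact_mod_cast Fintype.card_pos
  set n : ℝ := ((Fintype.card ι : ℕ) : ℝ) with hndef
  have hsum : ∑ i, (l i - (∑ i, l i) / n) = 0 := by
    rw [Finset.sum_sub_distrib, Finset.sum_const, Finset.card_univ, nsmul_eq_mul, ← hndef]
    field_simp
    ring
  have hsq : ∑ i, (l i - (∑ i, l i) / n) ^ 2 = ∑ i, l i ^ 2 - (∑ i, l i) ^ 2 / n := by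
    simp_rw [sub_sq]
    rw [Finset.sum_add_distrib, Finset.sum_sub_distrib, Finset.sum_const, Finset.card_univ,
      nsmul_eq_mul, ← hndef, ← Finset.sum_mul, ← Finset.mul_sum]
    field_simp
    ring
  obtain ⟨h1, h2, h4⟩ := integral_sum_mul_direction_sq_of_sum_eq_zero _ hsum
  have hae : ∀ᵐ x ∂(stdGaussian (EuclideanSpace ℝ ι)),
      ∑ i, l i * ((‖x‖⁻¹ • x) i) ^ 2 - (∑ i, l i) / n =
        ∑ i, (l i - (∑ i, l i) / n) * ((‖x‖⁻¹ • x) i) ^ 2 := by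
    filter_upwards [stdGaussian_ae_ne_zero] with x hx
    have h : ∑ i, ((‖x‖⁻¹ • x) i) ^ 2 = 1 := by
      rw [← EuclideanSpace.real_norm_sq_eq, norm_smul, norm_inv, norm_norm,
        inv_mul_cancel₀ (norm_ne_zero_iff.2 hx), one_pow]
    simp_rw [sub_mul]
    rw [Finset.sum_sub_distrib, ← Finset.mul_sum, h, mul_one]
  refine ⟨?_, ?_, ?_⟩
  · rw [integral_congr_ae hae, h1]
  · rw [integral_congr_ae (hae.mono fun x hx => by rw [hx]), h2, hsq]
  · rw [integral_congr_ae (hae.mono fun x hx => by rw [hx])]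
    refine h4.trans ?_
    rw [hsq]
    have h0 : 0 ≤ ∑ i, l i ^ 2 - (∑ i, l i) ^ 2 / n := by
      rw [← hsq]; exact Finset.sum_nonneg fun i _ => sq_nonneg _
    have h3 : 0 ≤ (∑ i, l i) ^ 2 / n := by positivity
    gcongr
    linarith

end

/-! ### Projections -/

section

variable {T p : ℕ} {x : Matrix (Fin T) (Fin p) ℝ}

lemma projMatrix_transpose (x : Matrix (Fin T) (Fin p) ℝ) :
    (PanelData.projMatrix x)ᵀ = PanelData.projMatrix x := by
  simp [PanelData.projMatrix, Matrix.transpose_mul, Matrix.transpose_nonsing_inv, Matrix.mul_assoc]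

lemma projMatrix_mul_self (hx : IsUnit (xᵀ * x)) :
    PanelData.projMatrix x * PanelData.projMatrix x = PanelData.projMatrix x := by
  have h : (xᵀ * x)⁻¹ * (xᵀ * x) = 1 :=
    Matrix.nonsing_inv_mul _ ((Matrix.isUnit_iff_isUnit_det _).1 hx)
  have h2 : x * (xᵀ * x)⁻¹ * xᵀ * (x * (xᵀ * x)⁻¹ * xᵀ) = x * (xᵀ * x)⁻¹ * xᵀ := by
    calc x * (xᵀ * x)⁻¹ * xᵀ * (x * (xᵀ * x)⁻¹ * xᵀ)
        = x * ((xᵀ * x)⁻¹ * (xᵀ * x)) * (xᵀ * x)⁻¹ * xᵀ := by simp only [Matrix.mul_assoc]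
      _ = _ := by rw [h, Matrix.mul_one]
  unfold PanelData.projMatrix
  rw [sub_mul, mul_sub, mul_sub, h2]
  simp

lemma trace_projMatrix (hx : IsUnit (xᵀ * x)) :
    (PanelData.projMatrix x).trace = (T : ℝ) - p := by
  have h : (xᵀ * x)⁻¹ * (xᵀ * x) = 1 :=
    Matrix.nonsing_inv_mul _ ((Matrix.isUnit_iff_isUnit_det _).1 hx)
  unfold PanelData.projMatrix
  rw [Matrix.trace_sub, Matrix.trace_one, Matrix.mul_assoc, Matrix.trace_mul_comm,
    Matrix.mul_assoc, h]
  simp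

lemma residual_eq_projMatrix_mulVec (hx : IsUnit (xᵀ * x)) (b : Fin p → ℝ) (e y : Fin T → ℝ)
    (hy : ∀ t, y t = x t ⬝ᵥ b + e t) :
    PanelData.residual x y = PanelData.projMatrix x *ᵥ e := by
  have h : (xᵀ * x)⁻¹ * (xᵀ * x) = 1 :=
    Matrix.nonsing_inv_mul _ ((Matrix.isUnit_iff_isUnit_det _).1 hx)
  have hy' : y = x *ᵥ b + e := by
    ext t
    exact hy t
  have h1 : PanelData.residual x y = y - x *ᵥ PanelData.olsEstimator x y := rfl
  have h2 : PanelData.olsEstimator x y = b + (xᵀ * x)⁻¹ *ᵥ (xᵀ *ᵥ e) := by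
    unfold PanelData.olsEstimator
    rw [hy', Matrix.mulVec_add, Matrix.mulVec_add, Matrix.mulVec_mulVec, Matrix.mulVec_mulVec,
      Matrix.mul_assoc, h, Matrix.one_mulVec]
  rw [h1, h2, hy', Matrix.mulVec_add, PanelData.projMatrix, Matrix.sub_mulVec, Matrix.one_mulVec,
    ← Matrix.mulVec_mulVec, ← Matrix.mulVec_mulVec]
  abel

end

lemma exists_orthogonal_diagonalization {n : Type*} [Fintype n] [DecidableEq n]
    {M : Matrix n n ℝ} (hM : Mᵀ = M) :
    ∃ (U : Matrix n n ℝ) (d : n → ℝ), Uᵀ * U = 1 ∧ U * Uᵀ = 1 ∧ M = U * Matrix.diagonal d * Uᵀ := by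
  have hMh : M.IsHermitian := by
    rw [Matrix.IsHermitian, Matrix.conjTranspose_eq_transpose_of_trivial, hM]
  have hUU : (hMh.eigenvectorUnitary : Matrix n n ℝ)ᵀ * hMh.eigenvectorUnitary = 1 := by
    have h := Unitary.coe_star_mul_self hMh.eigenvectorUnitary
    rwa [Matrix.star_eq_conjTranspose, Matrix.conjTranspose_eq_transpose_of_trivial] at h
  refine ⟨hMh.eigenvectorUnitary, hMh.eigenvalues, hUU, mul_eq_one_comm.1 hUU, ?_⟩
  have h := hMh.spectral_theorem
  rw [Unitary.conjStarAlgAut_apply, Matrix.star_eq_conjTranspose,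
    Matrix.conjTranspose_eq_transpose_of_trivial] at h
  exact h

/-- A symmetric idempotent matrix `P` factors as `J * Jᵀ` through an isometry `J`, and `J` can be
chosen to diagonalize the compression to the range of `P` of a given symmetric matrix. -/
lemma exists_isometry_diagonalizing {n : Type} [Fintype n] [DecidableEq n] {P M : Matrix n n ℝ}
    (hPt : Pᵀ = P) (hP : P * P = P) (hM : Mᵀ = M) :
    ∃ (k : Type) (_ : Fintype k) (_ : DecidableEq k) (J : Matrix n k ℝ) (l : k → ℝ),
      Jᵀ * J = 1 ∧ J * Jᵀ = P ∧ Jᵀ * M * J = Matrix.diagonal l ∧ (Fintype.card k : ℝ) = P.trace := by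
  classical
  obtain ⟨U, d, hUU, hUU', hspec⟩ := exists_orthogonal_diagonalization hPt
  have hdiag : Matrix.diagonal d = Uᵀ * P * U := by
    rw [hspec]
    simp only [Matrix.mul_assoc, hUU]
    rw [← Matrix.mul_assoc Uᵀ U, hUU]
    simp
  have hd01 : ∀ i, d i = 0 ∨ d i = 1 := by
    intro i
    have h : Matrix.diagonal d * Matrix.diagonal d = Matrix.diagonal d := by
      rw [hdiag]
      calc Uᵀ * P * U * (Uᵀ * P * U) = Uᵀ * P * (U * Uᵀ) * P * U := by simp only [Matrix.mul_assoc]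
        _ = Uᵀ * (P * P) * U := by rw [hUU']; simp only [Matrix.mul_assoc, Matrix.mul_one]
        _ = _ := by rw [hP]
    rw [Matrix.diagonal_mul_diagonal] at h
    have h2 := Matrix.diagonal_injective h
    have h3 : d i * d i = d i := congrFun h2 i
    rcases eq_or_ne (d i) 0 with h0 | h0
    · exact Or.inl h0
    · exact Or.inr (mul_left_cancel₀ h0 (by rw [h3, mul_one]))
  let k : Type := {i : n // d i = 1}
  let J₀ : Matrix n k ℝ := U.submatrix id (fun i => i.1)
  have hJ1 : J₀ᵀ * J₀ = 1 := by
    ext a b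
    have h : (Uᵀ * U) a.1 b.1 = (1 : Matrix n n ℝ) a.1 b.1 := by rw [hUU]
    simp only [Matrix.mul_apply, Matrix.transpose_apply, Matrix.one_apply] at h
    simp only [J₀, Matrix.mul_apply, Matrix.transpose_apply, Matrix.submatrix_apply, id,
      Matrix.one_apply, h]
    exact if_congr Subtype.ext_iff.symm rfl rfl
  have hJ2 : J₀ * J₀ᵀ = P := by
    ext a b
    rw [hspec, Matrix.mul_apply, Matrix.mul_apply]
    simp only [J₀, Matrix.mul_diagonal, Matrix.transpose_apply, Matrix.submatrix_apply, id]
    rw [← Finset.sum_subtype (Finset.univ.filter (fun i => d i = 1)) (by simp)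
      (fun i => U a i * U b i), Finset.sum_filter]
    refine Finset.sum_congr rfl fun i _ => ?_
    rcases hd01 i with h | h <;> simp [h]
  have hBt : (J₀ᵀ * M * J₀)ᵀ = J₀ᵀ * M * J₀ := by
    simp [Matrix.transpose_mul, hM, Matrix.mul_assoc]
  obtain ⟨V, l, hVV, hVV', hspecB⟩ := exists_orthogonal_diagonalization hBt
  have hJ1' : (J₀ * V)ᵀ * (J₀ * V) = 1 := by
    rw [Matrix.transpose_mul, Matrix.mul_assoc, ← Matrix.mul_assoc J₀ᵀ, hJ1, Matrix.one_mul, hVV]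
  have hJ2' : (J₀ * V) * (J₀ * V)ᵀ = P := by
    rw [Matrix.transpose_mul, Matrix.mul_assoc, ← Matrix.mul_assoc V, hVV', Matrix.one_mul, hJ2]
  refine ⟨k, inferInstance, inferInstance, J₀ * V, l, hJ1', hJ2', ?_, ?_⟩
  · calc (J₀ * V)ᵀ * M * (J₀ * V) = Vᵀ * (J₀ᵀ * M * J₀) * V := by
          simp only [Matrix.transpose_mul, Matrix.mul_assoc]
      _ = (Vᵀ * V) * Matrix.diagonal l * (Vᵀ * V) := by
          rw [hspecB]; simp only [Matrix.mul_assoc]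
      _ = _ := by rw [hVV]; simp
  · rw [← hJ2', Matrix.trace_mul_comm, hJ1', Matrix.trace_one]

/-! ### Coisometric images of Gaussian vectors -/

section

variable {E F : Type*} [NormedAddCommGroup E] [InnerProductSpace ℝ E] [FiniteDimensional ℝ E]
  [MeasurableSpace E] [BorelSpace E] [NormedAddCommGroup F] [InnerProductSpace ℝ F]
  [FiniteDimensional ℝ F] [MeasurableSpace F] [BorelSpace F]

lemma stdGaussian_map_of_norm_adjoint (L : E →L[ℝ] F)
    (hL : ∀ t, ‖ContinuousLinearMap.adjoint L t‖ = ‖t‖) :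
    (stdGaussian E).map L = stdGaussian F := by
  have : IsProbabilityMeasure ((stdGaussian E).map L) :=
    Measure.isProbabilityMeasure_map L.continuous.aemeasurable
  refine Measure.ext_of_charFun ?_
  ext t
  rw [charFun_apply, integral_map L.continuous.aemeasurable (by fun_prop)]
  have h : ∀ y : E, inner ℝ (L y) t = inner ℝ y (ContinuousLinearMap.adjoint L t) := fun y =>
    (ContinuousLinearMap.adjoint_inner_right L y t).symm
  simp_rw [h]
  rw [← charFun_apply, charFun_stdGaussian, charFun_stdGaussian, hL]

end

lemma multivariateGaussian_sq_smul_one {ι : Type*} [Fintype ι] [DecidableEq ι] (s : ℝ) :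
    multivariateGaussian 0 (s ^ 2 • (1 : Matrix ι ι ℝ)) =
      (stdGaussian (EuclideanSpace ℝ ι)).map (fun x => s • x) := by
  have : IsProbabilityMeasure ((stdGaussian (EuclideanSpace ℝ ι)).map (fun x => s • x)) :=
    Measure.isProbabilityMeasure_map (by fun_prop)
  have hpsd : (s ^ 2 • (1 : Matrix ι ι ℝ)).PosSemidef :=
    Matrix.PosSemidef.one.smul (sq_nonneg s)
  refine Measure.ext_of_charFun ?_
  ext t
  rw [charFun_multivariateGaussian hpsd, charFun_map_smul, charFun_stdGaussian]
  congr 1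
  simp [Matrix.smul_mulVec, norm_smul, mul_pow, neg_div]
  norm_cast
  rw [EuclideanSpace.real_norm_sq_eq, sq_abs]
  simp [dotProduct, sq]

/-- The direction `r / ‖r‖` of the vector of residuals `r = P e` of the errors `e`. -/
noncomputable def residualDirection {T p : ℕ} (x : Matrix (Fin T) (Fin p) ℝ)
    (e : EuclideanSpace ℝ (Fin T)) : EuclideanSpace ℝ (Fin T) :=
  ‖WithLp.toLp 2 (PanelData.projMatrix x *ᵥ e)‖⁻¹ • WithLp.toLp 2 (PanelData.projMatrix x *ᵥ e)

lemma measurable_residualDirection {T p : ℕ} (x : Matrix (Fin T) (Fin p) ℝ) :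
    Measurable (residualDirection x) := by
  unfold residualDirection
  have h : Measurable (fun e : EuclideanSpace ℝ (Fin T) =>
      (WithLp.toLp 2 (PanelData.projMatrix x *ᵥ e) : EuclideanSpace ℝ (Fin T))) := by
    refine Continuous.measurable ?_
    have : Continuous (fun e : EuclideanSpace ℝ (Fin T) => PanelData.projMatrix x *ᵥ e.ofLp) :=
      continuous_const.matrix_mulVec (by fun_prop)
    fun_prop
  fun_prop

lemma norm_toLp_mulVec_of_isometry {n k : Type*} [Fintype n] [Fintype k] [DecidableEq k]
    {J : Matrix n k ℝ} (hJ : Jᵀ * J = 1) (w : k → ℝ) :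
    ‖(WithLp.toLp 2 (J *ᵥ w) : EuclideanSpace ℝ n)‖ =
      ‖(WithLp.toLp 2 w : EuclideanSpace ℝ k)‖ := by
  have h : ‖(WithLp.toLp 2 (J *ᵥ w) : EuclideanSpace ℝ n)‖ ^ 2 =
      ‖(WithLp.toLp 2 w : EuclideanSpace ℝ k)‖ ^ 2 := by
    rw [EuclideanSpace.real_norm_sq_eq, EuclideanSpace.real_norm_sq_eq]
    have h1 : (J *ᵥ w) ⬝ᵥ (J *ᵥ w) = w ⬝ᵥ w := by
      rw [Matrix.dotProduct_mulVec, Matrix.vecMul_mulVec, hJ]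
      simp
    simpa [dotProduct, sq] using h1
  exact (sq_eq_sq₀ (norm_nonneg _) (norm_nonneg _)).1 h

lemma measurable_toLp_mulVec_direction {n k : Type*} [Fintype n] [Fintype k] (J : Matrix n k ℝ) :
    Measurable (fun w : EuclideanSpace ℝ k =>
      (WithLp.toLp 2 (J *ᵥ (‖w‖⁻¹ • w).ofLp) : EuclideanSpace ℝ n)) := by
  have h : Continuous (fun w : EuclideanSpace ℝ k =>
      (WithLp.toLp 2 (J *ᵥ w.ofLp) : EuclideanSpace ℝ n)) := by
    have : Continuous (fun e : EuclideanSpace ℝ k => J *ᵥ e.ofLp) :=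
      continuous_const.matrix_mulVec (by fun_prop)
    fun_prop
  exact h.measurable.comp (by fun_prop : Measurable fun w : EuclideanSpace ℝ k => ‖w‖⁻¹ • w)

/-- If `P = J Jᵀ` with an isometry `J`, the direction of the residuals of Gaussian errors has the
law of `J v`, with `v` the direction of a standard Gaussian vector in the smaller space. -/
lemma map_residualDirection {T p : ℕ} {x : Matrix (Fin T) (Fin p) ℝ} {s : ℝ} (hs : 0 < s)
    {k : Type} [Fintype k] [DecidableEq k] {J : Matrix (Fin T) k ℝ} (hJ : Jᵀ * J = 1)
    (hJP : J * Jᵀ = PanelData.projMatrix x) :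
    (multivariateGaussian 0 (s ^ 2 • (1 : Matrix (Fin T) (Fin T) ℝ))).map (residualDirection x) =
      (stdGaussian (EuclideanSpace ℝ k)).map
        (fun w => WithLp.toLp 2 (J *ᵥ (‖w‖⁻¹ • w).ofLp)) := by
  let L : EuclideanSpace ℝ (Fin T) →L[ℝ] EuclideanSpace ℝ k :=
    (Matrix.toEuclideanLin Jᵀ).toContinuousLinearMap
  have hLapp : ∀ e : EuclideanSpace ℝ (Fin T), L e = WithLp.toLp 2 (Jᵀ *ᵥ e.ofLp) := fun e => rfl
  have hadj : ∀ t, ContinuousLinearMap.adjoint L t = WithLp.toLp 2 (J *ᵥ t.ofLp) := by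
    intro t
    refine ext_inner_left ℝ fun v => ?_
    rw [ContinuousLinearMap.adjoint_inner_right, hLapp]
    simp only [EuclideanSpace.inner_eq_star_dotProduct, star_trivial]
    rw [Matrix.dotProduct_mulVec, Matrix.vecMul_transpose]
  have hL : (stdGaussian (EuclideanSpace ℝ (Fin T))).map L =
      stdGaussian (EuclideanSpace ℝ k) := by
    refine stdGaussian_map_of_norm_adjoint L fun t => ?_
    rw [hadj, norm_toLp_mulVec_of_isometry hJ]
  have hJm := measurable_toLp_mulVec_direction J
  rw [multivariateGaussian_sq_smul_one, Measure.map_map (measurable_residualDirection x)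
    (by fun_prop), ← hL, Measure.map_map hJm L.continuous.measurable]
  congr 1
  ext1 e
  simp only [Function.comp_apply, residualDirection, hLapp]
  rw [← hJP, ← Matrix.mulVec_mulVec, norm_toLp_mulVec_of_isometry hJ]
  have h1 : (s • e).ofLp = s • e.ofLp := rfl
  have h2 : ∀ c : ℝ, ∀ v : k → ℝ,
      (WithLp.toLp 2 (c • v) : EuclideanSpace ℝ k) = c • WithLp.toLp 2 v := fun c v => rfl
  have h3 : ∀ c : ℝ, ∀ v : Fin T → ℝ,
      (WithLp.toLp 2 (c • v) : EuclideanSpace ℝ (Fin T)) = c • WithLp.toLp 2 v := fun c v => rfl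
  rw [h1, Matrix.mulVec_smul, Matrix.mulVec_smul, h2, h3, norm_smul, Real.norm_of_nonneg hs.le,
    smul_smul, mul_inv, WithLp.ofLp_smul, Matrix.mulVec_smul, h3]
  congr 1
  field_simp

/-! ### Centered outer products of the residual directions -/

section

variable {n : Type*}

/-- A square matrix as a vector of the Euclidean space of its entries, whose inner product is the
Frobenius inner product. -/
noncomputable def matVec (M : Matrix n n ℝ) : EuclideanSpace ℝ (n × n) :=
  WithLp.toLp 2 fun q => M q.1 q.2

lemma matVec_add (M M' : Matrix n n ℝ) : matVec (M + M') = matVec M + matVec M' := rfl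

lemma matVec_sub (M M' : Matrix n n ℝ) : matVec (M - M') = matVec M - matVec M' := rfl

lemma matVec_smul (c : ℝ) (M : Matrix n n ℝ) : matVec (c • M) = c • matVec M := rfl

variable [Fintype n]

lemma inner_matVec (M M' : Matrix n n ℝ) :
    inner ℝ (matVec M) (matVec M') = (Mᵀ * M').trace := by
  simp only [matVec, PiLp.inner_apply, Matrix.trace, Matrix.diag, Matrix.mul_apply,
    Matrix.transpose_apply, Fintype.sum_prod_type]
  rw [Finset.sum_comm]
  simp [mul_comm]

lemma norm_sq_matVec (M : Matrix n n ℝ) : ‖matVec M‖ ^ 2 = (Mᵀ * M).trace := by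
  rw [← inner_matVec, real_inner_self_eq_norm_sq]

lemma trace_transpose_mul_self_nonneg (M : Matrix n n ℝ) : 0 ≤ (Mᵀ * M).trace := by
  rw [← norm_sq_matVec]; positivity

lemma norm_matVec_transpose (M : Matrix n n ℝ) : ‖matVec Mᵀ‖ = ‖matVec M‖ := by
  have h : ‖matVec Mᵀ‖ ^ 2 = ‖matVec M‖ ^ 2 := by
    rw [norm_sq_matVec, norm_sq_matVec, Matrix.trace_mul_comm, Matrix.transpose_transpose]
  exact (sq_eq_sq₀ (norm_nonneg _) (norm_nonneg _)).1 h

lemma inner_matVec_vecMulVec (M : Matrix n n ℝ) (u v : n → ℝ) :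
    inner ℝ (matVec M) (matVec (Matrix.vecMulVec u v)) = u ⬝ᵥ (M *ᵥ v) := by
  simp only [matVec, PiLp.inner_apply, Fintype.sum_prod_type, Matrix.vecMulVec_apply, dotProduct,
    Matrix.mulVec, Finset.mul_sum]
  refine Finset.sum_congr rfl fun i _ => Finset.sum_congr rfl fun j _ => ?_
  simp
  ring

/-- Compressing a symmetric matrix by an orthogonal projection decreases its Frobenius norm. -/
lemma trace_compression_le [DecidableEq n] {P M : Matrix n n ℝ} (hPt : Pᵀ = P) (hP : P * P = P)
    (hM : Mᵀ = M) : (P * M * P * M).trace ≤ (M * M).trace := by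
  have h1 := trace_transpose_mul_self_nonneg (M * P - P * M)
  have h2 := trace_transpose_mul_self_nonneg ((1 - P) * M)
  have e1 : (M * P - P * M)ᵀ * (M * P - P * M) =
      P * (M * M * P) - P * M * P * M - M * (P * M * P) + M * (P * P) * M := by
    rw [Matrix.transpose_sub, Matrix.transpose_mul, Matrix.transpose_mul, hPt, hM]
    noncomm_ring
  have e2 : ((1 - P) * M)ᵀ * ((1 - P) * M) = M * M - 2 • (M * P * M) + M * (P * P) * M := by
    rw [Matrix.transpose_mul, Matrix.transpose_sub, Matrix.transpose_one, hPt, hM]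
    noncomm_ring
  rw [e1, hP, Matrix.trace_add, Matrix.trace_sub, Matrix.trace_sub, Matrix.trace_mul_comm M,
    Matrix.trace_mul_comm P] at h1
  rw [e2, hP, Matrix.trace_add, Matrix.trace_sub, Matrix.trace_smul] at h2
  have e3 : (M * M * P * P).trace = (M * P * M).trace := by
    rw [Matrix.mul_assoc _ P P, hP, Matrix.mul_assoc, Matrix.trace_mul_comm]
  rw [e3] at h1
  simp only [nsmul_eq_mul, Nat.cast_ofNat] at h2
  linarith

end

section

variable {T p : ℕ}

/-- The matrix `u uᵀ - P / (T - p)`, as a vector, where `u` is the direction of the residuals;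
for Gaussian errors this is `u uᵀ` minus its mean. -/
noncomputable def centeredOuter (x : Matrix (Fin T) (Fin p) ℝ) (e : EuclideanSpace ℝ (Fin T)) :
    EuclideanSpace ℝ (Fin T × Fin T) :=
  matVec (Matrix.vecMulVec (residualDirection x e) (residualDirection x e) -
    ((T : ℝ) - p)⁻¹ • PanelData.projMatrix x)

lemma measurable_centeredOuter (x : Matrix (Fin T) (Fin p) ℝ) : Measurable (centeredOuter x) := by
  have h := measurable_residualDirection x
  unfold centeredOuter matVec
  have h2 : ∀ t, Measurable fun e => residualDirection x e t := fun t => by fun_prop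
  have h3 : Measurable (fun e : EuclideanSpace ℝ (Fin T) => fun q : Fin T × Fin T =>
      (Matrix.vecMulVec (residualDirection x e) (residualDirection x e) -
        ((T : ℝ) - p)⁻¹ • PanelData.projMatrix x) q.1 q.2) := by
    refine measurable_pi_lambda _ fun q => ?_
    simp only [Matrix.sub_apply, Matrix.vecMulVec_apply]
    exact ((h2 _).mul (h2 _)).sub_const _
  exact (by fun_prop : Measurable
    (WithLp.toLp 2 : (Fin T × Fin T → ℝ) → EuclideanSpace ℝ (Fin T × Fin T))).comp h3

lemma inner_matVec_centeredOuter (x : Matrix (Fin T) (Fin p) ℝ) (M : Matrix (Fin T) (Fin T) ℝ)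
    (e : EuclideanSpace ℝ (Fin T)) :
    inner ℝ (matVec M) (centeredOuter x e) =
      (residualDirection x e).ofLp ⬝ᵥ (M *ᵥ (residualDirection x e).ofLp) -
        (M * PanelData.projMatrix x).trace / ((T : ℝ) - p) := by
  rw [centeredOuter, matVec_sub, inner_sub_right, inner_matVec_vecMulVec, matVec_smul,
    inner_smul_right, inner_matVec, ← Matrix.trace_transpose, Matrix.transpose_mul,
    Matrix.transpose_transpose, projMatrix_transpose, Matrix.trace_mul_comm]
  ring

lemma inner_matVec_transpose_centeredOuter (x : Matrix (Fin T) (Fin p) ℝ)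
    (M : Matrix (Fin T) (Fin T) ℝ) (e : EuclideanSpace ℝ (Fin T)) :
    inner ℝ (matVec Mᵀ) (centeredOuter x e) = inner ℝ (matVec M) (centeredOuter x e) := by
  rw [inner_matVec_centeredOuter, inner_matVec_centeredOuter, Matrix.mulVec_transpose,
    dotProduct_comm, ← Matrix.dotProduct_mulVec]
  congr 2
  rw [← Matrix.trace_transpose, Matrix.transpose_mul, Matrix.transpose_transpose,
    projMatrix_transpose, Matrix.trace_mul_comm]

lemma norm_residualDirection_le (x : Matrix (Fin T) (Fin p) ℝ) (e : EuclideanSpace ℝ (Fin T)) :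
    ‖residualDirection x e‖ ≤ 1 := by
  rw [residualDirection, norm_smul, norm_inv, norm_norm]
  exact inv_mul_le_one

variable {x : Matrix (Fin T) (Fin p) ℝ} {s : ℝ}

lemma projMatrix_mulVec_residualDirection (hx : IsUnit (xᵀ * x)) (e : EuclideanSpace ℝ (Fin T)) :
    PanelData.projMatrix x *ᵥ (residualDirection x e).ofLp = (residualDirection x e).ofLp := by
  simp only [residualDirection, WithLp.ofLp_smul]
  rw [Matrix.mulVec_smul, Matrix.mulVec_mulVec, projMatrix_mul_self hx]

lemma dotProduct_residualDirection_self (e : EuclideanSpace ℝ (Fin T)) :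
    (residualDirection x e).ofLp ⬝ᵥ (residualDirection x e).ofLp = ‖residualDirection x e‖ ^ 2 := by
  rw [EuclideanSpace.real_norm_sq_eq]
  simp [dotProduct, sq]

lemma norm_sq_matVec_vecMulVec {n : Type*} [Fintype n] (u : EuclideanSpace ℝ n) :
    ‖matVec (Matrix.vecMulVec u.ofLp u.ofLp)‖ ^ 2 = ‖u‖ ^ 4 := by
  rw [← real_inner_self_eq_norm_sq, inner_matVec_vecMulVec]
  have h : u.ofLp ⬝ᵥ u.ofLp = ‖u‖ ^ 2 := by
    rw [EuclideanSpace.real_norm_sq_eq]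
    simp [dotProduct, sq]
  rw [Matrix.vecMulVec_mulVec, h]
  simp [h]
  ring

lemma norm_sq_matVec_projMatrix (hx : IsUnit (xᵀ * x)) :
    ‖matVec (PanelData.projMatrix x)‖ ^ 2 = (T : ℝ) - p := by
  rw [norm_sq_matVec, projMatrix_transpose, projMatrix_mul_self hx, trace_projMatrix hx]

lemma norm_sq_centeredOuter (hx : IsUnit (xᵀ * x)) (hp : p < T) (e : EuclideanSpace ℝ (Fin T)) :
    ‖centeredOuter x e‖ ^ 2 = ‖residualDirection x e‖ ^ 4 -
      2 * ‖residualDirection x e‖ ^ 2 / ((T : ℝ) - p) + 1 / ((T : ℝ) - p) := by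
  have hm : (0 : ℝ) < (T : ℝ) - p := by
    have : (p : ℝ) < T := by exact_mod_cast hp
    linarith
  rw [centeredOuter, matVec_sub, norm_sub_sq_real, norm_sq_matVec_vecMulVec, matVec_smul,
    norm_smul, mul_pow, norm_sq_matVec_projMatrix hx, inner_smul_right, real_inner_comm,
    inner_matVec_vecMulVec, projMatrix_mulVec_residualDirection hx,
    dotProduct_residualDirection_self, Real.norm_of_nonneg (by positivity)]
  field_simp

lemma norm_centeredOuter_le (hx : IsUnit (xᵀ * x)) (hp : p < T) (e : EuclideanSpace ℝ (Fin T)) :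
    ‖centeredOuter x e‖ ≤ 2 := by
  have hm : (1 : ℝ) ≤ (T : ℝ) - p := by
    have : (p : ℝ) + 1 ≤ T := by exact_mod_cast hp
    linarith
  have h1 := norm_residualDirection_le x e
  have h0 := norm_nonneg (residualDirection x e)
  have h2 : ‖centeredOuter x e‖ ^ 2 ≤ 2 ^ 2 := by
    rw [norm_sq_centeredOuter hx hp]
    have a1 : ‖residualDirection x e‖ ^ 4 ≤ 1 := pow_le_one₀ h0 h1
    have a2 : 0 ≤ 2 * ‖residualDirection x e‖ ^ 2 / ((T : ℝ) - p) := by positivity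
    have a3 : 1 / ((T : ℝ) - p) ≤ 1 := by
      rw [div_le_one (by linarith)]; exact hm
    linarith
  exact (sq_le_sq₀ (norm_nonneg _) (by norm_num)).1 h2

/-- The direction of Gaussian residuals is a unit vector almost surely. -/
lemma ae_norm_residualDirection (hx : IsUnit (xᵀ * x)) (hp : p < T) (hs : 0 < s) :
    ∀ᵐ e ∂(multivariateGaussian 0 (s ^ 2 • (1 : Matrix (Fin T) (Fin T) ℝ))),
      ‖residualDirection x e‖ = 1 := by
  obtain ⟨k, _, _, J, l, hJ, hJP, -, hcard⟩ := exists_isometry_diagonalizing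
    (projMatrix_transpose x) (projMatrix_mul_self hx) (Matrix.transpose_one (n := Fin T) (α := ℝ))
  rw [trace_projMatrix hx] at hcard
  have hk : Nonempty k := by
    rw [← Fintype.card_pos_iff]
    have : (p : ℝ) < T := by exact_mod_cast hp
    have h : (0 : ℝ) < Fintype.card k := by rw [hcard]; linarith
    exact_mod_cast h
  have hlaw := map_residualDirection hs hJ hJP
  have hJm := measurable_toLp_mulVec_direction J
  have hms : MeasurableSet {v : EuclideanSpace ℝ (Fin T) | ‖v‖ = 1} :=
    measurableSet_eq_fun (by fun_prop) (by fun_prop)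
  rw [← ae_map_iff (measurable_residualDirection x).aemeasurable hms, hlaw,
    ae_map_iff hJm.aemeasurable hms]
  filter_upwards [stdGaussian_ae_ne_zero] with w hw
  rw [norm_toLp_mulVec_of_isometry hJ, WithLp.toLp_ofLp, norm_smul, norm_inv, norm_norm,
    inv_mul_cancel₀ (norm_ne_zero_iff.2 hw)]

lemma ae_norm_sq_centeredOuter (hx : IsUnit (xᵀ * x)) (hp : p < T) (hs : 0 < s) :
    ∀ᵐ e ∂(multivariateGaussian 0 (s ^ 2 • (1 : Matrix (Fin T) (Fin T) ℝ))),
      ‖centeredOuter x e‖ ^ 2 = 1 - 1 / ((T : ℝ) - p) := by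
  filter_upwards [ae_norm_residualDirection hx hp hs] with e he
  rw [norm_sq_centeredOuter hx hp, he]
  ring

/-- The centered outer product has trace zero almost surely. -/
lemma ae_inner_matVec_one_centeredOuter (hx : IsUnit (xᵀ * x)) (hp : p < T) (hs : 0 < s) :
    ∀ᵐ e ∂(multivariateGaussian 0 (s ^ 2 • (1 : Matrix (Fin T) (Fin T) ℝ))),
      inner ℝ (matVec 1) (centeredOuter x e) = 0 := by
  have hm : (0 : ℝ) < (T : ℝ) - p := by
    have : (p : ℝ) < T := by exact_mod_cast hp
    linarith
  filter_upwards [ae_norm_residualDirection hx hp hs] with e he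
  rw [inner_matVec_centeredOuter, Matrix.one_mulVec, dotProduct_residualDirection_self, he,
    Matrix.one_mul, trace_projMatrix hx, div_self hm.ne']
  ring

/-- Moments of the linear functionals of the centered outer product given by symmetric matrices. -/
lemma integral_inner_matVec_centeredOuter_of_symm (hx : IsUnit (xᵀ * x)) (hp : p < T) (hs : 0 < s)
    {M : Matrix (Fin T) (Fin T) ℝ} (hM : Mᵀ = M) :
    ∫ e, inner ℝ (matVec M) (centeredOuter x e)
      ∂(multivariateGaussian 0 (s ^ 2 • (1 : Matrix (Fin T) (Fin T) ℝ))) = 0 ∧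
    ∫ e, inner ℝ (matVec M) (centeredOuter x e) ^ 2
      ∂(multivariateGaussian 0 (s ^ 2 • (1 : Matrix (Fin T) (Fin T) ℝ))) =
      2 / (((T : ℝ) - p) * ((T : ℝ) - p + 2)) *
        ((PanelData.projMatrix x * M * PanelData.projMatrix x * M).trace -
          (M * PanelData.projMatrix x).trace ^ 2 / ((T : ℝ) - p)) ∧
    ∫ e, inner ℝ (matVec M) (centeredOuter x e) ^ 4
      ∂(multivariateGaussian 0 (s ^ 2 • (1 : Matrix (Fin T) (Fin T) ℝ))) ≤
      15 * (2 / (((T : ℝ) - p) * ((T : ℝ) - p + 2)) * ‖matVec M‖ ^ 2) ^ 2 := by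
  obtain ⟨k, _, _, J, l, hJ, hJP, hJM, hcard⟩ := exists_isometry_diagonalizing
    (projMatrix_transpose x) (projMatrix_mul_self hx) hM
  rw [trace_projMatrix hx] at hcard
  have hpT : (p : ℝ) < T := by exact_mod_cast hp
  have hm : (0 : ℝ) < (T : ℝ) - p := by linarith
  have hk : Nonempty k := by
    rw [← Fintype.card_pos_iff]
    have h : (0 : ℝ) < Fintype.card k := by rw [hcard]; linarith
    exact_mod_cast h
  have htr : (M * PanelData.projMatrix x).trace = ∑ i, l i := by
    rw [← hJP, ← Matrix.mul_assoc, Matrix.trace_mul_comm, ← Matrix.mul_assoc, hJM,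
      Matrix.trace_diagonal]
  have htr2 : (PanelData.projMatrix x * M * PanelData.projMatrix x * M).trace = ∑ i, l i ^ 2 := by
    have h : (PanelData.projMatrix x * M * PanelData.projMatrix x * M).trace =
        ((Jᵀ * M * J) * (Jᵀ * M * J)).trace := by
      rw [← hJP]
      simp only [Matrix.mul_assoc]
      rw [Matrix.trace_mul_comm]
      simp only [Matrix.mul_assoc]
    rw [h, hJM, Matrix.diagonal_mul_diagonal, Matrix.trace_diagonal]
    simp [sq]
  have hlaw := map_residualDirection hs hJ hJP
  have hJm := measurable_toLp_mulVec_direction J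
  have hquad : Continuous (fun v : EuclideanSpace ℝ (Fin T) => v.ofLp ⬝ᵥ (M *ᵥ v.ofLp) -
      (∑ i, l i) / ((T : ℝ) - p)) := by
    have h1 : Continuous (fun v : EuclideanSpace ℝ (Fin T) => v.ofLp) := by fun_prop
    exact (h1.dotProduct (continuous_const.matrix_mulVec h1)).sub continuous_const
  have key : ∀ q : ℕ, ∫ e, inner ℝ (matVec M) (centeredOuter x e) ^ q
      ∂(multivariateGaussian 0 (s ^ 2 • (1 : Matrix (Fin T) (Fin T) ℝ))) =
      ∫ w, (∑ i, l i * ((‖w‖⁻¹ • w) i) ^ 2 - (∑ i, l i) / Fintype.card k) ^ q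
        ∂(stdGaussian (EuclideanSpace ℝ k)) := by
    intro q
    simp_rw [inner_matVec_centeredOuter, htr]
    have hq : AEStronglyMeasurable (fun v : EuclideanSpace ℝ (Fin T) =>
        (v.ofLp ⬝ᵥ (M *ᵥ v.ofLp) - (∑ i, l i) / ((T : ℝ) - p)) ^ q)
        ((stdGaussian (EuclideanSpace ℝ k)).map
          fun w => WithLp.toLp 2 (J *ᵥ (‖w‖⁻¹ • w).ofLp)) := (hquad.pow q).aestronglyMeasurable
    rw [← integral_map (φ := residualDirection x) (f := fun v : EuclideanSpace ℝ (Fin T) =>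
      (v.ofLp ⬝ᵥ (M *ᵥ v.ofLp) - (∑ i, l i) / ((T : ℝ) - p)) ^ q)
      (measurable_residualDirection x).aemeasurable (hquad.pow q).aestronglyMeasurable, hlaw,
      integral_map hJm.aemeasurable hq]
    congr 1
    ext w
    rw [hcard]
    congr 2
    rw [WithLp.ofLp_toLp, Matrix.mulVec_mulVec, Matrix.dotProduct_mulVec, ← Matrix.vecMul_transpose,
      Matrix.vecMul_vecMul, ← Matrix.mul_assoc, hJM, ← Matrix.dotProduct_mulVec]
    simp only [dotProduct, Matrix.mulVec_diagonal]
    exact Finset.sum_congr rfl fun i _ => by ring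
  obtain ⟨h1, h2, h4⟩ := integral_sum_mul_direction_sq_sub l
  refine ⟨?_, ?_, ?_⟩
  · have := key 1
    simp only [pow_one] at this
    rw [this, h1]
  · rw [key 2, h2, hcard, htr, htr2]
  · rw [key 4]
    refine h4.trans ?_
    rw [hcard]
    have hle : ∑ i, l i ^ 2 ≤ ‖matVec M‖ ^ 2 := by
      rw [← htr2, norm_sq_matVec, hM]
      exact trace_compression_le (projMatrix_transpose x) (projMatrix_mul_self hx) hM
    have h0 : 0 ≤ ∑ i, l i ^ 2 := Finset.sum_nonneg fun i _ => sq_nonneg _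
    gcongr

/-- The centered outer product has mean zero, and its linear functionals have second and fourth
moments controlled by `κ = 2 / (m (m + 2))`, where `m = T - p`. -/
lemma integral_inner_centeredOuter (hx : IsUnit (xᵀ * x)) (hp : p < T) (hs : 0 < s)
    (z : EuclideanSpace ℝ (Fin T × Fin T)) :
    ∫ e, inner ℝ z (centeredOuter x e)
      ∂(multivariateGaussian 0 (s ^ 2 • (1 : Matrix (Fin T) (Fin T) ℝ))) = 0 ∧
    ∫ e, inner ℝ z (centeredOuter x e) ^ 2
      ∂(multivariateGaussian 0 (s ^ 2 • (1 : Matrix (Fin T) (Fin T) ℝ))) ≤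
      2 / (((T : ℝ) - p) * ((T : ℝ) - p + 2)) * ‖z‖ ^ 2 ∧
    ∫ e, inner ℝ z (centeredOuter x e) ^ 4
      ∂(multivariateGaussian 0 (s ^ 2 • (1 : Matrix (Fin T) (Fin T) ℝ))) ≤
      15 * (2 / (((T : ℝ) - p) * ((T : ℝ) - p + 2)) * ‖z‖ ^ 2) ^ 2 := by
  have hpT : (p : ℝ) < T := by exact_mod_cast hp
  have hm : (0 : ℝ) < (T : ℝ) - p := by linarith
  -- only the symmetric part of the matrix with entries `z` matters
  let M : Matrix (Fin T) (Fin T) ℝ := fun i j => z (i, j)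
  have hz : z = matVec M := rfl
  let S : Matrix (Fin T) (Fin T) ℝ := (1 / 2 : ℝ) • (M + Mᵀ)
  have hS : Sᵀ = S := by simp [S, add_comm]
  have hin : ∀ e, inner ℝ z (centeredOuter x e) = inner ℝ (matVec S) (centeredOuter x e) := by
    intro e
    simp only [S]
    rw [matVec_smul, matVec_add, inner_smul_left, inner_add_left,
      inner_matVec_transpose_centeredOuter, hz]
    simp
    ring
  have hn : ‖matVec S‖ ≤ ‖z‖ := by
    simp only [S]
    rw [matVec_smul, matVec_add, norm_smul, hz]
    have h := norm_add_le (matVec M) (matVec Mᵀ)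
    rw [norm_matVec_transpose] at h
    rw [Real.norm_of_nonneg (by norm_num)]
    linarith
  obtain ⟨h1, h2, h4⟩ := integral_inner_matVec_centeredOuter_of_symm hx hp hs hS
  simp_rw [hin]
  refine ⟨h1, ?_, h4.trans (by gcongr)⟩
  rw [h2]
  have hle := trace_compression_le (projMatrix_transpose x) (projMatrix_mul_self hx) hS
  have hle2 : (S * S).trace ≤ ‖z‖ ^ 2 := by
    have : ‖matVec S‖ ^ 2 = (S * S).trace := by rw [norm_sq_matVec, hS]
    rw [← this]
    gcongr
  have h0 : 0 ≤ (S * PanelData.projMatrix x).trace ^ 2 / ((T : ℝ) - p) := by positivity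
  gcongr
  linarith

end

/-! ### Elementary inequalities -/

/-- Second order Taylor expansion of the exponential on the imaginary axis. -/
lemma norm_cexp_I_mul_sub_le (x : ℝ) :
    ‖Complex.exp (x * Complex.I) - 1 - x * Complex.I + (x : ℂ) ^ 2 / 2‖ ≤ 4 * |x| ^ 3 := by
  rcases le_or_gt |x| 1 with h | h
  · have hn : ‖(x : ℂ) * Complex.I‖ = |x| := by simp
    have h1 := Complex.exp_bound (x := (x : ℂ) * Complex.I) (by rw [hn]; exact h)
      (n := 3) (by norm_num)
    have h2 : Complex.exp (x * Complex.I) - 1 - x * Complex.I + (x : ℂ) ^ 2 / 2 =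
        Complex.exp (x * Complex.I) -
          ∑ m ∈ Finset.range 3, ((x : ℂ) * Complex.I) ^ m / (m.factorial : ℂ) := by
      simp [Finset.sum_range_succ, mul_pow, Nat.factorial]
      ring
    rw [h2]
    refine h1.trans ?_
    rw [hn]
    have h3 : (0 : ℝ) ≤ |x| ^ 3 := by positivity
    norm_num [Nat.factorial]
    linarith
  · have h1 : ‖Complex.exp (x * Complex.I)‖ = 1 := Complex.norm_exp_ofReal_mul_I x
    have h2 : ‖(x : ℂ) * Complex.I‖ = |x| := by simp
    have h3 : ‖(x : ℂ) ^ 2 / 2‖ = |x| ^ 2 / 2 := by simp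
    calc _ ≤ ‖Complex.exp (x * Complex.I)‖ + ‖(1 : ℂ)‖ + ‖(x : ℂ) * Complex.I‖
          + ‖(x : ℂ) ^ 2 / 2‖ :=
          (norm_add_le _ _).trans (add_le_add_left
            ((norm_sub_le _ _).trans (add_le_add_left (norm_sub_le _ _) _)) _)
      _ = 2 + |x| + |x| ^ 2 / 2 := by rw [h1, h2, h3, norm_one]; ring
      _ ≤ 4 * |x| ^ 3 := by nlinarith [mul_pos (sub_pos.2 h) (sub_pos.2 h), sq_nonneg (|x|)]

lemma abs_one_sub_sub_exp_neg_le {x : ℝ} (hx : 0 ≤ x) : |1 - x - Real.exp (-x)| ≤ x ^ 2 := by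
  rcases le_or_gt x 1 with h | h
  · have h1 := Real.abs_exp_sub_one_sub_id_le (x := -x) (by rw [abs_neg, abs_of_nonneg hx]; exact h)
    rw [abs_sub_comm]
    convert h1 using 1
    · congr 1; ring
    · ring
  · have h1 := Real.add_one_le_exp (-x)
    have h2 : Real.exp (-x) ≤ 1 := Real.exp_le_one_iff.2 (by linarith)
    rw [abs_le]
    constructor <;> nlinarith

/-- An approximate recursion `φ (k + 1) ≈ r k * φ k` with contracting factors accumulates at most
the sum of its errors. -/
lemma norm_sub_prod_le_sum {φ : ℕ → ℂ} {r err : ℕ → ℝ} {N : ℕ} (h0 : φ 0 = 1)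
    (hr : ∀ k < N, |r k| ≤ 1) (h : ∀ k < N, ‖φ (k + 1) - r k * φ k‖ ≤ err k) :
    ‖φ N - ((∏ k ∈ Finset.range N, r k : ℝ) : ℂ)‖ ≤ ∑ k ∈ Finset.range N, err k := by
  have key : ∀ n ≤ N, ‖φ n - ((∏ k ∈ Finset.range n, r k : ℝ) : ℂ)‖ ≤
      ∑ k ∈ Finset.range n, err k := by
    intro n
    induction n with
    | zero => intro _; simp [h0]
    | succ n ih =>
      intro hn
      have h1 := ih (by omega)
      rw [Finset.sum_range_succ, Finset.prod_range_succ]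
      have h2 : φ (n + 1) - (((∏ k ∈ Finset.range n, r k) * r n : ℝ) : ℂ) =
          (φ (n + 1) - r n * φ n) +
            r n * (φ n - ((∏ k ∈ Finset.range n, r k : ℝ) : ℂ)) := by
        push_cast
        ring
      rw [h2]
      refine (norm_add_le _ _).trans ?_
      rw [norm_mul, Complex.norm_real, Real.norm_eq_abs]
      have h3 := mul_le_mul (hr n (by omega)) h1 (norm_nonneg _) zero_le_one
      linarith [h n (by omega)]
  exact key N le_rfl

lemma integral_abs_le_sqrt {Ω : Type*} [MeasurableSpace Ω] {P : Measure Ω}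
    [IsProbabilityMeasure P] {f : Ω → ℝ} (hf : Integrable f P)
    (hf2 : Integrable (fun ω => f ω ^ 2) P) :
    ∫ ω, |f ω| ∂P ≤ √(∫ ω, f ω ^ 2 ∂P) := by
  set m := ∫ ω, |f ω| ∂P with hm
  have h0 : 0 ≤ ∫ ω, (|f ω| - m) ^ 2 ∂P := integral_nonneg fun ω => sq_nonneg _
  have h1 : ∀ ω, (|f ω| - m) ^ 2 = f ω ^ 2 - (2 * m * |f ω| - m ^ 2) := fun ω => by
    rw [sub_sq, sq_abs]; ring
  have i1 : Integrable (fun ω => 2 * m * |f ω| - m ^ 2) P :=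
    (hf.abs.const_mul _).sub (integrable_const _)
  simp_rw [h1] at h0
  rw [integral_sub hf2 i1, integral_sub (hf.abs.const_mul _) (integrable_const _),
    integral_const_mul, ← hm] at h0
  simp only [integral_const, probReal_univ, smul_eq_mul, one_mul] at h0
  exact Real.le_sqrt_of_sq_le (by linarith)

/-! ### Cross sums of independent vectors -/

/-- Freezing one of two independent variables: the other one is integrated out first. -/
lemma ProbabilityTheory.IndepFun.integral_comp_prodMk {Ω α β E : Type*} [MeasurableSpace Ω]
    [MeasurableSpace α] [MeasurableSpace β] [NormedAddCommGroup E] [NormedSpace ℝ E]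
    {P : Measure Ω} [IsProbabilityMeasure P] {X : Ω → α} {Y : Ω → β} (h : IndepFun X Y P)
    (hX : Measurable X) (hY : Measurable Y) {F : α × β → E} (hF : StronglyMeasurable F)
    (hint : Integrable (fun ω => F (X ω, Y ω)) P) :
    ∫ ω, F (X ω, Y ω) ∂P = ∫ ω, ∫ ω', F (X ω, Y ω') ∂P ∂P := by
  have hprod := (indepFun_iff_map_prod_eq_prod_map_map hX.aemeasurable hY.aemeasurable).1 h
  have hXY : Measurable fun ω => (X ω, Y ω) := hX.prodMk hY
  have : IsProbabilityMeasure (P.map X) := Measure.isProbabilityMeasure_map hX.aemeasurable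
  have : IsProbabilityMeasure (P.map Y) := Measure.isProbabilityMeasure_map hY.aemeasurable
  rw [← integral_map (φ := fun ω => (X ω, Y ω)) hXY.aemeasurable hF.aestronglyMeasurable, hprod,
    integral_prod]
  · rw [integral_map hX.aemeasurable hF.integral_prod_right'.aestronglyMeasurable]
    congr 1
    ext ω
    rw [integral_map hY.aemeasurable]
    exact (hF.comp_measurable measurable_prodMk_left).aestronglyMeasurable
  · rw [← hprod, integrable_map_measure hF.aestronglyMeasurable hXY.aemeasurable]
    exact hint

section

variable {H : Type*} [NormedAddCommGroup H] [InnerProductSpace ℝ H]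

/-- The sum `∑_{i < j < k} ⟪a i, a j⟫`. -/
noncomputable def crossSum (a : ℕ → H) (k : ℕ) : ℝ :=
  ∑ j ∈ Finset.range k, inner ℝ (∑ i ∈ Finset.range j, a i) (a j)

/-- Through this identity the squared norm of a partial sum is a constant plus twice the cross sum
when the summands have constant norm. -/
lemma norm_sq_sum_range (a : ℕ → H) (k : ℕ) :
    ‖∑ i ∈ Finset.range k, a i‖ ^ 2 = ∑ i ∈ Finset.range k, ‖a i‖ ^ 2 + 2 * crossSum a k := by
  induction k with
  | zero => simp [crossSum]
  | succ k ih =>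
    rw [Finset.sum_range_succ, norm_add_sq_real, ih, Finset.sum_range_succ]
    simp only [crossSum, Finset.sum_range_succ]
    ring

lemma abs_crossSum_le {a : ℕ → H} {C : ℝ} (hC : ∀ k, ‖a k‖ ≤ C) (k : ℕ) :
    |crossSum a k| ≤ ∑ j ∈ Finset.range k, (j * C) * C := by
  refine (Finset.abs_sum_le_sum_abs _ _).trans (Finset.sum_le_sum fun j _ => ?_)
  have h0 : 0 ≤ C := (norm_nonneg _).trans (hC 0)
  refine (abs_real_inner_le_norm _ _).trans (mul_le_mul ?_ (hC j) (norm_nonneg _) (by positivity))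
  refine (norm_sum_le _ _).trans ((Finset.sum_le_sum fun i _ => hC i).trans ?_)
  simp

end

set_option linter.unusedSectionVars false

/-! ### Moments of the cross sums of a degenerate array -/

/-- Bounded centered vectors `a 0, …, a (N - 1)`, each independent of the past through the partial
sum and the cross sum, with common norm `√s`, covariance operators at most `κ`, second moments of
the inner products with independent copies of the preceding vectors close to their maximal value
`κ s` (up to `η`), and fourth moments of linear functionals controlled by `K`. -/
structure IsDegenerateArray {Ω H : Type*} [MeasurableSpace Ω] [NormedAddCommGroup H]
    [InnerProductSpace ℝ H] [MeasurableSpace H] (P : Measure Ω) (a : ℕ → Ω → H) (N : ℕ)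
    (C s κ K η : ℝ) : Prop where
  measurable : ∀ k, Measurable (a k)
  norm_le : ∀ k ω, ‖a k ω‖ ≤ C
  indep : ∀ k < N, IndepFun
    (fun ω => (∑ i ∈ Finset.range k, a i ω, crossSum (fun i => a i ω) k)) (a k) P
  norm_sq : ∀ k < N, ∀ᵐ ω ∂P, ‖a k ω‖ ^ 2 = s
  mean : ∀ k < N, ∀ z, ∫ ω, inner ℝ z (a k ω) ∂P = 0
  second_le : ∀ k < N, ∀ z, ∫ ω, inner ℝ z (a k ω) ^ 2 ∂P ≤ κ * ‖z‖ ^ 2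
  fourth_le : ∀ k < N, ∀ z, ∫ ω, inner ℝ z (a k ω) ^ 4 ∂P ≤ K * (κ * ‖z‖ ^ 2) ^ 2
  le_second : ∀ k < N, ∀ i < k,
    κ * s - η ≤ ∫ ω', ∫ ω, inner ℝ (a i ω) (a k ω') ^ 2 ∂P ∂P

namespace IsDegenerateArray

variable {Ω H : Type*} [MeasurableSpace Ω] [NormedAddCommGroup H]
  [InnerProductSpace ℝ H] [MeasurableSpace H] [BorelSpace H] [SecondCountableTopology H]
  {P : Measure Ω} [IsProbabilityMeasure P] {a : ℕ → Ω → H} {N : ℕ} {C s κ K η : ℝ}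

lemma measurable_sum (h : IsDegenerateArray P a N C s κ K η) (k : ℕ) :
    Measurable fun ω => ∑ i ∈ Finset.range k, a i ω :=
  Finset.measurable_sum _ fun i _ => h.measurable i

lemma measurable_crossSum (h : IsDegenerateArray P a N C s κ K η) (k : ℕ) :
    Measurable fun ω => crossSum (fun i => a i ω) k := by
  unfold crossSum
  exact Finset.measurable_sum _ fun j _ => (h.measurable_sum j).inner (h.measurable j)

lemma norm_sum_le (h : IsDegenerateArray P a N C s κ K η) (k : ℕ) (ω : Ω) :
    ‖∑ i ∈ Finset.range k, a i ω‖ ≤ k * C := by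
  refine (_root_.norm_sum_le _ _).trans ((Finset.sum_le_sum fun i _ => h.norm_le i ω).trans ?_)
  simp

lemma bound_nonneg (h : IsDegenerateArray P a N C s κ K η) : 0 ≤ C := by
  obtain ⟨ω⟩ := nonempty_of_isProbabilityMeasure P
  exact (norm_nonneg _).trans (h.norm_le 0 ω)

lemma abs_inner_sum_le (h : IsDegenerateArray P a N C s κ K η) (k : ℕ) (ω ω' : Ω) :
    |inner ℝ (∑ i ∈ Finset.range k, a i ω) (a k ω')| ≤ k * C * C :=
  (abs_real_inner_le_norm _ _).trans
    (mul_le_mul (h.norm_sum_le k ω) (h.norm_le k ω') (norm_nonneg _)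
      (mul_nonneg (Nat.cast_nonneg _) h.bound_nonneg))

lemma measurable_inner_sum (h : IsDegenerateArray P a N C s κ K η) (k : ℕ) :
    Measurable fun ω => inner ℝ (∑ i ∈ Finset.range k, a i ω) (a k ω) :=
  (h.measurable_sum k).inner (h.measurable k)

lemma integrable_crossSum_pow_mul (h : IsDegenerateArray P a N C s κ K η) (k m n : ℕ) :
    Integrable (fun ω => crossSum (fun i => a i ω) k ^ m *
      inner ℝ (∑ i ∈ Finset.range k, a i ω) (a k ω) ^ n) P := by
  refine Integrable.of_bound (((h.measurable_crossSum k).pow_const m).mul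
    ((h.measurable_inner_sum k).pow_const n)).aestronglyMeasurable
    ((∑ j ∈ Finset.range k, (j * C) * C) ^ m * (k * C * C) ^ n) (ae_of_all _ fun ω => ?_)
  rw [norm_mul, norm_pow, norm_pow, Real.norm_eq_abs, Real.norm_eq_abs]
  have h1 := abs_crossSum_le (fun i => h.norm_le i ω) k
  have h2 := h.abs_inner_sum_le k ω ω
  have h3 := (abs_nonneg _).trans h1
  gcongr

lemma integrable_inner_pow (h : IsDegenerateArray P a N C s κ K η) (k n : ℕ) :
    Integrable (fun ω => inner ℝ (∑ i ∈ Finset.range k, a i ω) (a k ω) ^ n) P := by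
  simpa using h.integrable_crossSum_pow_mul k 0 n

lemma integrable_crossSum_pow (h : IsDegenerateArray P a N C s κ K η) (k n : ℕ) :
    Integrable (fun ω => crossSum (fun i => a i ω) k ^ n) P := by
  simpa using h.integrable_crossSum_pow_mul k n 0

/-- Freezing the past: the `k`-th vector is integrated out first. -/
lemma integral_eq_integral_integral {E : Type*} [NormedAddCommGroup E] [NormedSpace ℝ E]
    (h : IsDegenerateArray P a N C s κ K η) {k : ℕ} (hk : k < N) {F : (H × ℝ) × H → E}
    (hF : StronglyMeasurable F)
    (hint : Integrable (fun ω => F ((∑ i ∈ Finset.range k, a i ω,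
      crossSum (fun i => a i ω) k), a k ω)) P) :
    ∫ ω, F ((∑ i ∈ Finset.range k, a i ω, crossSum (fun i => a i ω) k), a k ω) ∂P =
      ∫ ω, ∫ ω', F ((∑ i ∈ Finset.range k, a i ω, crossSum (fun i => a i ω) k), a k ω') ∂P ∂P :=
  (h.indep k hk).integral_comp_prodMk ((h.measurable_sum k).prodMk (h.measurable_crossSum k))
    (h.measurable k) hF hint

lemma integral_crossSum_pow_mul (h : IsDegenerateArray P a N C s κ K η) {k : ℕ} (hk : k < N)
    (m n : ℕ) :
    ∫ ω, crossSum (fun i => a i ω) k ^ m *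
        inner ℝ (∑ i ∈ Finset.range k, a i ω) (a k ω) ^ n ∂P =
      ∫ ω, crossSum (fun i => a i ω) k ^ m *
        ∫ ω', inner ℝ (∑ i ∈ Finset.range k, a i ω) (a k ω') ^ n ∂P ∂P := by
  rw [h.integral_eq_integral_integral hk (F := fun q => q.1.2 ^ m * inner ℝ q.1.1 q.2 ^ n)
    (Measurable.stronglyMeasurable (by fun_prop)) (h.integrable_crossSum_pow_mul k m n)]
  simp_rw [integral_const_mul]

lemma integral_crossSum (h : IsDegenerateArray P a N C s κ K η) {k : ℕ} (hk : k ≤ N) :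
    ∫ ω, crossSum (fun i => a i ω) k ∂P = 0 := by
  induction k with
  | zero => simp [crossSum]
  | succ k ih =>
    have h1 := h.integral_crossSum_pow_mul (k := k) (by omega) 0 1
    simp only [pow_zero, one_mul, pow_one, h.mean k (by omega), integral_zero] at h1
    have i1 := h.integrable_crossSum_pow k 1
    have i2 := h.integrable_inner_pow k 1
    simp only [pow_one] at i1 i2
    have h2 : ∀ ω, crossSum (fun i => a i ω) (k + 1) = crossSum (fun i => a i ω) k +
        inner ℝ (∑ i ∈ Finset.range k, a i ω) (a k ω) := fun ω => Finset.sum_range_succ _ _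
    simp_rw [h2]
    rw [integral_add i1 i2, ih (by omega), h1, add_zero]

lemma ae_norm_sq_sum (h : IsDegenerateArray P a N C s κ K η) {k : ℕ} (hk : k ≤ N) :
    ∀ᵐ ω ∂P, ‖∑ i ∈ Finset.range k, a i ω‖ ^ 2 = k * s + 2 * crossSum (fun i => a i ω) k := by
  have h1 : ∀ᵐ ω ∂P, ∀ i : Fin k, ‖a i ω‖ ^ 2 = s :=
    ae_all_iff.2 fun i => h.norm_sq i (by omega)
  filter_upwards [h1] with ω hω
  rw [norm_sq_sum_range, Finset.sum_range]
  simp [hω]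

lemma integrable_norm_pow_sum (h : IsDegenerateArray P a N C s κ K η) (k n : ℕ) :
    Integrable (fun ω => ‖∑ i ∈ Finset.range k, a i ω‖ ^ n) P := by
  refine Integrable.of_bound ((h.measurable_sum k).norm.pow_const n).aestronglyMeasurable
    ((k * C) ^ n) (ae_of_all _ fun ω => ?_)
  rw [norm_pow, norm_norm]
  gcongr
  exact h.norm_sum_le k ω

lemma integral_norm_sq_sum (h : IsDegenerateArray P a N C s κ K η) {k : ℕ} (hk : k ≤ N) :
    ∫ ω, ‖∑ i ∈ Finset.range k, a i ω‖ ^ 2 ∂P = k * s := by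
  have i1 := h.integrable_crossSum_pow k 1
  simp only [pow_one] at i1
  rw [integral_congr_ae (h.ae_norm_sq_sum hk), integral_add (integrable_const _) (i1.const_mul _),
    integral_const_mul 2, h.integral_crossSum hk]
  simp

lemma integral_inner_sum_sq_le (h : IsDegenerateArray P a N C s κ K η) {k : ℕ} (hk : k < N) :
    ∫ ω, inner ℝ (∑ i ∈ Finset.range k, a i ω) (a k ω) ^ 2 ∂P ≤ κ * (k * s) := by
  have h1 := h.integral_crossSum_pow_mul hk 0 2
  simp only [pow_zero, one_mul] at h1
  rw [h1, ← h.integral_norm_sq_sum hk.le, ← integral_const_mul]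
  refine integral_mono_of_nonneg (ae_of_all _ fun ω => integral_nonneg fun ω' => sq_nonneg _)
    ((h.integrable_norm_pow_sum k 2).const_mul _) (ae_of_all _ fun ω => h.second_le k hk _)

lemma integral_crossSum_sq_le (h : IsDegenerateArray P a N C s κ K η) (hκ : 0 ≤ κ)
    (hs1 : s ≤ 1) {k : ℕ} (hk : k ≤ N) :
    ∫ ω, crossSum (fun i => a i ω) k ^ 2 ∂P ≤ κ * (k : ℝ) ^ 2 := by
  induction k with
  | zero => simp [crossSum]
  | succ k ih =>
    have h1 := h.integral_crossSum_pow_mul (k := k) (by omega) 1 1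
    simp only [pow_one, h.mean k (by omega), mul_zero, integral_zero] at h1
    have h3 := h.integral_inner_sum_sq_le (k := k) (by omega)
    have i1 := h.integrable_crossSum_pow k 2
    have i2 := h.integrable_inner_pow k 2
    have i3 := h.integrable_crossSum_pow_mul k 1 1
    simp only [pow_one] at i3
    have h2 : ∀ ω, crossSum (fun i => a i ω) (k + 1) ^ 2 = crossSum (fun i => a i ω) k ^ 2 +
        (2 * (crossSum (fun i => a i ω) k * inner ℝ (∑ i ∈ Finset.range k, a i ω) (a k ω)) +
          inner ℝ (∑ i ∈ Finset.range k, a i ω) (a k ω) ^ 2) := fun ω => by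
      have : crossSum (fun i => a i ω) (k + 1) = crossSum (fun i => a i ω) k +
        inner ℝ (∑ i ∈ Finset.range k, a i ω) (a k ω) := Finset.sum_range_succ _ _
      rw [this]; ring
    have i4 : Integrable (fun ω => 2 * (crossSum (fun i => a i ω) k *
        inner ℝ (∑ i ∈ Finset.range k, a i ω) (a k ω)) +
          inner ℝ (∑ i ∈ Finset.range k, a i ω) (a k ω) ^ 2) P := (i3.const_mul _).add i2
    simp_rw [h2]
    rw [integral_add i1 i4, integral_add (i3.const_mul _) i2, integral_const_mul, h1]
    have h4 := ih (by omega)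
    have h5 : κ * (k * s) ≤ κ * (k * 1) := by gcongr
    push_cast
    nlinarith

lemma integral_norm_pow_four_sum_le (h : IsDegenerateArray P a N C s κ K η) (hκ : 0 ≤ κ)
    (hκ1 : κ ≤ 1) (hs0 : 0 ≤ s) (hs1 : s ≤ 1) {k : ℕ} (hk : k ≤ N) :
    ∫ ω, ‖∑ i ∈ Finset.range k, a i ω‖ ^ 4 ∂P ≤ 5 * (k : ℝ) ^ 2 := by
  have i1 := h.integrable_crossSum_pow k 1
  have i2 := h.integrable_crossSum_pow k 2
  simp only [pow_one] at i1
  have h1 : ∀ᵐ ω ∂P, ‖∑ i ∈ Finset.range k, a i ω‖ ^ 4 = (k * s) ^ 2 +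
      (4 * (k * s) * crossSum (fun i => a i ω) k + 4 * crossSum (fun i => a i ω) k ^ 2) := by
    filter_upwards [h.ae_norm_sq_sum hk] with ω hω
    have : ‖∑ i ∈ Finset.range k, a i ω‖ ^ 4 = (‖∑ i ∈ Finset.range k, a i ω‖ ^ 2) ^ 2 := by ring
    rw [this, hω]
    ring
  have i3 : Integrable (fun ω => 4 * (k * s) * crossSum (fun i => a i ω) k +
      4 * crossSum (fun i => a i ω) k ^ 2) P := (i1.const_mul _).add (i2.const_mul _)
  rw [integral_congr_ae h1, integral_add (integrable_const _) i3,
    integral_add (i1.const_mul _) (i2.const_mul _), integral_const_mul, integral_const_mul,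
    h.integral_crossSum hk]
  have h2 := h.integral_crossSum_sq_le hκ hs1 hk
  have h3 : κ * (k : ℝ) ^ 2 ≤ 1 * (k : ℝ) ^ 2 := by gcongr
  have h4 : (k * s) ^ 2 ≤ ((k : ℝ) * 1) ^ 2 := by gcongr
  simp only [integral_const, probReal_univ, smul_eq_mul, one_mul, mul_zero, zero_add]
  linarith

lemma integral_inner_sum_pow_four_le (h : IsDegenerateArray P a N C s κ K η) (hκ : 0 ≤ κ)
    (hκ1 : κ ≤ 1) (hs0 : 0 ≤ s) (hs1 : s ≤ 1) (hK : 0 ≤ K) {k : ℕ} (hk : k < N) :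
    ∫ ω, inner ℝ (∑ i ∈ Finset.range k, a i ω) (a k ω) ^ 4 ∂P ≤ 5 * K * (κ * k) ^ 2 := by
  have h1 := h.integral_crossSum_pow_mul hk 0 4
  simp only [pow_zero, one_mul] at h1
  rw [h1]
  calc _ ≤ ∫ ω, K * κ ^ 2 * ‖∑ i ∈ Finset.range k, a i ω‖ ^ 4 ∂P := by
        refine integral_mono_of_nonneg (ae_of_all _ fun ω => integral_nonneg fun ω' => by positivity)
          ((h.integrable_norm_pow_sum k 4).const_mul _) (ae_of_all _ fun ω => ?_)
        refine (h.fourth_le k hk _).trans (le_of_eq ?_)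
        ring
    _ ≤ K * κ ^ 2 * (5 * (k : ℝ) ^ 2) := by
        rw [integral_const_mul]
        exact mul_le_mul_of_nonneg_left (h.integral_norm_pow_four_sum_le hκ hκ1 hs0 hs1 hk.le)
          (by positivity)
    _ = _ := by ring

/-- The second moment of `⟪z, a k⟫`. With the partial sum of the first `k` vectors in place of `z`
this is the conditional variance of the `k`-th increment of the cross sum given the past. -/
noncomputable def condVar (P : Measure Ω) (a : ℕ → Ω → H) (k : ℕ) (z : H) : ℝ :=
  ∫ ω', inner ℝ z (a k ω') ^ 2 ∂P

lemma measurable_condVar (h : IsDegenerateArray P a N C s κ K η) (k : ℕ) :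
    Measurable (condVar P a k) := by
  have h1 : StronglyMeasurable (fun q : H × Ω => inner ℝ q.1 (a k q.2) ^ 2) := by
    refine Measurable.stronglyMeasurable ?_
    have := h.measurable k
    fun_prop
  exact h1.integral_prod_right'.measurable

lemma condVar_nonneg (k : ℕ) (z : H) : 0 ≤ condVar P a k z :=
  integral_nonneg fun _ => sq_nonneg _

lemma integrable_condVar_sum (h : IsDegenerateArray P a N C s κ K η) {k : ℕ} (hk : k < N) :
    Integrable (fun ω => condVar P a k (∑ i ∈ Finset.range k, a i ω)) P := by
  refine ((h.integrable_norm_pow_sum k 2).const_mul κ).mono'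
    ((h.measurable_condVar k).comp (h.measurable_sum k)).aestronglyMeasurable
    (ae_of_all _ fun ω => ?_)
  rw [Real.norm_of_nonneg (condVar_nonneg _ _)]
  exact h.second_le k hk _

lemma integral_condVar_sum (h : IsDegenerateArray P a N C s κ K η) {k : ℕ} (hk : k < N) :
    ∫ ω, condVar P a k (∑ i ∈ Finset.range k, a i ω) ∂P =
      ∫ ω, inner ℝ (∑ i ∈ Finset.range k, a i ω) (a k ω) ^ 2 ∂P := by
  have h1 := h.integral_crossSum_pow_mul hk 0 2
  simp only [pow_zero, one_mul] at h1
  exact h1.symm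

/-- The vectors being independent and centered, squared linear functionals of the partial sums
have additive means. -/
lemma integral_inner_sum_sq (h : IsDegenerateArray P a N C s κ K η) (z : H) {k : ℕ} (hk : k ≤ N) :
    ∫ ω, inner ℝ (∑ i ∈ Finset.range k, a i ω) z ^ 2 ∂P =
      ∑ i ∈ Finset.range k, ∫ ω, inner ℝ (a i ω) z ^ 2 ∂P := by
  induction k with
  | zero => simp
  | succ k ih =>
    have hm1 : Measurable fun ω => inner ℝ (∑ i ∈ Finset.range k, a i ω) z :=
      (h.measurable_sum k).inner measurable_const
    have hm2 : Measurable fun ω => inner ℝ (a k ω) z := (h.measurable k).inner measurable_const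
    have hb1 : ∀ ω, |inner ℝ (∑ i ∈ Finset.range k, a i ω) z| ≤ k * C * ‖z‖ := fun ω =>
      (abs_real_inner_le_norm _ _).trans
        (mul_le_mul_of_nonneg_right (h.norm_sum_le k ω) (norm_nonneg _))
    have hb2 : ∀ ω, |inner ℝ (a k ω) z| ≤ C * ‖z‖ := fun ω =>
      (abs_real_inner_le_norm _ _).trans
        (mul_le_mul_of_nonneg_right (h.norm_le k ω) (norm_nonneg _))
    have hC := h.bound_nonneg
    have i1 : Integrable (fun ω => inner ℝ (∑ i ∈ Finset.range k, a i ω) z ^ 2) P := by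
      refine Integrable.of_bound (hm1.pow_const 2).aestronglyMeasurable ((k * C * ‖z‖) ^ 2)
        (ae_of_all _ fun ω => ?_)
      rw [norm_pow, Real.norm_eq_abs]
      gcongr
      exact hb1 ω
    have i2 : Integrable (fun ω => inner ℝ (a k ω) z ^ 2) P := by
      refine Integrable.of_bound (hm2.pow_const 2).aestronglyMeasurable ((C * ‖z‖) ^ 2)
        (ae_of_all _ fun ω => ?_)
      rw [norm_pow, Real.norm_eq_abs]
      gcongr
      exact hb2 ω
    have i3 : Integrable (fun ω => inner ℝ (∑ i ∈ Finset.range k, a i ω) z * inner ℝ (a k ω) z)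
        P := by
      refine Integrable.of_bound (hm1.mul hm2).aestronglyMeasurable ((k * C * ‖z‖) * (C * ‖z‖))
        (ae_of_all _ fun ω => ?_)
      rw [norm_mul, Real.norm_eq_abs, Real.norm_eq_abs]
      exact mul_le_mul (hb1 ω) (hb2 ω) (abs_nonneg _) (by positivity)
    have h3 : ∫ ω, inner ℝ (∑ i ∈ Finset.range k, a i ω) z * inner ℝ (a k ω) z ∂P = 0 := by
      rw [h.integral_eq_integral_integral (by omega)
        (F := fun q => inner ℝ q.1.1 z * inner ℝ q.2 z)
        (Measurable.stronglyMeasurable (by fun_prop)) i3]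
      have h0 : ∫ ω, inner ℝ (a k ω) z ∂P = 0 := by
        rw [← h.mean k (by omega) z]
        exact integral_congr_ae (ae_of_all _ fun ω => real_inner_comm _ _)
      simp_rw [integral_const_mul, h0]
      simp
    have h2 : ∀ ω, inner ℝ (∑ i ∈ Finset.range (k + 1), a i ω) z ^ 2 =
        inner ℝ (∑ i ∈ Finset.range k, a i ω) z ^ 2 +
          (2 * (inner ℝ (∑ i ∈ Finset.range k, a i ω) z * inner ℝ (a k ω) z) +
            inner ℝ (a k ω) z ^ 2) := fun ω => by
      rw [Finset.sum_range_succ, inner_add_left]; ring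
    have i4 : Integrable (fun ω => 2 * (inner ℝ (∑ i ∈ Finset.range k, a i ω) z *
        inner ℝ (a k ω) z) + inner ℝ (a k ω) z ^ 2) P := (i3.const_mul _).add i2
    simp_rw [h2]
    rw [integral_add i1 i4, integral_add (i3.const_mul _) i2, integral_const_mul, h3,
      ih (by omega), Finset.sum_range_succ]
    ring

/-- Lower bound for the variance of an increment of the cross sum, matching the upper bound
`integral_inner_sum_sq_le` up to `k * η`. -/
lemma le_integral_inner_sum_sq (h : IsDegenerateArray P a N C s κ K η) {k : ℕ} (hk : k < N) :
    k * (κ * s - η) ≤ ∫ ω, inner ℝ (∑ i ∈ Finset.range k, a i ω) (a k ω) ^ 2 ∂P := by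
  have hC := h.bound_nonneg
  -- freeze the `k`-th vector instead of the past
  have h1 := (h.indep k hk).symm.integral_comp_prodMk (h.measurable k)
    ((h.measurable_sum k).prodMk (h.measurable_crossSum k))
    (F := fun q => inner ℝ q.2.1 q.1 ^ 2) (Measurable.stronglyMeasurable (by fun_prop))
    (h.integrable_inner_pow k 2)
  rw [h1]
  simp_rw [h.integral_inner_sum_sq _ hk.le]
  have hmeas : ∀ i, StronglyMeasurable fun ω' => ∫ ω, inner ℝ (a i ω) (a k ω') ^ 2 ∂P := by
    intro i
    have h2 : StronglyMeasurable (fun q : Ω × Ω => inner ℝ (a i q.2) (a k q.1) ^ 2) := by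
      refine Measurable.stronglyMeasurable ?_
      have := h.measurable k
      have := h.measurable i
      fun_prop
    exact h2.integral_prod_right'
  rw [integral_finsetSum]
  · calc k * (κ * s - η) = ∑ i ∈ Finset.range k, (κ * s - η) := by simp [mul_sub]
      _ ≤ _ := Finset.sum_le_sum fun i hi => h.le_second k hk i (Finset.mem_range.1 hi)
  · intro i _
    refine Integrable.of_bound (hmeas i).aestronglyMeasurable ((C * C) ^ 2)
      (ae_of_all _ fun ω' => ?_)
    refine (norm_integral_le_of_norm_le_const (C := (C * C) ^ 2) (ae_of_all _ fun ω => ?_)).trans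
      (by simp)
    rw [norm_pow, Real.norm_eq_abs]
    have := (abs_real_inner_le_norm (a i ω) (a k ω')).trans
      (mul_le_mul (h.norm_le i ω) (h.norm_le k ω') (norm_nonneg _) hC)
    gcongr

/-- The conditional variances concentrate around their deterministic proxies `κ s k`. They lie below
`κ ‖W‖ ^ 2`, with `W` the partial sum, and the gap, being nonnegative, is controlled by its mean;
`κ ‖W‖ ^ 2` itself differs from `κ s k` by `2 κ` times the cross sum. -/
lemma integral_abs_condVar_sub_le (h : IsDegenerateArray P a N C s κ K η) (hκ : 0 ≤ κ)
    (hs1 : s ≤ 1) {k : ℕ} (hk : k < N) :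
    ∫ ω, |condVar P a k (∑ i ∈ Finset.range k, a i ω) - κ * (k * s)| ∂P ≤
      k * η + 2 * κ * (√κ * k) := by
  have i0 := h.integrable_condVar_sum hk
  have iN := (h.integrable_norm_pow_sum k 2).const_mul κ
  have iZ := h.integrable_crossSum_pow k 1
  simp only [pow_one] at iZ
  have hle : ∀ᵐ ω ∂P, |condVar P a k (∑ i ∈ Finset.range k, a i ω) - κ * (k * s)| ≤
      (κ * ‖∑ i ∈ Finset.range k, a i ω‖ ^ 2 - condVar P a k (∑ i ∈ Finset.range k, a i ω)) +
        2 * κ * |crossSum (fun i => a i ω) k| := by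
    filter_upwards [h.ae_norm_sq_sum hk.le] with ω hω
    have h1 : condVar P a k (∑ i ∈ Finset.range k, a i ω) ≤
      κ * ‖∑ i ∈ Finset.range k, a i ω‖ ^ 2 := h.second_le k hk _
    rw [hω] at h1 ⊢
    have h2 := neg_abs_le (crossSum (fun i => a i ω) k)
    have h3 := le_abs_self (crossSum (fun i => a i ω) k)
    have h4 := mul_le_mul_of_nonneg_left h2 hκ
    have h5 := mul_le_mul_of_nonneg_left h3 hκ
    rw [abs_le]
    constructor <;> nlinarith
  refine (integral_mono_of_nonneg (ae_of_all _ fun ω => abs_nonneg _)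
    ((iN.sub i0).add (iZ.abs.const_mul _)) hle).trans ?_
  simp only [Pi.add_apply, Pi.sub_apply]
  have i1 : Integrable (fun ω => κ * ‖∑ i ∈ Finset.range k, a i ω‖ ^ 2 -
      condVar P a k (∑ i ∈ Finset.range k, a i ω)) P := iN.sub i0
  rw [integral_add i1 (iZ.abs.const_mul _), integral_sub iN i0, integral_const_mul,
    integral_const_mul, h.integral_norm_sq_sum hk.le, h.integral_condVar_sum hk]
  have h1 := h.le_integral_inner_sum_sq hk
  have h2 := (integral_abs_le_sqrt iZ (h.integrable_crossSum_pow k 2)).trans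
    (Real.sqrt_le_sqrt (h.integral_crossSum_sq_le hκ hs1 hk.le))
  rw [Real.sqrt_mul hκ, Real.sqrt_sq (Nat.cast_nonneg k)] at h2
  have h3 := mul_le_mul_of_nonneg_left h2 (by positivity : 0 ≤ 2 * κ)
  linarith

/-! ### Characteristic functions of the cross sums -/

lemma measurable_cexp_crossSum (h : IsDegenerateArray P a N C s κ K η) (t : ℝ) (k : ℕ) :
    Measurable fun ω => Complex.exp ((t * crossSum (fun i => a i ω) k : ℝ) * Complex.I) := by
  have := h.measurable_crossSum k
  fun_prop

lemma integrable_cexp_crossSum_mul (h : IsDegenerateArray P a N C s κ K η) (t : ℝ) (k : ℕ)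
    {f : Ω → ℝ} (hf : Integrable f P) :
    Integrable (fun ω => Complex.exp ((t * crossSum (fun i => a i ω) k : ℝ) * Complex.I) *
      (f ω : ℂ)) P :=
  hf.ofReal.bdd_mul (h.measurable_cexp_crossSum t k).aestronglyMeasurable (c := 1)
    (ae_of_all _ fun _ => (Complex.norm_exp_ofReal_mul_I _).le)

/-- The past may be frozen under the oscillating factor. -/
lemma integral_cexp_crossSum_mul (h : IsDegenerateArray P a N C s κ K η) (t : ℝ) {k : ℕ}
    (hk : k < N) (n : ℕ) :
    ∫ ω, Complex.exp ((t * crossSum (fun i => a i ω) k : ℝ) * Complex.I) *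
        ((inner ℝ (∑ i ∈ Finset.range k, a i ω) (a k ω) ^ n : ℝ) : ℂ) ∂P =
      ∫ ω, Complex.exp ((t * crossSum (fun i => a i ω) k : ℝ) * Complex.I) *
        ((∫ ω', inner ℝ (∑ i ∈ Finset.range k, a i ω) (a k ω') ^ n ∂P : ℝ) : ℂ) ∂P := by
  rw [h.integral_eq_integral_integral hk (F := fun q => Complex.exp ((t * q.1.2 : ℝ) * Complex.I) *
    ((inner ℝ q.1.1 q.2 ^ n : ℝ) : ℂ)) (Measurable.stronglyMeasurable (by fun_prop))
    (h.integrable_cexp_crossSum_mul t k (h.integrable_inner_pow k n))]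
  simp_rw [integral_const_mul]
  congr 1
  ext ω
  rw [integral_complex_ofReal]

/-- One step of the recursion for the characteristic function of the cross sums: expand the
exponential of the increment to second order and integrate out the `k`-th vector. -/
lemma norm_charFun_step_le (h : IsDegenerateArray P a N C s κ K η) (hκ : 0 ≤ κ) (hs0 : 0 ≤ s)
    (t : ℝ) {k : ℕ} (hk : k < N) :
    ‖∫ ω, Complex.exp ((t * crossSum (fun i => a i ω) (k + 1) : ℝ) * Complex.I) ∂P -
      (Real.exp (-(t ^ 2 / 2 * (κ * (k * s)))) : ℝ) *
        ∫ ω, Complex.exp ((t * crossSum (fun i => a i ω) k : ℝ) * Complex.I) ∂P‖ ≤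
      4 * |t| ^ 3 * ∫ ω, |inner ℝ (∑ i ∈ Finset.range k, a i ω) (a k ω)| ^ 3 ∂P +
      t ^ 2 / 2 *
        ∫ ω, |condVar P a k (∑ i ∈ Finset.range k, a i ω) - κ * (k * s)| ∂P +
      (t ^ 2 / 2 * (κ * (k * s))) ^ 2 := by
  set e : Ω → ℂ := fun ω => Complex.exp ((t * crossSum (fun i => a i ω) k : ℝ) * Complex.I)
    with he
  set Y : Ω → ℝ := fun ω => inner ℝ (∑ i ∈ Finset.range k, a i ω) (a k ω) with hY
  set v : Ω → ℝ := fun ω => condVar P a k (∑ i ∈ Finset.range k, a i ω) with hv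
  set b : ℝ := κ * (k * s) with hb
  have hb0 : 0 ≤ b := by positivity
  set r : ℝ := Real.exp (-(t ^ 2 / 2 * b)) with hr
  set R : Ω → ℂ := fun ω => Complex.exp ((t * Y ω : ℝ) * Complex.I) - 1 -
    (t * Y ω : ℝ) * Complex.I + ((t * Y ω : ℝ) : ℂ) ^ 2 / 2 with hR
  have hYm : Measurable Y := h.measurable_inner_sum k
  have hem : Measurable e := h.measurable_cexp_crossSum t k
  have he1 : ∀ ω, ‖e ω‖ = 1 := fun ω => Complex.norm_exp_ofReal_mul_I _
  have iY1 : Integrable Y P := by simpa using h.integrable_inner_pow k 1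
  have iY2 : Integrable (fun ω => Y ω ^ 2) P := h.integrable_inner_pow k 2
  have iY3 : Integrable (fun ω => |Y ω| ^ 3) P := by
    have := (h.integrable_inner_pow k 3).abs
    simpa [abs_pow] using this
  have iv : Integrable v P := h.integrable_condVar_sum hk
  have hRle : ∀ ω, ‖R ω‖ ≤ 4 * |t| ^ 3 * |Y ω| ^ 3 := fun ω => by
    refine (norm_cexp_I_mul_sub_le (t * Y ω)).trans (le_of_eq ?_)
    rw [abs_mul, mul_pow, mul_assoc]
  have iR : Integrable (fun ω => e ω * R ω) P := by
    have hRm : Measurable R := by fun_prop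
    refine (iY3.const_mul (4 * |t| ^ 3)).mono' (hem.mul hRm).aestronglyMeasurable
      (ae_of_all _ fun ω => ?_)
    rw [norm_mul, he1, one_mul]
    exact hRle ω
  have ie : Integrable e P := by
    simpa [he] using h.integrable_cexp_crossSum_mul t k (integrable_const (1 : ℝ))
  have i1 : Integrable (fun ω => e ω * (Y ω : ℂ)) P := h.integrable_cexp_crossSum_mul t k iY1
  have i2 : Integrable (fun ω => e ω * ((Y ω ^ 2 : ℝ) : ℂ)) P :=
    h.integrable_cexp_crossSum_mul t k iY2
  have i3 : Integrable (fun ω => e ω * (v ω : ℂ)) P := h.integrable_cexp_crossSum_mul t k iv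
  have i4 : Integrable (fun ω => e ω * ((v ω - b : ℝ) : ℂ)) P :=
    h.integrable_cexp_crossSum_mul t k (iv.sub (integrable_const b))
  have z1 : ∫ ω, e ω * (Y ω : ℂ) ∂P = 0 := by
    have := h.integral_cexp_crossSum_mul t hk 1
    simp only [pow_one, h.mean k hk, Complex.ofReal_zero, mul_zero, integral_zero] at this
    exact this
  have z2 : ∫ ω, e ω * ((Y ω ^ 2 : ℝ) : ℂ) ∂P = ∫ ω, e ω * (v ω : ℂ) ∂P :=
    h.integral_cexp_crossSum_mul t hk 2
  have hstep : ∀ ω, Complex.exp ((t * crossSum (fun i => a i ω) (k + 1) : ℝ) * Complex.I) =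
      e ω * R ω + (t * Complex.I * (e ω * (Y ω : ℂ)) +
        ((-(t ^ 2 / 2) : ℝ) * (e ω * ((Y ω ^ 2 : ℝ) : ℂ)) + e ω)) := fun ω => by
    have h1 : crossSum (fun i => a i ω) (k + 1) = crossSum (fun i => a i ω) k + Y ω :=
      Finset.sum_range_succ _ _
    have h2 : Complex.exp ((t * crossSum (fun i => a i ω) (k + 1) : ℝ) * Complex.I) =
        e ω * Complex.exp ((t * Y ω : ℝ) * Complex.I) := by
      rw [he, ← Complex.exp_add, h1]
      congr 1
      push_cast
      ring
    rw [h2, hR]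
    push_cast
    ring
  have hphi : ∫ ω, Complex.exp ((t * crossSum (fun i => a i ω) (k + 1) : ℝ) * Complex.I) ∂P =
      ∫ ω, e ω * R ω ∂P + ((-(t ^ 2 / 2) : ℝ) * ∫ ω, e ω * (v ω : ℂ) ∂P + ∫ ω, e ω ∂P) := by
    simp_rw [hstep]
    rw [integral_add iR, integral_add (i1.const_mul _), integral_add (i2.const_mul _) ie,
      integral_const_mul, integral_const_mul, z1, z2, mul_zero, zero_add]
    · exact (i2.const_mul _).add ie
    · exact (i1.const_mul _).add ((i2.const_mul _).add ie)
  have hv2 : ∫ ω, e ω * (v ω : ℂ) ∂P = ∫ ω, e ω * ((v ω - b : ℝ) : ℂ) ∂P + b * ∫ ω, e ω ∂P := by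
    rw [← integral_const_mul, ← integral_add i4 (ie.const_mul _)]
    congr 1
    ext ω
    push_cast
    ring
  have hdecomp : ∫ ω, Complex.exp ((t * crossSum (fun i => a i ω) (k + 1) : ℝ) * Complex.I) ∂P -
      (r : ℂ) * ∫ ω, e ω ∂P = ∫ ω, e ω * R ω ∂P +
        (-(t ^ 2 / 2) : ℝ) * ∫ ω, e ω * ((v ω - b : ℝ) : ℂ) ∂P +
        ((1 - t ^ 2 / 2 * b - r : ℝ) : ℂ) * ∫ ω, e ω ∂P := by
    rw [hphi, hv2]
    push_cast
    ring
  rw [hdecomp]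
  refine (norm_add₃_le).trans (add_le_add (add_le_add ?_ ?_) ?_)
  · rw [← integral_const_mul]
    refine norm_integral_le_of_norm_le (iY3.const_mul _) (ae_of_all _ fun ω => ?_)
    rw [norm_mul, he1, one_mul]
    exact hRle ω
  · rw [norm_mul, Complex.norm_real, norm_neg, Real.norm_of_nonneg (by positivity)]
    refine mul_le_mul_of_nonneg_left ?_ (by positivity)
    refine norm_integral_le_of_norm_le (iv.sub (integrable_const b)).abs (ae_of_all _ fun ω => ?_)
    rw [norm_mul, he1, one_mul, Complex.norm_real, Real.norm_eq_abs]
  · rw [norm_mul, Complex.norm_real, Real.norm_eq_abs]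
    have h1 := abs_one_sub_sub_exp_neg_le (x := t ^ 2 / 2 * b) (by positivity)
    have h2 : ‖∫ ω, e ω ∂P‖ ≤ 1 := by
      refine (norm_integral_le_of_norm_le_const (C := 1) (ae_of_all _ fun ω => (he1 ω).le)).trans
        (by simp)
    calc _ ≤ (t ^ 2 / 2 * b) ^ 2 * 1 := mul_le_mul h1 h2 (norm_nonneg _) (by positivity)
      _ = _ := mul_one _

/-- Quantitative central limit theorem for the cross sum of independent vectors: its
characteristic function is close to that of the centered Gaussian with variance
`κ s N (N - 1) / 2`. The free parameter `θ` weighs the second against the fourth moment in the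
bound for the third absolute moment of an increment. -/
theorem norm_charFun_crossSum_sub_le (h : IsDegenerateArray P a N C s κ K η) (hκ : 0 ≤ κ)
    (hκ1 : κ ≤ 1) (hs0 : 0 ≤ s) (hs1 : s ≤ 1) (hK : 0 ≤ K) (hη : 0 ≤ η) (t : ℝ) {θ : ℝ}
    (hθ : 0 < θ) :
    ‖∫ ω, Complex.exp ((t * crossSum (fun i => a i ω) N : ℝ) * Complex.I) ∂P -
      (Real.exp (-(t ^ 2 / 2 * (κ * s * (N * (N - 1) / 2)))) : ℝ)‖ ≤
      N * (4 * |t| ^ 3 * ((θ * (κ * N) + 5 * K * (κ * N) ^ 2 / θ) / 2) +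
        t ^ 2 / 2 * (N * η + 2 * κ * (√κ * N)) + (t ^ 2 / 2 * (κ * N)) ^ 2) := by
  have hprod : ∏ k ∈ Finset.range N, Real.exp (-(t ^ 2 / 2 * (κ * (k * s)))) =
      Real.exp (-(t ^ 2 / 2 * (κ * s * (N * (N - 1) / 2)))) := by
    rw [← Real.exp_sum]
    congr 1
    have : ∀ n : ℕ, ∑ k ∈ Finset.range n, (k : ℝ) = n * (n - 1) / 2 := by
      intro n
      induction n with
      | zero => simp
      | succ n ih => rw [Finset.sum_range_succ, ih]; push_cast; ring
    rw [← this, Finset.sum_neg_distrib, Finset.mul_sum, Finset.mul_sum]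
    congr 1
    exact Finset.sum_congr rfl fun k _ => by ring
  rw [← hprod]
  refine (norm_sub_prod_le_sum
    (φ := fun k => ∫ ω, Complex.exp ((t * crossSum (fun i => a i ω) k : ℝ) * Complex.I) ∂P)
    (r := fun k => Real.exp (-(t ^ 2 / 2 * (κ * (k * s)))))
    (err := fun _ => 4 * |t| ^ 3 * ((θ * (κ * N) + 5 * K * (κ * N) ^ 2 / θ) / 2) +
        t ^ 2 / 2 * (N * η + 2 * κ * (√κ * N)) + (t ^ 2 / 2 * (κ * N)) ^ 2)
    ?_ ?_ ?_).trans ?_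
  · simp [crossSum]
  · intro k _
    rw [abs_of_pos (Real.exp_pos _)]
    exact Real.exp_le_one_iff.2 (by simp only [Left.neg_nonpos_iff]; positivity)
  · intro k hk
    have hkN : (k : ℝ) ≤ N := by exact_mod_cast hk.le
    refine (h.norm_charFun_step_le hκ hs0 t hk).trans ?_
    have e1 : ∫ ω, |inner ℝ (∑ i ∈ Finset.range k, a i ω) (a k ω)| ^ 3 ∂P ≤
        (θ * (κ * N) + 5 * K * (κ * N) ^ 2 / θ) / 2 := by
      have i2 := h.integrable_inner_pow k 2
      have i4 := h.integrable_inner_pow k 4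
      have hpt : ∀ y : ℝ, |y| ^ 3 ≤ θ / 2 * y ^ 2 + 1 / (2 * θ) * y ^ 4 := by
        intro y
        have h1 : θ / 2 * y ^ 2 + 1 / (2 * θ) * y ^ 4 - |y| ^ 3 =
            1 / (2 * θ) * y ^ 2 * (|y| - θ) ^ 2 := by
          have h2 : y ^ 4 = y ^ 2 * |y| ^ 2 := by rw [sq_abs]; ring
          have h3 : |y| ^ 3 = y ^ 2 * |y| := by rw [← sq_abs]; ring
          rw [h2, h3]
          field_simp
          ring
        have h2 : 0 ≤ 1 / (2 * θ) * y ^ 2 * (|y| - θ) ^ 2 := by positivity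
        linarith
      calc _ ≤ ∫ ω, (θ / 2 * inner ℝ (∑ i ∈ Finset.range k, a i ω) (a k ω) ^ 2 +
            1 / (2 * θ) * inner ℝ (∑ i ∈ Finset.range k, a i ω) (a k ω) ^ 4) ∂P :=
            integral_mono_of_nonneg (ae_of_all _ fun ω => by positivity)
              ((i2.const_mul _).add (i4.const_mul _)) (ae_of_all _ fun ω => hpt _)
        _ ≤ θ / 2 * (κ * (N * 1)) + 1 / (2 * θ) * (5 * K * (κ * N) ^ 2) := by
            rw [integral_add (i2.const_mul _) (i4.const_mul _), integral_const_mul,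
              integral_const_mul]
            refine add_le_add (mul_le_mul_of_nonneg_left ?_ (by positivity))
              (mul_le_mul_of_nonneg_left ?_ (by positivity))
            · refine (h.integral_inner_sum_sq_le hk).trans ?_
              gcongr
            · refine (h.integral_inner_sum_pow_four_le hκ hκ1 hs0 hs1 hK hk).trans ?_
              gcongr
        _ = _ := by field_simp
    have e2 : ∫ ω, |condVar P a k (∑ i ∈ Finset.range k, a i ω) - κ * (k * s)| ∂P ≤
        N * η + 2 * κ * (√κ * N) := by
      refine (h.integral_abs_condVar_sub_le hκ hs1 hk).trans ?_
      gcongr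
    have e3 : (t ^ 2 / 2 * (κ * (k * s))) ^ 2 ≤ (t ^ 2 / 2 * (κ * N)) ^ 2 := by
      have : (k : ℝ) * s ≤ N * 1 := by gcongr
      rw [mul_one] at this
      gcongr
    gcongr
  · rw [Finset.sum_const, Finset.card_range, nsmul_eq_mul]

end IsDegenerateArray

/-! ### Covariances of the centered outer products of two sections -/

section

variable {n : Type*} [Fintype n] {P P' : Matrix n n ℝ}

lemma dotProduct_mulVec_nonneg_of_idempotent (hPt : Pᵀ = P) (hP : P * P = P) (v : n → ℝ) :
    0 ≤ v ⬝ᵥ (P *ᵥ v) := by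
  have h : v ⬝ᵥ (P *ᵥ v) = (P *ᵥ v) ⬝ᵥ (P *ᵥ v) := by
    rw [Matrix.dotProduct_mulVec (P *ᵥ v), Matrix.vecMul_mulVec, hPt, hP,
      ← Matrix.dotProduct_mulVec]
  rw [h]
  exact Finset.sum_nonneg fun i _ => mul_self_nonneg _

lemma trace_mul_nonneg_of_idempotent (hPt : Pᵀ = P) (hP : P * P = P) (hPt' : P'ᵀ = P')
    (hP' : P' * P' = P') : 0 ≤ (P * P').trace := by
  have h := trace_transpose_mul_self_nonneg (P * P')
  rwa [Matrix.transpose_mul, hPt, hPt', Matrix.mul_assoc, ← Matrix.mul_assoc P P, hP,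
    Matrix.trace_mul_comm, Matrix.mul_assoc, hP'] at h

variable [DecidableEq n]

lemma dotProduct_mulVec_le_of_idempotent (hPt : Pᵀ = P) (hP : P * P = P) (v : n → ℝ) :
    v ⬝ᵥ (P *ᵥ v) ≤ v ⬝ᵥ v := by
  have h := dotProduct_mulVec_nonneg_of_idempotent (P := 1 - P) (by simp [hPt])
    (IsIdempotentElem.one_sub hP).eq v
  rw [Matrix.sub_mulVec, Matrix.one_mulVec, dotProduct_sub] at h
  linarith

lemma trace_mul_le_of_idempotent (hPt : Pᵀ = P) (hP : P * P = P) (hPt' : P'ᵀ = P')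
    (hP' : P' * P' = P') : (P * P').trace ≤ P'.trace := by
  have h := trace_mul_nonneg_of_idempotent (P := 1 - P) (by simp [hPt])
    (IsIdempotentElem.one_sub hP).eq hPt' hP'
  rw [sub_mul, Matrix.one_mul, Matrix.trace_sub] at h
  linarith

/-- Lower bound for the variance functional of one section along the centered outer product
`u uᵀ - P' / m` of another section. -/
lemma le_trace_compression_vecMulVec_sub (hPt : Pᵀ = P) (hP : P * P = P) (hPt' : P'ᵀ = P')
    (hP' : P' * P' = P') {m : ℝ} (hm : 0 < m) (htr' : P'.trace = m)
    {u : n → ℝ} (hu : u ⬝ᵥ u = 1) :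
    2 * (u ⬝ᵥ (P *ᵥ u)) - 1 - 3 / m ≤
      (P * (Matrix.vecMulVec u u - m⁻¹ • P') * P * (Matrix.vecMulVec u u - m⁻¹ • P')).trace -
        ((Matrix.vecMulVec u u - m⁻¹ • P') * P).trace ^ 2 / m := by
  -- the main term is `w ^ 2 ≥ 2 w - 1`; the three other negative terms are at most `1 / m` each
  set w := u ⬝ᵥ (P *ᵥ u) with hw
  have hw0 : 0 ≤ w := dotProduct_mulVec_nonneg_of_idempotent hPt hP u
  have hw1 : w ≤ 1 := hu ▸ dotProduct_mulVec_le_of_idempotent hPt hP u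
  have hPu : u ᵥ* P = P *ᵥ u := by rw [← Matrix.mulVec_transpose, hPt]
  have hPuPu : (P *ᵥ u) ⬝ᵥ (P *ᵥ u) = w := by
    rw [Matrix.dotProduct_mulVec, Matrix.vecMul_mulVec, hPt, hP, hPu, dotProduct_comm]
  have hX : ∀ X : Matrix n n ℝ, (P * Matrix.vecMulVec u u * P * X).trace =
      (P *ᵥ u) ⬝ᵥ (X *ᵥ (P *ᵥ u)) := by
    intro X
    rw [Matrix.mul_vecMulVec, Matrix.mul_assoc, Matrix.vecMulVec_mul, Matrix.trace_vecMulVec,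
      ← Matrix.vecMul_vecMul, hPu, dotProduct_comm, ← Matrix.dotProduct_mulVec]
  have t1 : (P * Matrix.vecMulVec u u * P * Matrix.vecMulVec u u).trace = w ^ 2 := by
    rw [hX, Matrix.vecMulVec_mulVec, ← hw]
    rw [dotProduct_smul, dotProduct_comm, ← hw, op_smul_eq_smul, smul_eq_mul, sq]
  have t2 : (P * Matrix.vecMulVec u u * P * P').trace ≤ 1 := by
    rw [hX]
    exact (dotProduct_mulVec_le_of_idempotent hPt' hP' _).trans (hPuPu ▸ hw1)
  have t3 : (P * P' * P * Matrix.vecMulVec u u).trace ≤ 1 := by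
    have : (P * P' * P * Matrix.vecMulVec u u).trace =
        (P * Matrix.vecMulVec u u * P * P').trace := by
      rw [Matrix.mul_assoc (P * P'), Matrix.trace_mul_comm, ← Matrix.mul_assoc]
    rw [this]
    exact t2
  have t4 : 0 ≤ (P * P' * P * P').trace := by
    have h := trace_transpose_mul_self_nonneg (P * P' * P)
    have e : ((P * P' * P)ᵀ * (P * P' * P)).trace = (P * P' * P * P').trace := by
      rw [Matrix.transpose_mul, Matrix.transpose_mul, hPt, hPt']
      calc (P * (P' * P) * (P * P' * P)).trace = (P * P' * (P * P) * P' * P).trace := by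
            simp only [Matrix.mul_assoc]
        _ = ((P * P) * P' * P * P').trace := by
            rw [hP, Matrix.trace_mul_comm]; simp only [← Matrix.mul_assoc, hP]
        _ = _ := by rw [hP]
    rwa [e] at h
  have t5 : ((Matrix.vecMulVec u u - m⁻¹ • P') * P).trace = w - m⁻¹ * (P * P').trace := by
    rw [sub_mul, Matrix.trace_sub, Matrix.vecMulVec_mul, Matrix.trace_vecMulVec, hPu,
      Matrix.smul_mul, Matrix.trace_smul, Matrix.trace_mul_comm P', smul_eq_mul]
  have t6 : 0 ≤ m⁻¹ * (P * P').trace :=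
    mul_nonneg (by positivity) (trace_mul_nonneg_of_idempotent hPt hP hPt' hP')
  have t7 : m⁻¹ * (P * P').trace ≤ 1 := by
    rw [inv_mul_le_iff₀ hm, mul_one, ← htr']
    exact trace_mul_le_of_idempotent hPt hP hPt' hP'
  have t8 : (P * (Matrix.vecMulVec u u - m⁻¹ • P') * P *
      (Matrix.vecMulVec u u - m⁻¹ • P')).trace =
      w ^ 2 - m⁻¹ * (P * Matrix.vecMulVec u u * P * P').trace -
        m⁻¹ * (P * P' * P * Matrix.vecMulVec u u).trace + m⁻¹ ^ 2 * (P * P' * P * P').trace := by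
    rw [← t1]
    simp only [mul_sub, sub_mul, Matrix.trace_sub, Matrix.mul_smul, Matrix.smul_mul,
      Matrix.trace_smul, smul_eq_mul]
    ring
  have t9 : (w - m⁻¹ * (P * P').trace) ^ 2 / m ≤ m⁻¹ := by
    rw [div_eq_mul_inv]
    refine mul_le_of_le_one_left (by positivity) ?_
    rw [sq_le_one_iff_abs_le_one, abs_le]
    constructor <;> linarith
  have hmi : 0 < m⁻¹ := by positivity
  rw [t8, t5, div_eq_mul_inv 3]
  nlinarith [mul_le_mul_of_nonneg_left t2 hmi.le, mul_le_mul_of_nonneg_left t3 hmi.le,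
    mul_nonneg (sq_nonneg m⁻¹) t4, sq_nonneg (w - 1)]

end

section

variable {T p : ℕ} {x x' : Matrix (Fin T) (Fin p) ℝ} {s s' : ℝ}

lemma sub_le_trace_projMatrix_mul (hx : IsUnit (xᵀ * x)) (hx' : IsUnit (x'ᵀ * x')) :
    (T : ℝ) - p - p ≤ (PanelData.projMatrix x * PanelData.projMatrix x').trace := by
  have h := trace_mul_le_of_idempotent (projMatrix_transpose x) (projMatrix_mul_self hx)
    (P' := 1 - PanelData.projMatrix x') (by simp [projMatrix_transpose])
    (IsIdempotentElem.one_sub (projMatrix_mul_self hx')).eq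
  rw [mul_sub, Matrix.mul_one, Matrix.trace_sub, Matrix.trace_sub, trace_projMatrix hx,
    trace_projMatrix hx', Matrix.trace_one, Fintype.card_fin] at h
  linarith

lemma integrable_inner_centeredOuter_pow (hx : IsUnit (xᵀ * x)) (hp : p < T)
    (z : EuclideanSpace ℝ (Fin T × Fin T)) (k : ℕ) (μ : Measure (EuclideanSpace ℝ (Fin T)))
    [IsProbabilityMeasure μ] :
    Integrable (fun e => inner ℝ z (centeredOuter x e) ^ k) μ := by
  refine Integrable.of_bound ((measurable_const.inner (measurable_centeredOuter x)).pow_const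
    k).aestronglyMeasurable ((‖z‖ * 2) ^ k) (ae_of_all _ fun e => ?_)
  rw [norm_pow, Real.norm_eq_abs]
  have := (abs_real_inner_le_norm z (centeredOuter x e)).trans
    (mul_le_mul_of_nonneg_left (norm_centeredOuter_le hx hp e) (norm_nonneg z))
  gcongr

/-- Lower bound for the second moment of the inner product of two independent centered outer
products: the previous bound for the variance functional is affine in `uᵀ P u`, whose mean
`tr (P P') / m` is at least `1 - p / m`. -/
lemma le_integral_integral_inner_centeredOuter_sq (hx : IsUnit (xᵀ * x)) (hx' : IsUnit (x'ᵀ * x'))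
    (hp : p < T) (hs : 0 < s) (hs' : 0 < s') :
    2 / (((T : ℝ) - p) * ((T : ℝ) - p + 2)) * (1 - (2 * p + 3) / ((T : ℝ) - p)) ≤
      ∫ e', ∫ e, inner ℝ (centeredOuter x e) (centeredOuter x' e') ^ 2
        ∂(multivariateGaussian 0 (s ^ 2 • (1 : Matrix (Fin T) (Fin T) ℝ)))
        ∂(multivariateGaussian 0 (s' ^ 2 • (1 : Matrix (Fin T) (Fin T) ℝ))) := by
  have hpT : (p : ℝ) < T := by exact_mod_cast hp
  have hm : (0 : ℝ) < (T : ℝ) - p := by linarith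
  set m : ℝ := (T : ℝ) - p with hmdef
  set μ := multivariateGaussian 0 (s ^ 2 • (1 : Matrix (Fin T) (Fin T) ℝ))
  set μ' := multivariateGaussian 0 (s' ^ 2 • (1 : Matrix (Fin T) (Fin T) ℝ))
  set Q := PanelData.projMatrix x with hQ
  have hκ : 0 ≤ 2 / (m * (m + 2)) := by positivity
  have hlow : ∀ᵐ e' ∂μ', 2 / (m * (m + 2)) *
      (2 * (inner ℝ (matVec Q) (centeredOuter x' e') + (Q * PanelData.projMatrix x').trace / m) -
        1 - 3 / m) ≤ ∫ e, inner ℝ (centeredOuter x e) (centeredOuter x' e') ^ 2 ∂μ := by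
    filter_upwards [ae_norm_residualDirection hx' hp hs'] with e' he'
    have hMt : (Matrix.vecMulVec (residualDirection x' e').ofLp (residualDirection x' e').ofLp -
        m⁻¹ • PanelData.projMatrix x')ᵀ = Matrix.vecMulVec (residualDirection x' e').ofLp
          (residualDirection x' e').ofLp - m⁻¹ • PanelData.projMatrix x' := by
      rw [Matrix.transpose_sub, Matrix.transpose_vecMulVec, Matrix.transpose_smul,
        projMatrix_transpose]
    have h1 := (integral_inner_matVec_centeredOuter_of_symm hx hp hs hMt).2.1
    have h2 : ∀ e, inner ℝ (centeredOuter x e) (centeredOuter x' e') =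
        inner ℝ (matVec (Matrix.vecMulVec (residualDirection x' e').ofLp
          (residualDirection x' e').ofLp - m⁻¹ • PanelData.projMatrix x')) (centeredOuter x e) :=
      fun e => real_inner_comm _ _
    simp_rw [h2]
    rw [h1, inner_matVec_centeredOuter]
    refine mul_le_mul_of_nonneg_left ?_ hκ
    have h3 := le_trace_compression_vecMulVec_sub (projMatrix_transpose x) (projMatrix_mul_self hx)
      (projMatrix_transpose x') (projMatrix_mul_self hx') hm (trace_projMatrix hx')
      (u := (residualDirection x' e').ofLp) (by rw [dotProduct_residualDirection_self, he', one_pow])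
    refine le_trans (le_of_eq ?_) h3
    ring
  have hi := integrable_inner_centeredOuter_pow hx' hp (matVec Q) 1 μ'
  simp only [pow_one] at hi
  have hlint : Integrable (fun e' => 2 / (m * (m + 2)) *
      (2 * (inner ℝ (matVec Q) (centeredOuter x' e') + (Q * PanelData.projMatrix x').trace / m) -
        1 - 3 / m)) μ' :=
    (((((hi.add (integrable_const _)).const_mul 2).sub (integrable_const 1)).sub
      (integrable_const _)).const_mul _)
  have hrm : StronglyMeasurable fun e' =>
      ∫ e, inner ℝ (centeredOuter x e) (centeredOuter x' e') ^ 2 ∂μ := by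
    have h2 : StronglyMeasurable (fun q : EuclideanSpace ℝ (Fin T) × EuclideanSpace ℝ (Fin T) =>
        inner ℝ (centeredOuter x q.2) (centeredOuter x' q.1) ^ 2) := by
      refine Measurable.stronglyMeasurable ?_
      have := measurable_centeredOuter x
      have := measurable_centeredOuter x'
      fun_prop
    exact h2.integral_prod_right'
  have hrint : Integrable (fun e' =>
      ∫ e, inner ℝ (centeredOuter x e) (centeredOuter x' e') ^ 2 ∂μ) μ' := by
    refine Integrable.of_bound hrm.aestronglyMeasurable ((2 * 2) ^ 2) (ae_of_all _ fun e' => ?_)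
    refine (norm_integral_le_of_norm_le_const (C := (2 * 2) ^ 2) (ae_of_all _ fun e => ?_)).trans
      (by simp)
    rw [norm_pow, Real.norm_eq_abs]
    have := (abs_real_inner_le_norm (centeredOuter x e) (centeredOuter x' e')).trans
      (mul_le_mul (norm_centeredOuter_le hx hp e) (norm_centeredOuter_le hx' hp e') (norm_nonneg _)
        (by norm_num))
    gcongr
  refine le_trans ?_ (integral_mono_ae hlint hrint hlow)
  have h0 := (integral_inner_centeredOuter hx' hp hs' (matVec Q)).1
  rw [integral_const_mul]
  refine mul_le_mul_of_nonneg_left ?_ hκ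
  have hval : ∫ e', (2 * (inner ℝ (matVec Q) (centeredOuter x' e') +
      (Q * PanelData.projMatrix x').trace / m) - 1 - 3 / m) ∂μ' =
      2 * ((Q * PanelData.projMatrix x').trace / m) - 1 - 3 / m := by
    have hsplit : ∀ e', 2 * (inner ℝ (matVec Q) (centeredOuter x' e') +
      (Q * PanelData.projMatrix x').trace / m) - 1 - 3 / m =
      2 * inner ℝ (matVec Q) (centeredOuter x' e') +
        (2 * ((Q * PanelData.projMatrix x').trace / m) - 1 - 3 / m) := fun e' => by ring
    simp_rw [hsplit]
    rw [integral_add (hi.const_mul 2) (integrable_const _), integral_const_mul, h0]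
    simp
  rw [hval]
  have h4 := sub_le_trace_projMatrix_mul hx hx'
  have h5 : (m - p) / m ≤ (Q * PanelData.projMatrix x').trace / m := by
    gcongr
  have h6 : 1 - (2 * p + 3) / m = 2 * ((m - p) / m) - 1 - 3 / m := by
    field_simp
    ring
  rw [h6]
  linarith

end

/-! ### The array of centered outer products of a panel -/

section

variable {N T p : ℕ}

/-- The joint law of the error vectors of the `N` sections. -/
noncomputable def errorLaw (N T : ℕ) (σ : Fin N → ℝ) :
    Measure (Fin N → EuclideanSpace ℝ (Fin T)) :=
  Measure.pi fun i => multivariateGaussian 0 (σ i ^ 2 • (1 : Matrix (Fin T) (Fin T) ℝ))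

instance (σ : Fin N → ℝ) : IsProbabilityMeasure (errorLaw N T σ) := by
  unfold errorLaw; infer_instance

/-- The centered outer products of the sections as a sequence, extended by zero. -/
noncomputable def outerSeq (x : Fin N → Matrix (Fin T) (Fin p) ℝ) (k : ℕ)
    (e : Fin N → EuclideanSpace ℝ (Fin T)) : EuclideanSpace ℝ (Fin T × Fin T) :=
  if h : k < N then centeredOuter (x ⟨k, h⟩) (e ⟨k, h⟩) else 0

lemma outerSeq_val (x : Fin N → Matrix (Fin T) (Fin p) ℝ) (i : Fin N)
    (e : Fin N → EuclideanSpace ℝ (Fin T)) : outerSeq x i e = centeredOuter (x i) (e i) := by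
  simp [outerSeq]

lemma measurable_outerSeq (x : Fin N → Matrix (Fin T) (Fin p) ℝ) (k : ℕ) :
    Measurable (outerSeq x k) := by
  unfold outerSeq
  split_ifs with h
  · exact (measurable_centeredOuter _).comp (measurable_pi_apply _)
  · exact measurable_const

lemma integral_errorLaw_eval (σ : Fin N → ℝ) (i : Fin N) {f : EuclideanSpace ℝ (Fin T) → ℝ}
    (hf : Measurable f) :
    ∫ e, f (e i) ∂(errorLaw N T σ) =
      ∫ v, f v ∂(multivariateGaussian 0 (σ i ^ 2 • (1 : Matrix (Fin T) (Fin T) ℝ))) :=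
  integral_comp_eval (μ := fun i => multivariateGaussian 0
    (σ i ^ 2 • (1 : Matrix (Fin T) (Fin T) ℝ))) hf.aestronglyMeasurable

lemma ae_errorLaw_eval (σ : Fin N → ℝ) (i : Fin N) {q : EuclideanSpace ℝ (Fin T) → Prop}
    (hq : ∀ᵐ v ∂(multivariateGaussian 0 (σ i ^ 2 • (1 : Matrix (Fin T) (Fin T) ℝ))), q v) :
    ∀ᵐ e ∂(errorLaw N T σ), q (e i) :=
  (measurePreserving_eval (fun i => multivariateGaussian 0
    (σ i ^ 2 • (1 : Matrix (Fin T) (Fin T) ℝ))) i).quasiMeasurePreserving.ae hq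

lemma crossSum_congr {H : Type*} [NormedAddCommGroup H] [InnerProductSpace ℝ H] {a b : ℕ → H}
    {k : ℕ} (h : ∀ i < k, a i = b i) : crossSum a k = crossSum b k := by
  unfold crossSum
  refine Finset.sum_congr rfl fun j hj => ?_
  have hj' := Finset.mem_range.1 hj
  rw [h j hj', Finset.sum_congr rfl fun i hi => h i ((Finset.mem_range.1 hi).trans hj')]

/-- The partial sums and cross sums of the past are independent of the present. -/
lemma indepFun_outerSeq (x : Fin N → Matrix (Fin T) (Fin p) ℝ) (σ : Fin N → ℝ) {k : ℕ}
    (hk : k < N) :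
    IndepFun (fun e => (∑ i ∈ Finset.range k, outerSeq x i e,
      crossSum (fun i => outerSeq x i e) k)) (outerSeq x k) (errorLaw N T σ) := by
  have hind : iIndepFun (fun (i : Fin N) (e : Fin N → EuclideanSpace ℝ (Fin T)) =>
      centeredOuter (x i) (e i)) (errorLaw N T σ) :=
    iIndepFun_pi (X := fun (i : Fin N) (v : EuclideanSpace ℝ (Fin T)) => centeredOuter (x i) v)
      (fun i => (measurable_centeredOuter (x i)).aemeasurable)
  have h := hind.indepFun_finset (Finset.Iio ⟨k, hk⟩) {⟨k, hk⟩}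
    (by simp) (fun i => (measurable_centeredOuter _).comp (measurable_pi_apply _))
  let pad : (Finset.Iio (⟨k, hk⟩ : Fin N) → EuclideanSpace ℝ (Fin T × Fin T)) → ℕ →
      EuclideanSpace ℝ (Fin T × Fin T) := fun z i =>
    if hi : i < k then z ⟨⟨i, hi.trans hk⟩, Finset.mem_Iio.2 hi⟩ else 0
  have hpad : ∀ i, Measurable fun z => pad z i := fun i => by
    simp only [pad]
    split_ifs with hi
    · exact measurable_pi_apply _
    · exact measurable_const
  have hsnd : Measurable fun z => crossSum (pad z) k :=
    Finset.measurable_sum _ fun j _ => (Finset.measurable_sum _ fun i _ => hpad i).inner (hpad j)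
  have hφ : Measurable fun z => (∑ i ∈ Finset.range k, pad z i, crossSum (pad z) k) :=
    (Finset.measurable_sum _ fun i _ => hpad i).prodMk hsnd
  have hψ : Measurable fun z : (({⟨k, hk⟩} : Finset (Fin N)) →
      EuclideanSpace ℝ (Fin T × Fin T)) => z ⟨⟨k, hk⟩, Finset.mem_singleton_self _⟩ :=
    measurable_pi_apply _
  have h2 := h.comp hφ hψ
  have hpad_eq : ∀ (e : Fin N → EuclideanSpace ℝ (Fin T)) (i : ℕ), i < k →
      pad (fun i => centeredOuter (x i.1) (e i.1)) i = outerSeq x i e := by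
    intro e i hi
    simp [pad, outerSeq, hi, hi.trans hk]
  convert h2 using 1
  · ext1 e
    simp only [Function.comp_apply]
    rw [Finset.sum_congr rfl fun i hi => hpad_eq e i (Finset.mem_range.1 hi),
      crossSum_congr fun i hi => hpad_eq e i hi]
  · ext1 e
    simp [outerSeq, hk]

lemma isDegenerateArray_outerSeq {x : Fin N → Matrix (Fin T) (Fin p) ℝ}
    (hx : ∀ i, IsUnit ((x i)ᵀ * x i)) (hp : p < T) {σ : Fin N → ℝ} (hσ : ∀ i, 0 < σ i) :
    IsDegenerateArray (errorLaw N T σ) (outerSeq x) N 2 (1 - 1 / ((T : ℝ) - p))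
      (2 / (((T : ℝ) - p) * ((T : ℝ) - p + 2))) 15
      (2 / (((T : ℝ) - p) * ((T : ℝ) - p + 2)) * ((2 * p + 3) / ((T : ℝ) - p))) := by
  have hpT : (p : ℝ) < T := by exact_mod_cast hp
  have hm : (0 : ℝ) < (T : ℝ) - p := by linarith
  have hmi : ∀ (z : EuclideanSpace ℝ (Fin T × Fin T)) (i : Fin N) (n : ℕ),
      Measurable fun v => inner ℝ z (centeredOuter (x i) v) ^ n := fun z i n =>
    (measurable_const.inner (measurable_centeredOuter _)).pow_const n
  have hval : ∀ z : EuclideanSpace ℝ (Fin T × Fin T), ∀ k (hk : k < N), ∀ n : ℕ,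
      ∫ e, inner ℝ z (outerSeq x k e) ^ n ∂(errorLaw N T σ) =
      ∫ v, inner ℝ z (centeredOuter (x ⟨k, hk⟩) v) ^ n
        ∂(multivariateGaussian 0 (σ ⟨k, hk⟩ ^ 2 • (1 : Matrix (Fin T) (Fin T) ℝ))) := by
    intro z k hk n
    rw [← integral_errorLaw_eval σ ⟨k, hk⟩ (hmi z ⟨k, hk⟩ n)]
    simp [outerSeq, hk]
  refine ⟨measurable_outerSeq x, ?_, fun k hk => indepFun_outerSeq x σ hk, ?_, ?_, ?_, ?_, ?_⟩
  · intro k e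
    unfold outerSeq
    split_ifs with h
    · exact norm_centeredOuter_le (hx _) hp _
    · simp
  · intro k hk
    filter_upwards [ae_errorLaw_eval σ ⟨k, hk⟩
      (ae_norm_sq_centeredOuter (hx ⟨k, hk⟩) hp (hσ ⟨k, hk⟩))] with e he
    rw [← he]
    simp [outerSeq, hk]
  · intro k hk z
    have h := hval z k hk 1
    simp only [pow_one] at h
    rw [h]
    exact (integral_inner_centeredOuter (hx _) hp (hσ _) z).1
  · intro k hk z
    rw [hval z k hk 2]
    exact (integral_inner_centeredOuter (hx _) hp (hσ _) z).2.1
  · intro k hk z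
    rw [hval z k hk 4]
    exact (integral_inner_centeredOuter (hx _) hp (hσ _) z).2.2
  · intro k hk i hi
    have hiN : i < N := hi.trans hk
    have h1 : ∀ e', ∫ e, inner ℝ (outerSeq x i e) (outerSeq x k e') ^ 2 ∂(errorLaw N T σ) =
        ∫ v, inner ℝ (centeredOuter (x ⟨i, hiN⟩) v) (centeredOuter (x ⟨k, hk⟩) (e' ⟨k, hk⟩)) ^ 2
          ∂(multivariateGaussian 0 (σ ⟨i, hiN⟩ ^ 2 • (1 : Matrix (Fin T) (Fin T) ℝ))) := by
      intro e'
      have h := hval (outerSeq x k e') i hiN 2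
      rw [integral_congr_ae (ae_of_all _ fun e => by
        rw [real_inner_comm]), h]
      refine integral_congr_ae (ae_of_all _ fun v => ?_)
      simp only [outerSeq, hk, dif_pos]
      rw [real_inner_comm]
    simp_rw [h1]
    have hmeas : StronglyMeasurable fun v' : EuclideanSpace ℝ (Fin T) =>
        ∫ v, inner ℝ (centeredOuter (x ⟨i, hiN⟩) v) (centeredOuter (x ⟨k, hk⟩) v') ^ 2
          ∂(multivariateGaussian 0 (σ ⟨i, hiN⟩ ^ 2 • (1 : Matrix (Fin T) (Fin T) ℝ))) := by
      have h2 : StronglyMeasurable (fun q : EuclideanSpace ℝ (Fin T) × EuclideanSpace ℝ (Fin T) =>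
          inner ℝ (centeredOuter (x ⟨i, hiN⟩) q.2) (centeredOuter (x ⟨k, hk⟩) q.1) ^ 2) := by
        refine Measurable.stronglyMeasurable ?_
        have := measurable_centeredOuter (x ⟨i, hiN⟩)
        have := measurable_centeredOuter (x ⟨k, hk⟩)
        fun_prop
      exact h2.integral_prod_right'
    rw [integral_errorLaw_eval σ ⟨k, hk⟩ hmeas.measurable]
    refine le_trans ?_ (le_integral_integral_inner_centeredOuter_sq (hx ⟨i, hiN⟩) (hx ⟨k, hk⟩) hp
      (hσ _) (hσ _))
    rw [← mul_sub]
    have h3 : (0 : ℝ) ≤ 1 / ((T : ℝ) - p) := by positivity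
    exact mul_le_mul_of_nonneg_left (by linarith) (by positivity)

/-! ### Decomposition of the test statistic -/

/-- The squared sample correlation is the Frobenius inner product of the outer products of the
residual directions, expanded around their means. -/
lemma sampleCorr_residual_sq {x x' : Matrix (Fin T) (Fin p) ℝ} (hx : IsUnit (xᵀ * x))
    (hx' : IsUnit (x'ᵀ * x')) {b b' : Fin p → ℝ} {e e' : EuclideanSpace ℝ (Fin T)}
    {y y' : Fin T → ℝ} (hy : ∀ t, y t = x t ⬝ᵥ b + e t) (hy' : ∀ t, y' t = x' t ⬝ᵥ b' + e' t) :
    PanelData.sampleCorr (PanelData.residual x y) (PanelData.residual x' y') ^ 2 =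
      inner ℝ (centeredOuter x e) (centeredOuter x' e') +
        (inner ℝ (matVec (PanelData.projMatrix x')) (centeredOuter x e) +
          inner ℝ (matVec (PanelData.projMatrix x)) (centeredOuter x' e')) / ((T : ℝ) - p) +
        (PanelData.projMatrix x * PanelData.projMatrix x').trace / ((T : ℝ) - p) ^ 2 := by
  have hr := residual_eq_projMatrix_mulVec hx b e y hy
  have hr' := residual_eq_projMatrix_mulVec hx' b' e' y' hy'
  have hnorm : ∀ v : Fin T → ℝ, √(∑ t, v t ^ 2) =
      ‖(WithLp.toLp 2 v : EuclideanSpace ℝ (Fin T))‖ := fun v => by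
    rw [EuclideanSpace.norm_eq]; simp
  have hcorr : PanelData.sampleCorr (PanelData.residual x y) (PanelData.residual x' y') =
      (residualDirection x e).ofLp ⬝ᵥ (residualDirection x' e').ofLp := by
    rw [PanelData.sampleCorr, hr, hr', hnorm, hnorm]
    simp only [residualDirection, WithLp.ofLp_smul, dotProduct_smul, smul_dotProduct, smul_eq_mul]
    simp only [dotProduct]
    rw [div_eq_mul_inv, mul_inv]
    ring
  have hU : ∀ (x : Matrix (Fin T) (Fin p) ℝ) (e : EuclideanSpace ℝ (Fin T)),
      matVec (Matrix.vecMulVec (residualDirection x e).ofLp (residualDirection x e).ofLp) =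
      centeredOuter x e + ((T : ℝ) - p)⁻¹ • matVec (PanelData.projMatrix x) := fun x e => by
    rw [centeredOuter, matVec_sub, matVec_smul, sub_add_cancel]
  have hsq : PanelData.sampleCorr (PanelData.residual x y) (PanelData.residual x' y') ^ 2 =
      inner ℝ (matVec (Matrix.vecMulVec (residualDirection x e).ofLp (residualDirection x e).ofLp))
        (matVec (Matrix.vecMulVec (residualDirection x' e').ofLp
          (residualDirection x' e').ofLp)) := by
    rw [inner_matVec_vecMulVec, Matrix.vecMulVec_mulVec, hcorr, dotProduct_smul, op_smul_eq_smul,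
      smul_eq_mul, dotProduct_comm (residualDirection x' e').ofLp, sq]
  rw [hsq, hU, hU, inner_add_left, inner_add_right, inner_add_right, inner_smul_left,
    inner_smul_right, inner_smul_right, inner_smul_left, inner_matVec, projMatrix_transpose,
    real_inner_comm (matVec (PanelData.projMatrix x'))]
  simp only [conj_trivial]
  rw [div_eq_mul_inv, div_eq_mul_inv _ (((T : ℝ) - p) ^ 2), ← inv_pow]
  ring

lemma sum_sum_Ioi_comm (f : Fin N → Fin N → ℝ) :
    ∑ i, ∑ j ∈ Finset.Ioi i, f i j = ∑ j, ∑ i ∈ Finset.Iio j, f i j :=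
  Finset.sum_comm' (by simp)

lemma sum_sum_Ioi_add_swap (f : Fin N → Fin N → ℝ) :
    ∑ i, ∑ j ∈ Finset.Ioi i, (f i j + f j i) = ∑ i, ∑ j ∈ Finset.univ.erase i, f i j := by
  simp_rw [Finset.sum_add_distrib]
  rw [sum_sum_Ioi_comm (fun i j => f j i), ← Finset.sum_add_distrib]
  refine Finset.sum_congr rfl fun i _ => ?_
  rw [← Finset.sum_union]
  · refine Finset.sum_congr ?_ fun _ _ => rfl
    ext j
    simp only [Finset.mem_union, Finset.mem_Ioi, Finset.mem_Iio, Finset.mem_erase,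
      Finset.mem_univ, and_true]
    exact ⟨fun h => h.elim ne_of_gt ne_of_lt, fun h => (lt_or_gt_of_ne h).symm⟩
  · rw [Finset.disjoint_left]
    intro j h1 h2
    exact absurd (Finset.mem_Ioi.1 h1) (not_lt.2 (Finset.mem_Iio.1 h2).le)

lemma sum_sum_inner_eq_crossSum (x : Fin N → Matrix (Fin T) (Fin p) ℝ)
    (e : Fin N → EuclideanSpace ℝ (Fin T)) :
    ∑ i, ∑ j ∈ Finset.Ioi i, inner ℝ (centeredOuter (x i) (e i)) (centeredOuter (x j) (e j)) =
      crossSum (fun k => outerSeq x k e) N := by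
  rw [sum_sum_Ioi_comm, crossSum, Finset.sum_range]
  refine Finset.sum_congr rfl fun j _ => ?_
  rw [← sum_inner, outerSeq_val]
  congr 1
  rw [← Nat.Iio_eq_range, ← Fin.map_valEmbedding_Iio, Finset.sum_map]
  exact Finset.sum_congr rfl fun i _ => (outerSeq_val x i e).symm

/-- The sum of the projections `1 - P j` onto the regressors of all sections but the `i`-th. -/
noncomputable def regressorSum (x : Fin N → Matrix (Fin T) (Fin p) ℝ) (i : Fin N) :
    EuclideanSpace ℝ (Fin T × Fin T) :=
  ∑ j ∈ Finset.univ.erase i, matVec (1 - PanelData.projMatrix (x j))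

lemma norm_regressorSum_le {x : Fin N → Matrix (Fin T) (Fin p) ℝ}
    (hx : ∀ i, IsUnit ((x i)ᵀ * x i)) (i : Fin N) : ‖regressorSum x i‖ ≤ N * √p := by
  have h : ∀ j, ‖matVec (1 - PanelData.projMatrix (x j))‖ = √p := by
    intro j
    have h1 : ‖matVec (1 - PanelData.projMatrix (x j))‖ ^ 2 = p := by
      rw [norm_sq_matVec, Matrix.transpose_sub, Matrix.transpose_one, projMatrix_transpose,
        (IsIdempotentElem.one_sub (projMatrix_mul_self (hx j))).eq, Matrix.trace_sub,
        trace_projMatrix (hx j), Matrix.trace_one, Fintype.card_fin]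
      ring
    rw [← h1, Real.sqrt_sq (norm_nonneg _)]
  refine (norm_sum_le _ _).trans ?_
  simp_rw [h]
  rw [Finset.sum_const, nsmul_eq_mul]
  have h2 : (Finset.univ.erase i).card ≤ N := by
    refine (Finset.card_le_univ _).trans (by simp)
  have h3 : (((Finset.univ.erase i).card : ℕ) : ℝ) ≤ N := by exact_mod_cast h2
  gcongr

/-- The standardized statistic is the degenerate cross sum plus a linear remainder, which only
involves the projections onto the regressors. -/
lemma ae_statistic_eq {x : Fin N → Matrix (Fin T) (Fin p) ℝ}
    (hx : ∀ i, IsUnit ((x i)ᵀ * x i)) (hp : p < T) {σ : Fin N → ℝ} (hσ : ∀ i, 0 < σ i)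
    (b : Fin N → Fin p → ℝ) :
    ∀ᵐ e ∂(errorLaw N T σ),
      (PanelData.sumStat x (fun i t => x i t ⬝ᵥ b i + e i t) - PanelData.centering x) / (N : ℝ) =
      (T : ℝ) / N * crossSum (fun k => outerSeq x k e) N -
        (T : ℝ) / N / ((T : ℝ) - p) * ∑ i, inner ℝ (regressorSum x i) (centeredOuter (x i) (e i)) := by
  have h0 : ∀ᵐ e ∂(errorLaw N T σ), ∀ i, inner ℝ (matVec 1) (centeredOuter (x i) (e i)) = 0 :=
    ae_all_iff.2 fun i => ae_errorLaw_eval σ i (ae_inner_matVec_one_centeredOuter (hx i) hp (hσ i))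
  filter_upwards [h0] with e he
  have h1 : PanelData.sumStat x (fun i t => x i t ⬝ᵥ b i + e i t) - PanelData.centering x =
      T * (∑ i, ∑ j ∈ Finset.Ioi i,
        inner ℝ (centeredOuter (x i) (e i)) (centeredOuter (x j) (e j)) +
      (∑ i, ∑ j ∈ Finset.Ioi i,
        (inner ℝ (matVec (PanelData.projMatrix (x j))) (centeredOuter (x i) (e i)) +
          inner ℝ (matVec (PanelData.projMatrix (x i))) (centeredOuter (x j) (e j)))) /
            ((T : ℝ) - p)) := by
    unfold PanelData.sumStat PanelData.centering
    rw [Finset.sum_div, ← Finset.sum_add_distrib, Finset.mul_sum, Finset.mul_sum,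
      ← Finset.sum_sub_distrib]
    refine Finset.sum_congr rfl fun i _ => ?_
    rw [Finset.sum_div, ← Finset.sum_add_distrib, Finset.mul_sum, Finset.mul_sum,
      ← Finset.sum_sub_distrib]
    refine Finset.sum_congr rfl fun j _ => ?_
    rw [sampleCorr_residual_sq (hx i) (hx j) (b := b i) (b' := b j) (e := e i) (e' := e j)
      (fun t => rfl) (fun t => rfl)]
    ring
  have h2 : ∀ i, ∑ j ∈ Finset.univ.erase i,
      inner ℝ (matVec (PanelData.projMatrix (x j))) (centeredOuter (x i) (e i)) =
      -inner ℝ (regressorSum x i) (centeredOuter (x i) (e i)) := by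
    intro i
    rw [regressorSum, sum_inner, ← Finset.sum_neg_distrib]
    refine Finset.sum_congr rfl fun j _ => ?_
    rw [matVec_sub, inner_sub_left, he i]
    ring
  rw [h1, sum_sum_inner_eq_crossSum, sum_sum_Ioi_add_swap
    (fun i j => inner ℝ (matVec (PanelData.projMatrix (x j))) (centeredOuter (x i) (e i))),
    Finset.sum_congr rfl fun i _ => h2 i, Finset.sum_neg_distrib]
  ring

/-- The linear remainder is a sum of independent centered variables, so its variance is the sum of
theirs. -/
lemma integral_sum_inner_regressorSum_sq_le {x : Fin N → Matrix (Fin T) (Fin p) ℝ}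
    (hx : ∀ i, IsUnit ((x i)ᵀ * x i)) (hp : p < T) {σ : Fin N → ℝ} (hσ : ∀ i, 0 < σ i) :
    Integrable (fun e => ∑ i, inner ℝ (regressorSum x i) (centeredOuter (x i) (e i)))
      (errorLaw N T σ) ∧
    Integrable (fun e => (∑ i, inner ℝ (regressorSum x i) (centeredOuter (x i) (e i))) ^ 2)
      (errorLaw N T σ) ∧
    ∫ e, (∑ i, inner ℝ (regressorSum x i) (centeredOuter (x i) (e i))) ^ 2 ∂(errorLaw N T σ) ≤
      N * (2 / (((T : ℝ) - p) * ((T : ℝ) - p + 2)) * (N ^ 2 * p)) := by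
  have hpT : (p : ℝ) < T := by exact_mod_cast hp
  have hm : (0 : ℝ) < (T : ℝ) - p := by linarith
  let X : Fin N → EuclideanSpace ℝ (Fin T) → ℝ := fun i v =>
    inner ℝ (regressorSum x i) (centeredOuter (x i) v)
  have hXm : ∀ i, Measurable (X i) := fun i =>
    measurable_const.inner (measurable_centeredOuter _)
  have hX1 : ∀ i, Integrable (X i)
      (multivariateGaussian 0 (σ i ^ 2 • (1 : Matrix (Fin T) (Fin T) ℝ))) := fun i => by
    simpa using integrable_inner_centeredOuter_pow (hx i) hp (regressorSum x i) 1
      (multivariateGaussian 0 (σ i ^ 2 • (1 : Matrix (Fin T) (Fin T) ℝ)))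
  have hX2 : ∀ i, MemLp (X i) 2
      (multivariateGaussian 0 (σ i ^ 2 • (1 : Matrix (Fin T) (Fin T) ℝ))) := fun i =>
    (memLp_two_iff_integrable_sq (hXm i).aestronglyMeasurable).2
      (integrable_inner_centeredOuter_pow (hx i) hp (regressorSum x i) 2 _)
  have hX2' : ∀ i, MemLp (fun e : Fin N → EuclideanSpace ℝ (Fin T) => X i (e i)) 2
      (errorLaw N T σ) := fun i =>
    (hX2 i).comp_measurePreserving (measurePreserving_eval _ i)
  have hsum2 : MemLp (fun e : Fin N → EuclideanSpace ℝ (Fin T) => ∑ i, X i (e i)) 2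
      (errorLaw N T σ) := memLp_finsetSum _ fun i _ => hX2' i
  have hmean : ∀ i, ∫ e, X i (e i) ∂(errorLaw N T σ) = 0 := fun i => by
    rw [integral_errorLaw_eval σ i (hXm i)]
    exact (integral_inner_centeredOuter (hx i) hp (hσ i) _).1
  refine ⟨hsum2.integrable (by norm_num), hsum2.integrable_sq, ?_⟩
  have hvar := variance_sum_pi (μ := fun i => multivariateGaussian 0
    (σ i ^ 2 • (1 : Matrix (Fin T) (Fin T) ℝ))) hX2
  have hE : ∫ e, ∑ i, X i (e i) ∂(errorLaw N T σ) = 0 := by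
    rw [integral_finsetSum _ fun i _ => (hX2' i).integrable (by norm_num)]
    simp [hmean]
  have hL : Var[∑ i, fun e : Fin N → EuclideanSpace ℝ (Fin T) => X i (e i); errorLaw N T σ] =
      ∫ e, (∑ i, X i (e i)) ^ 2 ∂(errorLaw N T σ) := by
    have hfun : (∑ i, fun e : Fin N → EuclideanSpace ℝ (Fin T) => X i (e i)) =
        fun e => ∑ i, X i (e i) := by
      ext e
      simp
    rw [hfun, variance_of_integral_eq_zero hsum2.aemeasurable hE]
  change Var[∑ i, fun e : Fin N → EuclideanSpace ℝ (Fin T) => X i (e i); errorLaw N T σ] = _ at hvar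
  rw [hL] at hvar
  change ∫ e, (∑ i, X i (e i)) ^ 2 ∂(errorLaw N T σ) ≤ _
  rw [hvar]
  calc _ ≤ ∑ _i : Fin N, 2 / (((T : ℝ) - p) * ((T : ℝ) - p + 2)) * (N ^ 2 * p) := by
        refine Finset.sum_le_sum fun i _ => ?_
        have h1 := integral_inner_centeredOuter (hx i) hp (hσ i) (regressorSum x i)
        rw [variance_of_integral_eq_zero (hXm i).aemeasurable h1.1]
        refine h1.2.1.trans ?_
        have h2 := norm_regressorSum_le hx i
        have h3 : ‖regressorSum x i‖ ^ 2 ≤ (N * √p) ^ 2 := by gcongr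
        rw [mul_pow, Real.sq_sqrt (Nat.cast_nonneg p)] at h3
        gcongr
    _ = _ := by simp

lemma norm_cexp_sub_cexp_le (a b : ℝ) :
    ‖Complex.exp (a * Complex.I) - Complex.exp (b * Complex.I)‖ ≤ |a - b| := by
  have h : Complex.exp (a * Complex.I) - Complex.exp (b * Complex.I) =
      Complex.exp (b * Complex.I) * (Complex.exp (Complex.I * ((a - b : ℝ) : ℂ)) - 1) := by
    rw [mul_sub, ← Complex.exp_add, mul_one]
    congr 2
    push_cast
    ring
  rw [h, norm_mul, Complex.norm_exp_ofReal_mul_I, one_mul]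
  exact Real.norm_exp_I_mul_ofReal_sub_one_le

end

/-! ### Characteristic function of the standardized statistic -/

section

variable {N T p : ℕ}

lemma measurable_statistic (x : Fin N → Matrix (Fin T) (Fin p) ℝ) (b : Fin N → Fin p → ℝ) :
    Measurable fun e : Fin N → EuclideanSpace ℝ (Fin T) =>
      (PanelData.sumStat x (fun i t => x i t ⬝ᵥ b i + e i t) - PanelData.centering x) /
        (N : ℝ) := by
  simp only [PanelData.sumStat, PanelData.sampleCorr, PanelData.residual, PanelData.olsEstimator,
    Matrix.mulVec, dotProduct]
  fun_prop

/-- Quantitative form of the central limit theorem: the characteristic function of the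
standardized statistic is compared with that of the centered Gaussian whose variance is the leading
part of the variance of the degenerate cross sum. The first error term comes from the linear
remainder, the others from `IsDegenerateArray.norm_charFun_crossSum_sub_le` with `θ = √N / T`. -/
lemma norm_charFun_statistic_sub_le {x : Fin N → Matrix (Fin T) (Fin p) ℝ}
    (hx : ∀ i, IsUnit ((x i)ᵀ * x i)) (hN : 0 < N) (hp : p < T) {σ : Fin N → ℝ}
    (hσ : ∀ i, 0 < σ i) (b : Fin N → Fin p → ℝ) (t : ℝ) {κ : ℝ}
    (hκ : κ = 2 / (((T : ℝ) - p) * ((T : ℝ) - p + 2))) :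
    ‖∫ e, Complex.exp ((t * ((PanelData.sumStat x (fun i s => x i s ⬝ᵥ b i + e i s) -
        PanelData.centering x) / (N : ℝ)) : ℝ) * Complex.I) ∂(errorLaw N T σ) -
      (Real.exp (-((t * (T / N)) ^ 2 / 2 *
        (κ * (1 - 1 / ((T : ℝ) - p)) * (N * (N - 1) / 2)))) : ℝ)‖ ≤
      |t| * (T / N / ((T : ℝ) - p)) * √(N * (κ * (N ^ 2 * p))) +
      N * (4 * |t * (T / N)| ^ 3 * ((√N / T * (κ * N) + 5 * 15 * (κ * N) ^ 2 / (√N / T)) / 2) +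
        (t * (T / N)) ^ 2 / 2 * (N * (κ * ((2 * p + 3) / ((T : ℝ) - p))) + 2 * κ * (√κ * N)) +
        ((t * (T / N)) ^ 2 / 2 * (κ * N)) ^ 2) := by
  have hpT : (p : ℝ) + 1 ≤ T := by exact_mod_cast hp
  have hm : (1 : ℝ) ≤ (T : ℝ) - p := by linarith
  have hNr : (0 : ℝ) < N := by exact_mod_cast hN
  have hTr : (0 : ℝ) < T := by have := Nat.cast_nonneg (α := ℝ) p; linarith
  have hκ0 : 0 ≤ κ := by rw [hκ]; positivity
  have hκ1 : κ ≤ 1 := by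
    rw [hκ, div_le_one (by positivity)]
    nlinarith
  have hinv : 1 / ((T : ℝ) - p) ≤ 1 := by rw [div_le_one (by linarith)]; exact hm
  have hinv0 : 0 ≤ 1 / ((T : ℝ) - p) := by positivity
  have harr := isDegenerateArray_outerSeq hx hp hσ
  rw [← hκ] at harr
  have hmain := harr.norm_charFun_crossSum_sub_le hκ0 hκ1 (by linarith) (by linarith)
    (by norm_num) (by positivity) (t * (T / N)) (θ := √N / T) (by positivity)
  obtain ⟨hi1, hi2, hle⟩ := integral_sum_inner_regressorSum_sq_le hx hp hσ
  rw [← hκ] at hle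
  have hmc : Measurable fun e : Fin N → EuclideanSpace ℝ (Fin T) =>
      crossSum (fun k => outerSeq x k e) N := harr.measurable_crossSum N
  have hbd : ∀ f : (Fin N → EuclideanSpace ℝ (Fin T)) → ℝ, Measurable f →
      Integrable (fun e => Complex.exp ((f e : ℝ) * Complex.I)) (errorLaw N T σ) := by
    intro f hf
    refine Integrable.of_bound (C := 1) ?_ (ae_of_all _ fun e => ?_)
    · exact (Complex.measurable_exp.comp
        ((Complex.measurable_ofReal.comp hf).mul_const _)).aestronglyMeasurable
    · rw [Complex.norm_exp_ofReal_mul_I]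
  have hrem : ‖∫ e, Complex.exp ((t * ((PanelData.sumStat x (fun i s => x i s ⬝ᵥ b i + e i s) -
        PanelData.centering x) / (N : ℝ)) : ℝ) * Complex.I) ∂(errorLaw N T σ) -
      ∫ e, Complex.exp ((t * (T / N) * crossSum (fun k => outerSeq x k e) N : ℝ) * Complex.I)
        ∂(errorLaw N T σ)‖ ≤
      |t| * (T / N / ((T : ℝ) - p)) * √(N * (κ * (N ^ 2 * p))) := by
    rw [← integral_sub (hbd _ ((measurable_statistic x b).const_mul t))
      (hbd _ (hmc.const_mul _))]
    refine (norm_integral_le_integral_norm _).trans ?_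
    calc _ ≤ ∫ e, |t| * (T / N / ((T : ℝ) - p)) *
          |∑ i, inner ℝ (regressorSum x i) (centeredOuter (x i) (e i))| ∂(errorLaw N T σ) := by
          refine integral_mono_of_nonneg (ae_of_all _ fun e => norm_nonneg _)
            (hi1.abs.const_mul _) ?_
          filter_upwards [ae_statistic_eq hx hp hσ b] with e he
          refine (norm_cexp_sub_cexp_le _ _).trans (le_of_eq ?_)
          rw [he, ← abs_of_nonneg (show 0 ≤ T / N / ((T : ℝ) - p) by positivity), ← abs_mul,
            ← abs_mul, ← abs_neg]
          rw [abs_of_nonneg (show 0 ≤ T / N / ((T : ℝ) - p) by positivity)]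
          congr 1
          ring
      _ ≤ _ := by
          rw [integral_const_mul]
          exact mul_le_mul_of_nonneg_left
            ((integral_abs_le_sqrt hi1 hi2).trans (Real.sqrt_le_sqrt hle)) (by positivity)
  refine (norm_sub_le_norm_sub_add_norm_sub _ _ _).trans (add_le_add hrem hmain)

/-- The error terms in `norm_charFun_statistic_sub_le` in terms of `n = √N` and `T`, in the range
`T ≤ 2 m`, where `m = T - p` and hence `κ ≤ 8 / T ^ 2`. -/
lemma charFun_error_le {n T m p κ : ℝ} (hn : 0 < n) (hT : 0 < T) (hm : T ≤ 2 * m) (hp : 0 ≤ p)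
    (hκ : κ = 2 / (m * (m + 2))) (t : ℝ) :
    |t| * (T / n ^ 2 / m) * √(n ^ 2 * (κ * ((n ^ 2) ^ 2 * p))) +
      n ^ 2 * (4 * |t * (T / n ^ 2)| ^ 3 *
          ((n / T * (κ * n ^ 2) + 5 * 15 * (κ * n ^ 2) ^ 2 / (n / T)) / 2) +
        (t * (T / n ^ 2)) ^ 2 / 2 * (n ^ 2 * (κ * ((2 * p + 3) / m)) + 2 * κ * (√κ * n ^ 2)) +
        ((t * (T / n ^ 2)) ^ 2 / 2 * (κ * n ^ 2)) ^ 2) ≤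
      |t| * 2 * √(8 * p) * (T / n)⁻¹ + 9616 * |t| ^ 3 * n⁻¹ +
        t ^ 2 * (8 * (2 * p + 3) + 24) * T⁻¹ + 16 * t ^ 4 * (n⁻¹) ^ 2 := by
  have hm0 : 0 < m := by linarith
  have hκ0 : 0 ≤ κ := by rw [hκ]; positivity
  have hκle : κ ≤ 8 / T ^ 2 := by
    rw [hκ, div_le_div_iff₀ (by positivity) (by positivity)]
    nlinarith
  have hinv : 1 / m ≤ 2 / T := by
    rw [div_le_div_iff₀ hm0 hT]; linarith
  -- `√8 ≤ 3`
  have hsκ : √κ ≤ 3 / T := by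
    refine Real.sqrt_le_iff.2 ⟨by positivity, hκle.trans ?_⟩
    rw [div_pow]
    gcongr
    norm_num
  have h1 : |t| * (T / n ^ 2 / m) * √(n ^ 2 * (κ * ((n ^ 2) ^ 2 * p))) ≤
      |t| * 2 * √(8 * p) * (T / n)⁻¹ := by
    calc _ = |t| * (T / n ^ 2 * (1 / m)) * √(n ^ 2 * (κ * ((n ^ 2) ^ 2 * p))) := by ring
      _ ≤ |t| * (T / n ^ 2 * (2 / T)) * √(n ^ 2 * (8 / T ^ 2 * ((n ^ 2) ^ 2 * p))) := by gcongr
      _ = |t| * (T / n ^ 2 * (2 / T)) * √((n ^ 3 / T) ^ 2 * (8 * p)) := by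
          congr 2; field_simp
      _ = |t| * (T / n ^ 2 * (2 / T)) * (n ^ 3 / T * √(8 * p)) := by
          rw [Real.sqrt_mul (by positivity), Real.sqrt_sq (by positivity)]
      _ = _ := by field_simp
  have h2 : n ^ 2 * (4 * |t * (T / n ^ 2)| ^ 3 *
      ((n / T * (κ * n ^ 2) + 5 * 15 * (κ * n ^ 2) ^ 2 / (n / T)) / 2)) ≤
      9616 * |t| ^ 3 * n⁻¹ := by
    rw [abs_mul, abs_of_pos (show 0 < T / n ^ 2 by positivity)]
    calc _ ≤ n ^ 2 * (4 * (|t| * (T / n ^ 2)) ^ 3 *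
          ((n / T * (8 / T ^ 2 * n ^ 2) + 5 * 15 * (8 / T ^ 2 * n ^ 2) ^ 2 / (n / T)) / 2)) := by
          gcongr
      _ = _ := by field_simp; ring
  have h3 : n ^ 2 * ((t * (T / n ^ 2)) ^ 2 / 2 *
      (n ^ 2 * (κ * ((2 * p + 3) / m)) + 2 * κ * (√κ * n ^ 2))) ≤
      t ^ 2 * (8 * (2 * p + 3) + 24) * T⁻¹ := by
    calc _ = n ^ 2 * ((t * (T / n ^ 2)) ^ 2 / 2 *
      (n ^ 2 * (κ * ((2 * p + 3) * (1 / m))) + 2 * κ * (√κ * n ^ 2))) := by ring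
      _ ≤ n ^ 2 * ((t * (T / n ^ 2)) ^ 2 / 2 *
      (n ^ 2 * (8 / T ^ 2 * ((2 * p + 3) * (2 / T))) + 2 * (8 / T ^ 2) * (3 / T * n ^ 2))) := by
          gcongr
      _ = _ := by field_simp; ring
  have h4 : n ^ 2 * ((t * (T / n ^ 2)) ^ 2 / 2 * (κ * n ^ 2)) ^ 2 ≤ 16 * t ^ 4 * (n⁻¹) ^ 2 := by
    calc _ ≤ n ^ 2 * ((t * (T / n ^ 2)) ^ 2 / 2 * (8 / T ^ 2 * n ^ 2)) ^ 2 := by gcongr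
      _ = _ := by field_simp; ring
  linarith

/-- `T / (T - p + a) → 1` along any sequence `T → ∞`. -/
lemma tendsto_div_sub_add {T : ℕ → ℝ} (hT : Tendsto T atTop atTop) (p a : ℝ) :
    Tendsto (fun N => T N / (T N - p + a)) atTop (𝓝 1) := by
  have h : Tendsto (fun N => (1 + (a - p) * (T N)⁻¹)⁻¹) atTop (𝓝 1) := by
    have := ((hT.inv_tendsto_atTop.const_mul (a - p)).const_add 1).inv₀ (by simp)
    simpa using this
  refine h.congr' ?_
  filter_upwards [hT.eventually_gt_atTop 0] with N hN
  rw [show T N - p + a = T N * (1 + (a - p) * (T N)⁻¹) by field_simp; ring,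
    ← div_div, div_self hN.ne', one_div]

/-- After scaling by `T / N` the variance of the Gaussian comparison tends to one. -/
lemma tendsto_asymptotic_variance {T : ℕ → ℝ} (hT : Tendsto T atTop atTop) (p t : ℝ) :
    Tendsto (fun N : ℕ => (t * (T N / N)) ^ 2 / 2 *
      (2 / ((T N - p) * (T N - p + 2)) * (1 - 1 / (T N - p)) * (N * (N - 1) / 2)))
      atTop (𝓝 (t ^ 2 / 2)) := by
  have h1 := tendsto_div_sub_add hT p 0
  have h2 := tendsto_div_sub_add hT p 2
  have h3 : Tendsto (fun N => 1 - 1 / (T N - p)) atTop (𝓝 1) := by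
    have : Tendsto (fun N => (T N - p)⁻¹) atTop (𝓝 0) :=
      (tendsto_atTop_add_const_right atTop (-p) hT).inv_tendsto_atTop
    simpa [one_div] using this.const_sub 1
  have h4 : Tendsto (fun N : ℕ => 1 - (N : ℝ)⁻¹) atTop (𝓝 1) := by
    simpa using (tendsto_inv_atTop_nhds_zero_nat (𝕜 := ℝ)).const_sub 1
  have h := (((h1.mul h2).mul h3).mul h4).const_mul (t ^ 2 / 2)
  simp only [mul_one] at h
  refine h.congr' ?_
  filter_upwards [eventually_gt_atTop 0] with N hN
  have hN' : (N : ℝ) ≠ 0 := by positivity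
  rw [add_zero, show (1 : ℝ) - (N : ℝ)⁻¹ = (N - 1) / N by field_simp]
  rw [div_mul_eq_mul_div (2 : ℝ), div_mul_eq_mul_div, div_mul_div_comm]
  field_simp

end

theorem theorem1
    (p : ℕ) (T : ℕ → ℕ)
    (hT : Tendsto (fun N : ℕ => (T N : ℝ) / √(N : ℝ)) atTop atTop)
    (x : ∀ N : ℕ, Fin N → Matrix (Fin (T N)) (Fin p) ℝ)
    (hx : ∀ N i, IsUnit ((x N i)ᵀ * x N i))
    (β : ∀ N : ℕ, Fin N → Fin p → ℝ)
    (σ : ∀ N : ℕ, Fin N → ℝ) (hσ : ∀ N i, 0 < σ N i)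
    {Ω : ℕ → Type*} [∀ N, MeasurableSpace (Ω N)]
    (P : ∀ N, Measure (Ω N)) [∀ N, IsProbabilityMeasure (P N)]
    (ε : ∀ N : ℕ, Fin N → Ω N → EuclideanSpace ℝ (Fin (T N)))
    (hε_law : ∀ N i,
      HasLaw (ε N i) (multivariateGaussian 0 (σ N i ^ 2 • (1 : Matrix _ _ ℝ))) (P N))
    (hε_indep : ∀ N, iIndepFun (ε N) (P N))
    (y : ∀ N : ℕ, Fin N → Ω N → Fin (T N) → ℝ)
    (hy : ∀ N i ω t, y N i ω t = x N i t ⬝ᵥ β N i + ε N i ω t) :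
    TendstoInDistribution
      (fun (N : ℕ) (ω : Ω N) =>
        (PanelData.sumStat (x N) (fun i => y N i ω) - PanelData.centering (x N)) / (N : ℝ))
      atTop (id : ℝ → ℝ) P (gaussianReal 0 1) := by
  have hεm : ∀ N i, AEMeasurable (ε N i) (P N) := fun N i => (hε_law N i).aemeasurable
  have hεm' : ∀ N, AEMeasurable (fun ω i => ε N i ω) (P N) := fun N =>
    aemeasurable_pi_lambda _ (hεm N)
  have hlaw : ∀ N, (P N).map (fun ω i => ε N i ω) = errorLaw N (T N) (σ N) := fun N => by
    rw [(hε_indep N).map_fun_eq_pi_map (hεm N), errorLaw]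
    simp_rw [(hε_law N _).map_eq]
  obtain rfl : y = fun N i ω t => x N i t ⬝ᵥ β N i + ε N i ω t := by
    funext N i ω t
    exact hy N i ω t
  have hSm : ∀ N, AEMeasurable (fun ω : Ω N =>
      (PanelData.sumStat (x N) (fun i t => x N i t ⬝ᵥ β N i + ε N i ω t) -
        PanelData.centering (x N)) / (N : ℝ)) (P N) := fun N =>
    (measurable_statistic (x N) (β N)).comp_aemeasurable (hεm' N)
  -- the hypothesis forces `T N → ∞`
  have hsqrt : Tendsto (fun N : ℕ => √(N : ℝ)) atTop atTop :=
    Real.tendsto_sqrt_atTop.comp tendsto_natCast_atTop_atTop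
  have hTT : Tendsto (fun N => (T N : ℝ)) atTop atTop := by
    refine (hT.atTop_mul_atTop₀ hsqrt).congr' ?_
    filter_upwards [hsqrt.eventually_gt_atTop 0] with N hN
    exact div_mul_cancel₀ _ hN.ne'
  refine ⟨hSm, aemeasurable_id, ?_⟩
  refine ProbabilityMeasure.tendsto_iff_tendsto_charFun.2 fun t => ?_
  have hchar : ∀ N, charFun ((P N).map (fun ω : Ω N =>
      (PanelData.sumStat (x N) (fun i t => x N i t ⬝ᵥ β N i + ε N i ω t) -
        PanelData.centering (x N)) / (N : ℝ))) t =
      ∫ e, Complex.exp ((t * ((PanelData.sumStat (x N) (fun i s => x N i s ⬝ᵥ β N i + e i s) -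
        PanelData.centering (x N)) / (N : ℝ)) : ℝ) * Complex.I) ∂(errorLaw N (T N) (σ N)) := by
    intro N
    rw [charFun_apply_real, ← hlaw N, integral_map (hεm' N), integral_map (hSm N)]
    · simp only [Complex.ofReal_mul]
    · fun_prop
    · exact (Complex.measurable_exp.comp ((Complex.measurable_ofReal.comp
        ((measurable_statistic (x N) (β N)).const_mul t)).mul_const _)).aestronglyMeasurable
  have hlim : Tendsto (fun N : ℕ => ((Real.exp (-((t * ((T N : ℝ) / N)) ^ 2 / 2 *
      (2 / (((T N : ℝ) - p) * ((T N : ℝ) - p + 2)) * (1 - 1 / ((T N : ℝ) - p)) *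
        (N * (N - 1) / 2)))) : ℝ) : ℂ)) atTop (𝓝 ((Real.exp (-(t ^ 2 / 2)) : ℝ) : ℂ)) :=
    (Complex.continuous_ofReal.tendsto _).comp ((Real.continuous_exp.tendsto _).comp
      (tendsto_asymptotic_variance hTT p t).neg)
  have herr : Tendsto (fun N : ℕ => |t| * 2 * √(8 * p) * ((T N : ℝ) / √N)⁻¹ +
      9616 * |t| ^ 3 * (√(N : ℝ))⁻¹ + t ^ 2 * (8 * (2 * p + 3) + 24) * (T N : ℝ)⁻¹ +
        16 * t ^ 4 * ((√(N : ℝ))⁻¹) ^ 2) atTop (𝓝 0) := by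
    have h := (((hT.inv_tendsto_atTop.const_mul (|t| * 2 * √(8 * p))).add
      (hsqrt.inv_tendsto_atTop.const_mul (9616 * |t| ^ 3))).add
      (hTT.inv_tendsto_atTop.const_mul (t ^ 2 * (8 * (2 * p + 3) + 24)))).add
      ((hsqrt.inv_tendsto_atTop.pow 2).const_mul (16 * t ^ 4))
    simpa using h
  have hdiff := squeeze_zero_norm' (f := fun N => charFun ((P N).map (fun ω : Ω N =>
      (PanelData.sumStat (x N) (fun i t => x N i t ⬝ᵥ β N i + ε N i ω t) -
        PanelData.centering (x N)) / (N : ℝ))) t -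
      ((Real.exp (-((t * ((T N : ℝ) / N)) ^ 2 / 2 *
      (2 / (((T N : ℝ) - p) * ((T N : ℝ) - p + 2)) * (1 - 1 / ((T N : ℝ) - p)) *
        (N * (N - 1) / 2)))) : ℝ) : ℂ)) ?_ herr
  · have h := hdiff.add hlim
    simp only [sub_add_cancel, zero_add] at h
    have hg : charFun ((gaussianReal 0 1).map (id : ℝ → ℝ)) t =
        ((Real.exp (-(t ^ 2 / 2)) : ℝ) : ℂ) := by
      rw [Measure.map_id, charFun_gaussianReal]
      push_cast
      congr 1
      simp
    change Tendsto _ _ (𝓝 (charFun ((gaussianReal 0 1).map (id : ℝ → ℝ)) t))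
    rw [hg]
    exact h
  -- for `T > 2 p` the degrees of freedom `T - p` are at least `T / 2`
  · filter_upwards [eventually_gt_atTop 0, hTT.eventually_gt_atTop (2 * p : ℝ),
      hTT.eventually_gt_atTop 0] with N hN hpT hT0
    have hp0 : (0 : ℝ) ≤ p := Nat.cast_nonneg p
    have hpT' : p < T N := by
      have : (p : ℝ) < T N := by linarith
      exact_mod_cast this
    rw [hchar N]
    refine (norm_charFun_statistic_sub_le (hx N) hN hpT' (hσ N) (β N) t rfl).trans ?_
    have hNr : (0 : ℝ) < N := by exact_mod_cast hN
    have h := charFun_error_le (n := √N) (T := T N) (m := (T N : ℝ) - p) (p := p)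
      (Real.sqrt_pos.2 hNr) hT0 (by linarith) hp0 rfl t
    rw [Real.sq_sqrt hNr.le] at h
    exact h
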